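/- Let $0\le h\le n$ be integers, and let $M$ be a closed (compact, without boundary) smooth manifold of dimension $2n+2$. A pair $(\xi,\sigma)$ of hyperplane fields on $M$ is called a contact-contact structure of type $(h,n-h)$ if there are smooth one-forms $\alpha,\beta$ on $M$ with $\xi=\operatorname{Ker}\alpha$ and $\sigma=\operatorname{Ker}\beta$ such that $\alpha\wedge(d\alpha)^h\wedge\beta\wedge(d\beta)^{n-h}$ vanishes nowhere, $\alpha\wedge(d\alpha)^{h+1}=0$ and $\beta\wedge(d\beta)^{n-h+1}=0$. Let $\alpha_t,\beta_t$, $t\in[0,1]$, be families of one-forms on $M$, smooth on $[0,1]\times M$, such that for every $t$ the pair $(\operatorname{Ker}\alpha_t,\operatorname{Ker}\beta_t)$ is a contact-contact structure of type $(h,n-h)$, and such that the kernel foliations $\mathcal F=\operatorname{Ker}(\alpha_t\wedge(d\alpha_t)^h)$ and $\mathcal G=\operatorname{Ker}(\beta_t\wedge(d\beta_t)^{n-h})$ (where $\operatorname{Ker}\omega$ is the set of tangent vectors $v$ with $i_v\omega=0$) do not depend on $t\in[0,1]$. Then there exist an isotopy $\varphi_t$, $t\in[0,1]$, of $M$ (diffeomorphisms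 of $M$ depending smoothly on $t$, that is, smooth on $[0,1]\times M$, with $\varphi_0=\mathrm{id}$) and nowhere vanishing functions $f_t,g_t$ on $M$, smooth on $[0,1]\times M$, such that $$\varphi_t^*\alpha_t=f_t\,\alpha_0\qquad\text{and}\qquad \varphi_t^*\beta_t=g_t\,\beta_0\qquad\text{for all } t\in[0,1].$$ -/

import Mathlib

open Set Bundle
open scoped Manifold ContDiff Topology

noncomputable section

/-! ### Exterior algebra on a real vector space -/

namespace ExtAlg

/-- The wedge product of alternating forms: the sum over shuffles of the products, so that
`(a ∧ b)(u, v) = a u * b v - a v * b u` for two one-forms. -/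
def wedge {V : Type*} [AddCommGroup V] [Module ℝ V] {k l : ℕ}
    (a : V [⋀^Fin k]→ₗ[ℝ] ℝ) (b : V [⋀^Fin l]→ₗ[ℝ] ℝ) : V [⋀^Fin (k + l)]→ₗ[ℝ] ℝ :=
  ((LinearMap.mul' ℝ ℝ).compAlternatingMap (a.domCoprod b)).domDomCongr finSumFinEquiv

/-- The `r`-th exterior power `η ∧ ⋯ ∧ η` of a two-form; the `0`-th power is the constant `1`. -/
def wedgePow {V : Type*} [AddCommGroup V] [Module ℝ V]
    (η : V [⋀^Fin 2]→ₗ[ℝ] ℝ) : (r : ℕ) → V [⋀^Fin (2 * r)]→ₗ[ℝ] ℝ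
  | 0 => AlternatingMap.constOfIsEmpty ℝ V (Fin 0) (1 : ℝ)
  | r + 1 => wedge (wedgePow η r) η

/-- The kernel `{v | i_v η = 0}` of an alternating form. -/
def ker {V : Type*} [AddCommGroup V] [Module ℝ V] {k : ℕ}
    (η : V [⋀^Fin k]→ₗ[ℝ] ℝ) : Submodule ℝ V where
  carrier := {v | ∀ (w : Fin k → V) (i : Fin k), η (Function.update w i v) = 0}
  zero_mem' := fun w i => η.map_update_zero w i
  add_mem' := fun {u v} hu hv w i => by
    rw [η.map_update_add, hu w i, hv w i, add_zero]
  smul_mem' := fun c v hv w i => by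
    rw [η.map_update_smul, hv w i, smul_zero]

end ExtAlg

/-! ### Differential one-forms on an `m`-dimensional manifold -/

/-- A (not necessarily smooth) differential one-form on the `m`-dimensional manifold `M`. -/
abbrev OneForm (m : ℕ) (M : Type*) [TopologicalSpace M]
    [ChartedSpace (EuclideanSpace ℝ (Fin m)) M] : Type _ :=
  (p : M) → (TangentSpace (𝓡 m) p →L[ℝ] ℝ)

/-- A (not necessarily smooth) field of tangent subspaces. -/
abbrev TangentSubspaceField (m : ℕ) (M : Type*) [TopologicalSpace M]
    [ChartedSpace (EuclideanSpace ℝ (Fin m)) M] : Type _ :=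
  (p : M) → Submodule ℝ (TangentSpace (𝓡 m) p)

namespace OneForm

variable {m : ℕ} {M : Type*} [TopologicalSpace M] [ChartedSpace (EuclideanSpace ℝ (Fin m)) M]

/-- Smoothness of a one-form, as a section of the cotangent bundle. -/
def IsSmooth [IsManifold (𝓡 m) ∞ M] (α : OneForm m M) : Prop :=
  ContMDiff (𝓡 m) ((𝓡 m).prod 𝓘(ℝ, EuclideanSpace ℝ (Fin m) →L[ℝ] ℝ)) ∞
    (fun p : M => TotalSpace.mk' (EuclideanSpace ℝ (Fin m) →L[ℝ] ℝ)
      (E := fun p : M => TangentSpace (𝓡 m) p →L[ℝ] Trivial M ℝ p) p (α p))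

/-- Smoothness on `[0, 1] × M` of a family of one-forms `α t`, `t ∈ [0, 1]`
(values at `t ∉ [0, 1]` are irrelevant). -/
def IsSmoothFamily [IsManifold (𝓡 m) ∞ M] (α : ℝ → OneForm m M) : Prop :=
  ContMDiffOn (𝓘(ℝ, ℝ).prod (𝓡 m)) ((𝓡 m).prod 𝓘(ℝ, EuclideanSpace ℝ (Fin m) →L[ℝ] ℝ)) ∞
    (fun x : ℝ × M => TotalSpace.mk' (EuclideanSpace ℝ (Fin m) →L[ℝ] ℝ)
      (E := fun p : M => TangentSpace (𝓡 m) p →L[ℝ] Trivial M ℝ p) x.2 (α x.1 x.2))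
    (Icc (0 : ℝ) 1 ×ˢ (univ : Set M))

/-- The coordinate expression of a one-form in the preferred chart around `p₀`, i.e. its pull-back
under the inverse of that chart. -/
def inChart (α : OneForm m M) (p₀ : M) (y : EuclideanSpace ℝ (Fin m)) :
    EuclideanSpace ℝ (Fin m) →L[ℝ] ℝ :=
  (α ((extChartAt (𝓡 m) p₀).symm y)).comp
    (mfderiv 𝓘(ℝ, EuclideanSpace ℝ (Fin m)) (𝓡 m) (extChartAt (𝓡 m) p₀).symm y)

/-- The exterior derivative, at the image of `p`, of the coordinate expression of `α` in the preferred
chart around `p`. -/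
def dInChart (α : OneForm m M) (p : M) : EuclideanSpace ℝ (Fin m) [⋀^Fin 2]→L[ℝ] ℝ :=
  extDeriv (fun y => ContinuousAlternatingMap.ofSubsingleton ℝ (EuclideanSpace ℝ (Fin m)) ℝ
    (0 : Fin 1) (α.inChart p y)) (extChartAt (𝓡 m) p p)

/-- The differential at `p` of the preferred chart around `p`. -/
def chartDeriv (p : M) : TangentSpace (𝓡 m) p →L[ℝ] EuclideanSpace ℝ (Fin m) :=
  mfderiv (𝓡 m) 𝓘(ℝ, EuclideanSpace ℝ (Fin m)) (extChartAt (𝓡 m) p) p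

/-- The exterior derivative `dα` at `p`: take the coordinate expression of `α` in the chart around
`p`, differentiate it, and pull the resulting two-form back to the manifold. -/
def d (α : OneForm m M) (p : M) : TangentSpace (𝓡 m) p [⋀^Fin 2]→L[ℝ] ℝ :=
  (α.dInChart p).compContinuousLinearMap (chartDeriv p)

/-- The form `α ∧ (dα) ^ r` at the point `p`. -/
def wedgePowD (α : OneForm m M) (r : ℕ) (p : M) :
    TangentSpace (𝓡 m) p [⋀^Fin (1 + 2 * r)]→ₗ[ℝ] ℝ :=
  ExtAlg.wedge (AlternatingMap.ofSubsingleton ℝ (TangentSpace (𝓡 m) p) ℝ (0 : Fin 1)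
    (α p : TangentSpace (𝓡 m) p →ₗ[ℝ] ℝ)) (ExtAlg.wedgePow (α.d p).toAlternatingMap r)

/-- The field of subspaces `Ker α`. -/
def kernelField (α : OneForm m M) : TangentSubspaceField m M :=
  fun p => LinearMap.ker (α p : TangentSpace (𝓡 m) p →ₗ[ℝ] ℝ)

/-- The tangent distribution `Ker (α ∧ (dα) ^ r)`. -/
def charDistribution (α : OneForm m M) (r : ℕ) : TangentSubspaceField m M :=
  fun p => ExtAlg.ker (α.wedgePowD r p)

/-- The pull-back `φ^* α`. -/
def pullback (φ : M → M) (α : OneForm m M) : OneForm m M :=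
  fun p => (α (φ p)).comp (mfderiv (𝓡 m) (𝓡 m) φ p)

end OneForm

/-- `(ξ, σ)` is a contact-contact structure of type `(h, k)` (on a manifold of dimension
`m = 2 * h + 2 * k + 2`): the fields `ξ`, `σ` are the kernels of smooth one-forms `α`, `β` such that
`α ∧ (dα)^h ∧ β ∧ (dβ)^k` vanishes nowhere, `α ∧ (dα)^(h+1) = 0` and `β ∧ (dβ)^(k+1) = 0`. -/
def IsContactContactStructure {m : ℕ} {M : Type*} [TopologicalSpace M]
    [ChartedSpace (EuclideanSpace ℝ (Fin m)) M] [IsManifold (𝓡 m) ∞ M]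
    (h k : ℕ) (ξ σ : TangentSubspaceField m M) : Prop :=
  ∃ α β : OneForm m M, α.IsSmooth ∧ β.IsSmooth ∧ α.kernelField = ξ ∧ β.kernelField = σ ∧
    ∀ p : M, ExtAlg.wedge (α.wedgePowD h p) (β.wedgePowD k p) ≠ 0 ∧
      α.wedgePowD (h + 1) p = 0 ∧ β.wedgePowD (k + 1) p = 0

/-- `φ t`, `t ∈ [0, 1]`, is an isotopy of `M`: a family of diffeomorphisms, smooth on `[0, 1] × M`
and starting at the identity (values at `t ∉ [0, 1]` are irrelevant). -/
structure IsIsotopy {m : ℕ} {M : Type*} [TopologicalSpace M]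
    [ChartedSpace (EuclideanSpace ℝ (Fin m)) M] (φ : ℝ → M → M) : Prop where
  zero : φ 0 = id
  smooth : ContMDiffOn (𝓘(ℝ, ℝ).prod (𝓡 m)) (𝓡 m) ∞ (fun x : ℝ × M => φ x.1 x.2)
    (Icc (0 : ℝ) 1 ×ˢ (univ : Set M))
  diffeo : ∀ t ∈ Icc (0 : ℝ) 1, ∃ ψ : M ≃ₘ^∞⟮𝓡 m, 𝓡 m⟯ M, ⇑ψ = φ t

/-- A family `f t`, `t ∈ [0, 1]`, of nowhere vanishing functions, smooth on `[0, 1] × M`. -/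
def IsSmoothNonvanishingFamily {m : ℕ} {M : Type*} [TopologicalSpace M]
    [ChartedSpace (EuclideanSpace ℝ (Fin m)) M] (f : ℝ → M → ℝ) : Prop :=
  ContMDiffOn (𝓘(ℝ, ℝ).prod (𝓡 m)) 𝓘(ℝ, ℝ) ∞ (fun x : ℝ × M => f x.1 x.2)
    (Icc (0 : ℝ) 1 ×ˢ (univ : Set M)) ∧
  ∀ t ∈ Icc (0 : ℝ) 1, ∀ p, f t p ≠ 0

end

/-! This is Moser's trick, with one vector field serving both forms. If φ_t is the flow of X_t and
α_t(X_t) = 0, Cartan's formula gives (d/dt) φ_t^*α_t = φ_t^*(i_X dα_t + ∂_t α_t). So it suffices to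
solve i_X dα = c α - ∂_t α and i_X dβ = c' β - ∂_t β with α(X) = β(X) = 0: then each φ_t^*α_t
satisfies u' = c(t, φ_t) u and equals α_0 times the exponential of the integral of c along the flow,
and likewise for β (`OneForm.hasDerivWithinAt_pullback`, `eq_exp_mul_of_hasDerivWithinAt`).

The equations are linear and pointwise. Let C_α be the space of vectors of Ker α that are
dα-orthogonal to Ker α. It lies in Ker(α ∧ dα^h), so the nonvanishing top-degree form forces C_α ∩
C_β = 0. The condition α ∧ dα^(h+1) = 0 bounds the rank of dα on Ker α by 2h, so C_α has codimension
at most 2h + 1. Counting dimensions, TM = C_α ⊕ C_β (`ExtAlg.isCompl_charSpace`). Hence dα is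
nondegenerate on C_β ∩ Ker α, a complement of C_α in Ker α, and i_X₁ dα = -∂_t α on Ker α has a
solution X₁ there provided that ∂_t α vanishes on C_α. The constancy of the foliation gives this:
C_{α_t} ⊆ Ker(α_t ∧ dα_t^h) = Ker(α_s ∧ dα_s^h) ⊆ Ker α_s for every s. Since X₁ lies in C_β, it does
not disturb the β-equation on Ker β; with the symmetric X₂, the sum X₁ + X₂ solves both
(`ExtAlg.exists_moser`). The solution is unique, hence smooth in (t, p)
(`contDiffOn_of_linear_system`).

The forms witnessing the contact-contact condition need not be α_t and β_t themselves. Forms with a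
common kernel have proportional exterior derivatives on it, which is enough to transfer the
conclusions (`OneForm.isCompl_charField`).

The flow has to be smooth up to the ends of [0, 1]. The manifold is embedded in a vector space with
local retractions, the field is extended with compact support, and the equation is solved there.
Solutions starting on the image stay on it (`RetractedEmbedding.mem_range`), and smooth dependence
on initial values comes from iterating the linearized equation (`UnitODE.contDiffOn_solution`). -/

section

/-! ### Exterior algebra: shuffles, kernels, products with a linear form -/

namespace ExtAlg

section Wedge

variable {V W : Type*} [AddCommGroup V] [Module ℝ V] [AddCommGroup W] [Module ℝ W] {k l : ℕ}

/-- The contribution of a shuffle to the wedge product. -/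
noncomputable def shuffleTerm (a : V [⋀^Fin k]→ₗ[ℝ] ℝ) (b : V [⋀^Fin l]→ₗ[ℝ] ℝ)
    (w : Fin k ⊕ Fin l → V) (σ : Equiv.Perm.ModSumCongr (Fin k) (Fin l)) : ℝ :=
  LinearMap.mul' ℝ ℝ (AlternatingMap.domCoprod.summand a b σ w)

theorem shuffleTerm_mk (a : V [⋀^Fin k]→ₗ[ℝ] ℝ) (b : V [⋀^Fin l]→ₗ[ℝ] ℝ)
    (w : Fin k ⊕ Fin l → V) (σ : Equiv.Perm (Fin k ⊕ Fin l)) :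
    shuffleTerm a b w (Quotient.mk'' σ) =
      ((Equiv.Perm.sign σ : ℤ) : ℝ) *
        (a (fun i => w (σ (Sum.inl i))) * b (fun i => w (σ (Sum.inr i)))) := by
  rw [shuffleTerm, AlternatingMap.domCoprod.summand_mk'']
  rcases Int.units_eq_one_or (Equiv.Perm.sign σ) with h | h <;> rw [h] <;>
    simp [MultilinearMap.domDomCongr_apply, MultilinearMap.domCoprod_apply]

theorem wedge_apply (a : V [⋀^Fin k]→ₗ[ℝ] ℝ) (b : V [⋀^Fin l]→ₗ[ℝ] ℝ) (v : Fin (k + l) → V) :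
    wedge a b v = ∑ σ, shuffleTerm a b (v ∘ finSumFinEquiv) σ := by
  simp [wedge, AlternatingMap.domCoprod_apply, shuffleTerm]

theorem wedge_apply_eq_zero (a : V [⋀^Fin k]→ₗ[ℝ] ℝ) (b : V [⋀^Fin l]→ₗ[ℝ] ℝ)
    (v : Fin (k + l) → V)
    (h : ∀ σ : Equiv.Perm (Fin k ⊕ Fin l), a (fun i => v (finSumFinEquiv (σ (Sum.inl i)))) *
      b (fun i => v (finSumFinEquiv (σ (Sum.inr i)))) = 0) : wedge a b v = 0 := by
  rw [wedge_apply]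
  refine Finset.sum_eq_zero fun σ _ => ?_
  induction σ using Quotient.inductionOn' with | _ σ
  rw [shuffleTerm_mk]
  simp only [Function.comp_apply, h, mul_zero]

/-- Two permutations with the same image of the first block differ by a permutation preserving both
blocks, so they define the same shuffle. -/
theorem mk_eq_mk_of_inl (σ τ : Equiv.Perm (Fin k ⊕ Fin l))
    (h : ∀ i, ∃ j, σ (Sum.inl i) = τ (Sum.inl j)) :
    (Quotient.mk'' σ : Equiv.Perm.ModSumCongr (Fin k) (Fin l)) = Quotient.mk'' τ := by
  refine (Quotient.sound' ?_).symm
  rw [QuotientGroup.leftRel_apply]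
  refine Equiv.Perm.mem_sumCongrHom_range_of_perm_mapsTo_inl ?_
  rintro _ ⟨i, rfl⟩
  obtain ⟨j, hj⟩ := h i
  exact ⟨j, by simp [hj]⟩

theorem wedge_apply_eq_mul (a : V [⋀^Fin k]→ₗ[ℝ] ℝ) (b : V [⋀^Fin l]→ₗ[ℝ] ℝ)
    (v : Fin (k + l) → V)
    (h : ∀ σ : Equiv.Perm (Fin k ⊕ Fin l), a (fun i => v (finSumFinEquiv (σ (Sum.inl i)))) *
      b (fun i => v (finSumFinEquiv (σ (Sum.inr i)))) ≠ 0 →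
        ∀ i, ∃ j, σ (Sum.inl i) = Sum.inl j) :
    wedge a b v = a (fun i => v (Fin.castAdd l i)) * b (fun i => v (Fin.natAdd k i)) := by
  rw [wedge_apply]
  refine (Finset.sum_eq_single (Quotient.mk'' 1 : Equiv.Perm.ModSumCongr (Fin k) (Fin l))
    ?_ ?_).trans ?_
  · intro σ _ hσ
    induction σ using Quotient.inductionOn' with | _ σ
    rw [shuffleTerm_mk]
    by_contra hne
    exact hσ (mk_eq_mk_of_inl σ 1 (by simpa using h σ (right_ne_zero_of_mul hne)))
  · simp
  · rw [shuffleTerm_mk]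
    simp

theorem wedge_compLinearMap (a : V [⋀^Fin k]→ₗ[ℝ] ℝ) (b : V [⋀^Fin l]→ₗ[ℝ] ℝ) (f : W →ₗ[ℝ] V) :
    wedge (a.compLinearMap f) (b.compLinearMap f) = (wedge a b).compLinearMap f := by
  ext v
  rw [AlternatingMap.compLinearMap_apply, wedge_apply, wedge_apply]
  refine Finset.sum_congr rfl fun σ _ => ?_
  induction σ using Quotient.inductionOn' with | _ σ
  rw [shuffleTerm_mk, shuffleTerm_mk]
  rfl

theorem wedge_smul_smul (a : V [⋀^Fin k]→ₗ[ℝ] ℝ) (b : V [⋀^Fin l]→ₗ[ℝ] ℝ) (c d : ℝ) :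
    wedge (c • a) (d • b) = (c * d) • wedge a b := by
  ext v
  rw [AlternatingMap.smul_apply, wedge_apply, wedge_apply, Finset.smul_sum]
  refine Finset.sum_congr rfl fun σ _ => ?_
  induction σ using Quotient.inductionOn' with | _ σ
  rw [shuffleTerm_mk, shuffleTerm_mk]
  simp only [AlternatingMap.smul_apply, smul_eq_mul]
  ring

theorem wedge_zero_left (b : V [⋀^Fin l]→ₗ[ℝ] ℝ) :
    wedge (0 : V [⋀^Fin k]→ₗ[ℝ] ℝ) b = 0 := by
  simpa using wedge_smul_smul (0 : V [⋀^Fin k]→ₗ[ℝ] ℝ) b 0 1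

theorem wedge_zero_right (a : V [⋀^Fin k]→ₗ[ℝ] ℝ) :
    wedge a (0 : V [⋀^Fin l]→ₗ[ℝ] ℝ) = 0 := by
  simpa using wedge_smul_smul a (0 : V [⋀^Fin l]→ₗ[ℝ] ℝ) 1 0

theorem wedgePow_compLinearMap (η : V [⋀^Fin 2]→ₗ[ℝ] ℝ) (f : W →ₗ[ℝ] V) (r : ℕ) :
    wedgePow (η.compLinearMap f) r = (wedgePow η r).compLinearMap f := by
  induction r with
  | zero => ext v; simp [wedgePow]
  | succ r ih => simp only [wedgePow, ih, wedge_compLinearMap]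

theorem wedgePow_smul (η : V [⋀^Fin 2]→ₗ[ℝ] ℝ) (c : ℝ) (r : ℕ) :
    wedgePow (c • η) r = c ^ r • wedgePow η r := by
  induction r with
  | zero => simp [wedgePow]
  | succ r ih => simp only [wedgePow, ih, wedge_smul_smul, pow_succ]

theorem apply_eq_zero_of_mem_ker {a : V [⋀^Fin k]→ₗ[ℝ] ℝ} {v : V} (hv : v ∈ ker a)
    (w : Fin k → V) (i : Fin k) (hi : w i = v) : a w = 0 := by
  have := hv w i
  rwa [← hi, Function.update_eq_self] at this

theorem ker_inf_ker_le (a : V [⋀^Fin k]→ₗ[ℝ] ℝ) (b : V [⋀^Fin l]→ₗ[ℝ] ℝ) :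
    ker a ⊓ ker b ≤ ker (wedge a b) := by
  rintro v ⟨ha, hb⟩ w i
  refine wedge_apply_eq_zero a b _ fun σ => ?_
  obtain ⟨j, hj⟩ : ∃ j, finSumFinEquiv (σ j) = i := ⟨σ.symm (finSumFinEquiv.symm i), by simp⟩
  rcases j with j | j
  · rw [apply_eq_zero_of_mem_ker ha _ j (by simp [hj]), zero_mul]
  · rw [apply_eq_zero_of_mem_ker hb _ j (by simp [hj]), mul_zero]

/-- Inserting `v` into slot `i` of a basis `b` leaves the `i`-th coordinate of `v` times `η b`, and
`η b ≠ 0` because a form of top degree is determined by its value on a basis. -/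
theorem ker_eq_bot_of_finrank [FiniteDimensional ℝ V] {η : V [⋀^Fin k]→ₗ[ℝ] ℝ}
    (hk : Module.finrank ℝ V = k) (hη : η ≠ 0) : ker η = ⊥ := by
  rw [eq_bot_iff]
  intro v hv
  let b := Module.finBasisOfFinrankEq ℝ V hk
  have hb : η b ≠ 0 := fun h => hη ((η.map_basis_eq_zero_iff b).1 h)
  rw [Submodule.mem_bot, ← b.forall_coord_eq_zero_iff]
  intro i
  have h := hv b i
  rw [← b.sum_repr v, η.map_update_sum, Finset.sum_eq_single i] at h
  · rw [η.map_update_smul, Function.update_eq_self, smul_eq_mul] at h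
    simpa [hb] using h
  · intro j _ hj
    rw [η.map_update_smul, η.map_update_self b (Ne.symm hj), smul_zero]
  · simp

end Wedge

section OneForm

variable {V : Type*} [AddCommGroup V] [Module ℝ V] {l : ℕ}

/-- The product `a ∧ θ` of a linear form and an alternating form. -/
noncomputable abbrev oneWedge (a : V →ₗ[ℝ] ℝ) (θ : V [⋀^Fin l]→ₗ[ℝ] ℝ) :
    V [⋀^Fin (1 + l)]→ₗ[ℝ] ℝ :=
  wedge (AlternatingMap.ofSubsingleton ℝ V ℝ (0 : Fin 1) a) θ

theorem oneWedge_apply_append (a : V →ₗ[ℝ] ℝ) (θ : V [⋀^Fin l]→ₗ[ℝ] ℝ) (u : V) (w : Fin l → V)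
    (hw : ∀ i, a (w i) = 0) :
    oneWedge a θ (Fin.append (fun _ => u) w) = a u * θ w := by
  rw [oneWedge, wedge_apply_eq_mul]
  · simp
  · intro σ hσ i
    rcases hj : σ (Sum.inl i) with j | j
    · exact ⟨j, rfl⟩
    · refine absurd ?_ (left_ne_zero_of_mul hσ)
      have : i = 0 := Subsingleton.elim _ _
      subst this
      simp [hj, hw]

/-- With `a u = 1`, split each argument as `a (w i) • u` plus a vector of `ker a` and expand. Terms
with two multiples of `u` vanish; in the others `a` must receive the multiple of `u`, so `θ` only
sees vectors of `ker a`. Arguments already in `ker a` are unchanged by the splitting and all reach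
`θ`; the range condition in `H` records this. -/
theorem oneWedge_apply_eq_zero (a : V →ₗ[ℝ] ℝ) (θ : V [⋀^Fin l]→ₗ[ℝ] ℝ) (w : Fin (1 + l) → V)
    (H : ∀ w' : Fin l → V, (∀ i, a (w' i) = 0) → (∀ i, a (w i) = 0 → w i ∈ range w') → θ w' = 0) :
    oneWedge a θ w = 0 := by
  by_cases ha : a = 0
  · subst ha
    exact wedge_apply_eq_zero _ _ _ fun σ => by simp
  obtain ⟨u, hu⟩ : ∃ u, a u = 1 := by
    obtain ⟨u, hu⟩ : ∃ u, a u ≠ 0 := by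
      by_contra! h
      exact ha (LinearMap.ext h)
    exact ⟨(a u)⁻¹ • u, by simp [hu]⟩
  set p : Fin (1 + l) → V := fun i => w i - a (w i) • u with hp
  have hap : ∀ i, a (p i) = 0 := fun i => by simp [hp, hu]
  have hw : w = (fun i => a (w i) • u) + p := by ext i; simp [hp]
  rw [hw, ← AlternatingMap.coe_multilinearMap, MultilinearMap.map_add_univ]
  refine Finset.sum_eq_zero fun s _ => ?_
  rw [AlternatingMap.coe_multilinearMap]
  by_cases hs : ∃ i ∈ s, ∃ j ∈ s, i ≠ j
  · obtain ⟨i, hi, j, hj, hij⟩ := hs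
    have h1 : s.piecewise (fun i => a (w i) • u) p =
        fun m => s.piecewise (fun i => a (w i)) 1 m • s.piecewise (fun _ => u) p m := by
      ext m
      by_cases hm : m ∈ s <;> simp [hm]
    rw [h1, AlternatingMap.map_smul_univ,
      AlternatingMap.map_eq_zero_of_eq _ _ (i := i) (j := j) (by simp [hi, hj]) hij, smul_zero]
  push Not at hs
  refine wedge_apply_eq_zero _ _ _ fun σ => ?_
  rw [mul_eq_zero, or_iff_not_imp_left]
  intro h0
  have h0s : finSumFinEquiv (σ (Sum.inl 0)) ∈ s := by
    by_contra hc
    exact h0 (by simp [hc, hap])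
  have hout : ∀ i, finSumFinEquiv (σ (Sum.inr i)) ∉ s := fun i hi => by
    simpa using hs _ h0s _ hi
  have hin : ∀ i, i ≠ finSumFinEquiv (σ (Sum.inl 0)) →
      ∃ j, i = finSumFinEquiv (σ (Sum.inr j)) := by
    intro i hi
    obtain ⟨j, rfl⟩ : ∃ j, i = finSumFinEquiv (σ j) :=
      ⟨σ.symm (finSumFinEquiv.symm i), by simp⟩
    rcases j with j | j
    · exact absurd (by rw [Subsingleton.elim j 0]) hi
    · exact ⟨j, rfl⟩
  refine H _ (fun i => by simp [hout, hap]) fun i hi => ?_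
  have hi0 : i ≠ finSumFinEquiv (σ (Sum.inl 0)) := by
    rintro rfl
    exact h0 (by simp [h0s, hi])
  obtain ⟨j, rfl⟩ := hin i hi0
  exact ⟨j, by simp [hout, hp, hi]⟩

theorem oneWedge_eq_zero (a : V →ₗ[ℝ] ℝ) (θ : V [⋀^Fin l]→ₗ[ℝ] ℝ)
    (h : θ.compLinearMap (LinearMap.ker a).subtype = 0) : oneWedge a θ = 0 := by
  ext w
  refine oneWedge_apply_eq_zero a θ w fun w' hw' _ => ?_
  exact DFunLike.congr_fun h (fun i => (⟨w' i, hw' i⟩ : LinearMap.ker a))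

/-- On `v` followed by vectors of `ker a`, the product reduces to `a v` times the value of `θ`. -/
theorem compLinearMap_ker_subtype_eq_zero {a : V →ₗ[ℝ] ℝ} {θ : V [⋀^Fin l]→ₗ[ℝ] ℝ} {v : V}
    (hv : v ∈ ker (oneWedge a θ)) (hav : a v ≠ 0) :
    θ.compLinearMap (LinearMap.ker a).subtype = 0 := by
  ext w
  have h := oneWedge_apply_append a θ v (fun i => (w i : V)) (fun i => (w i).2)
  rw [apply_eq_zero_of_mem_ker hv _ (Fin.castAdd l 0) (by simp)] at h
  simpa [hav] using h.symm

theorem compLinearMap_ker_subtype_eq_zero_of_oneWedge {a : V →ₗ[ℝ] ℝ} (ha : a ≠ 0)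
    {θ : V [⋀^Fin l]→ₗ[ℝ] ℝ} (h : oneWedge a θ = 0) :
    θ.compLinearMap (LinearMap.ker a).subtype = 0 := by
  obtain ⟨u, hu⟩ : ∃ u, a u ≠ 0 := by
    by_contra! h'
    exact ha (LinearMap.ext h')
  exact compLinearMap_ker_subtype_eq_zero (v := u) (fun w i => by simp [h]) hu

end OneForm

section Bilinear

variable {V : Type*} [AddCommGroup V] [Module ℝ V]

theorem two_swap (A : V [⋀^Fin 2]→ₗ[ℝ] ℝ) (u v : V) : A ![u, v] = -A ![v, u] := by
  have h := A.map_swap ![v, u] (i := 0) (j := 1) (by decide)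
  rw [← h]
  congr 1
  ext i
  fin_cases i <;> simp

/-- The bilinear form of an alternating two-form. -/
noncomputable def bilin (A : V [⋀^Fin 2]→ₗ[ℝ] ℝ) : V →ₗ[ℝ] V →ₗ[ℝ] ℝ :=
  LinearMap.mk₂ ℝ (fun u v => A ![u, v])
    (fun u u' v => A.map_vecCons_add ![v] u u')
    (fun c u v => A.map_vecCons_smul ![v] c u)
    (fun u v v' => by
      rw [two_swap A u, two_swap A u v, two_swap A u v']
      rw [show A ![v + v', u] = _ from A.map_vecCons_add ![u] v v']
      ring)
    (fun c u v => by
      rw [two_swap A u, two_swap A u v, show A ![c • v, u] = _ from A.map_vecCons_smul ![u] c v]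
      simp)

@[simp] theorem bilin_apply (A : V [⋀^Fin 2]→ₗ[ℝ] ℝ) (u v : V) : bilin A u v = A ![u, v] := rfl

theorem bilin_swap (A : V [⋀^Fin 2]→ₗ[ℝ] ℝ) (u v : V) : bilin A u v = -bilin A v u :=
  two_swap A u v

theorem bilin_self (A : V [⋀^Fin 2]→ₗ[ℝ] ℝ) (u : V) : bilin A u u = 0 := by
  linarith [bilin_swap A u u]

/-- The Gram matrix of a symplectic family `x₀, y₀, x₁, y₁, …`. -/
def gram (i j : ℕ) : ℝ :=
  if i % 2 = 0 ∧ j = i + 1 then 1 else if j % 2 = 0 ∧ i = j + 1 then -1 else 0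

/-- The transposition of the blocks `{2 * i, 2 * i + 1}` and `{2 * r, 2 * r + 1}`. -/
def blockSwap (i r n : ℕ) : ℕ :=
  if n = 2 * i then 2 * r else if n = 2 * i + 1 then 2 * r + 1 else
  if n = 2 * r then 2 * i else if n = 2 * r + 1 then 2 * i + 1 else n

theorem gram_blockSwap (i r m n : ℕ) :
    gram (blockSwap i r m) (blockSwap i r n) = gram m n := by
  have h1 : ((blockSwap i r m) % 2 = 0 ∧ blockSwap i r n = blockSwap i r m + 1) ↔
      (m % 2 = 0 ∧ n = m + 1) := by
    unfold blockSwap; grind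
  have h2 : ((blockSwap i r n) % 2 = 0 ∧ blockSwap i r m = blockSwap i r n + 1) ↔
      (n % 2 = 0 ∧ m = n + 1) := by
    unfold blockSwap; grind
  simp only [gram, h1, h2]

end Bilinear

end ExtAlg

end

/-! ### Symplectic families and the rank of a two-form -/

section

namespace ExtAlg

section Symplectic

variable {V : Type*} [AddCommGroup V] [Module ℝ V]

/-- A family `x₀, y₀, x₁, y₁, …` with `A (xᵢ, yᵢ) = 1`, all other pairs being orthogonal. -/
def IsSymplecticFamily (A : V [⋀^Fin 2]→ₗ[ℝ] ℝ) {n : ℕ} (v : Fin n → V) : Prop :=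
  ∀ i j, A ![v i, v j] = gram i j

theorem exists_block_of_gram_ne_zero {i j r : ℕ} (h : gram i j ≠ 0) (hi : i < 2 * (r + 1))
    (hj : j < 2 * (r + 1)) : ∃ b ≤ r,
      (i = 2 * b ∧ j = 2 * b + 1 ∧ gram i j = 1) ∨ (j = 2 * b ∧ i = 2 * b + 1) := by
  unfold gram at h ⊢
  split_ifs at h ⊢ with h1 h2
  · exact ⟨i / 2, by omega, Or.inl ⟨by omega, by omega, rfl⟩⟩
  · exact ⟨j / 2, by omega, Or.inr ⟨by omega, by omega⟩⟩
  · simp at h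

/-- The transposition of two blocks as a permutation of the index set. -/
def blockPerm {r b : ℕ} (hb : b ≤ r) : Equiv.Perm (Fin (2 * r) ⊕ Fin 2) :=
  Equiv.swap (finSumFinEquiv.symm ⟨2 * b, by omega⟩) (Sum.inr 0) *
    Equiv.swap (finSumFinEquiv.symm ⟨2 * b + 1, by omega⟩) (Sum.inr 1)

theorem val_blockPerm {r b : ℕ} (hb : b ≤ r) (i : Fin (2 * r) ⊕ Fin 2) :
    (finSumFinEquiv (blockPerm hb i) : ℕ) = blockSwap b r (finSumFinEquiv i : ℕ) := by
  have key : ∀ i : Fin (2 * r + 2), (finSumFinEquiv (blockPerm hb (finSumFinEquiv.symm i)) : ℕ) =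
      blockSwap b r (i : ℕ) := by
    intro i
    have h0 : (Sum.inr 0 : Fin (2 * r) ⊕ Fin 2) = finSumFinEquiv.symm ⟨2 * r, by omega⟩ := by
      rw [Equiv.eq_symm_apply]; ext; simp
    have h1 : (Sum.inr 1 : Fin (2 * r) ⊕ Fin 2) = finSumFinEquiv.symm ⟨2 * r + 1, by omega⟩ := by
      rw [Equiv.eq_symm_apply]; ext; simp
    have hs : ∀ (x y : Fin (2 * r + 2)) (z : Fin (2 * r) ⊕ Fin 2),
        finSumFinEquiv (Equiv.swap (finSumFinEquiv.symm x) (finSumFinEquiv.symm y) z) =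
          Equiv.swap x y (finSumFinEquiv z) := by
      intro x y z
      simp only [Equiv.swap_apply_def, Equiv.eq_symm_apply]
      split_ifs <;> simp
    rw [blockPerm, h0, h1, Equiv.Perm.mul_apply, hs, hs, Equiv.apply_symm_apply,
      Equiv.swap_apply_def, Equiv.swap_apply_def]
    simp only [Fin.ext_iff, apply_ite Fin.val]
    unfold blockSwap
    grind
  simpa using key (finSumFinEquiv i)

/-- The two transpositions are both trivial when `b = r` and both nontrivial otherwise. -/
theorem sign_blockPerm {r b : ℕ} (hb : b ≤ r) : Equiv.Perm.sign (blockPerm hb) = 1 := by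
  have h0 : (finSumFinEquiv (Sum.inr 0 : Fin (2 * r) ⊕ Fin 2) : ℕ) = 2 * r := by simp
  have h1 : (finSumFinEquiv (Sum.inr 1 : Fin (2 * r) ⊕ Fin 2) : ℕ) = 2 * r + 1 := by simp
  rw [blockPerm, Equiv.Perm.sign_mul, Equiv.Perm.sign_swap', Equiv.Perm.sign_swap']
  simp only [Equiv.symm_apply_eq, Fin.ext_iff, h0, h1]
  by_cases h : b = r
  · simp [h]
  · simp [h]

/-- A shuffle contributes only if its last two slots form a block `{2b, 2b + 1}`, and then it is the
class of `blockPerm`. That permutation is even and keeps the family symplectic, so by induction its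
term is positive. All terms being nonnegative, the exact value of the sum is not needed. -/
theorem wedgePow_pos (A : V [⋀^Fin 2]→ₗ[ℝ] ℝ) (r : ℕ) (v : Fin (2 * r) → V)
    (hv : IsSymplecticFamily A v) : 0 < wedgePow A r v := by
  induction r with
  | zero => simp [wedgePow]
  | succ r ih =>
    have hA : ∀ w : Fin 2 → V, A w = A ![w 0, w 1] := fun w => by
      congr 1; ext i; fin_cases i <;> rfl
    have hblock : ∀ b (hb : b ≤ r), 0 < shuffleTerm (wedgePow A r) A
        (fun i => v (finSumFinEquiv i)) (Quotient.mk'' (blockPerm hb)) := by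
      intro b hb
      rw [shuffleTerm_mk, sign_blockPerm, hA, hv, val_blockPerm, val_blockPerm, gram_blockSwap]
      have hg : gram (finSumFinEquiv (Sum.inr 0 : Fin (2 * r) ⊕ Fin 2))
          (finSumFinEquiv (Sum.inr 1 : Fin (2 * r) ⊕ Fin 2)) = 1 := by simp [gram]
      rw [hg]
      simp only [Units.val_one, Int.cast_one, one_mul, mul_one]
      refine ih _ fun i j => ?_
      rw [hv, val_blockPerm, val_blockPerm, gram_blockSwap]
      simp
    have hterm : ∀ σ, 0 ≤ shuffleTerm (wedgePow A r) A (fun i => v (finSumFinEquiv i)) σ := by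
      intro σ
      induction σ using Quotient.inductionOn' with | _ σ
      by_cases h0 : A ![v (finSumFinEquiv (σ (Sum.inr 0))), v (finSumFinEquiv (σ (Sum.inr 1)))] = 0
      · rw [shuffleTerm_mk, hA, h0, mul_zero, mul_zero]
      rw [hv] at h0
      obtain ⟨b, hb, h⟩ := exists_block_of_gram_ne_zero h0 (Fin.is_lt _) (Fin.is_lt _)
      have hmem : ∀ i : Fin 2, ∃ j : Fin 2, blockPerm hb (Sum.inr i) = σ (Sum.inr j) := by
        have e0 : (finSumFinEquiv (blockPerm hb (Sum.inr 0)) : ℕ) = 2 * b := by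
          rw [val_blockPerm, show ((finSumFinEquiv (Sum.inr 0 : Fin (2 * r) ⊕ Fin 2) : Fin _) : ℕ) =
            2 * r by simp]
          unfold blockSwap; split_ifs <;> omega
        have e1 : (finSumFinEquiv (blockPerm hb (Sum.inr 1)) : ℕ) = 2 * b + 1 := by
          rw [val_blockPerm, show ((finSumFinEquiv (Sum.inr 1 : Fin (2 * r) ⊕ Fin 2) : Fin _) : ℕ) =
            2 * r + 1 by simp]
          unfold blockSwap; split_ifs <;> omega
        intro i
        rcases h with ⟨ha, hb, _⟩ | ⟨ha, hb⟩ <;> fin_cases i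
        · exact ⟨0, finSumFinEquiv.injective (Fin.ext (e0.trans ha.symm))⟩
        · exact ⟨1, finSumFinEquiv.injective (Fin.ext (e1.trans hb.symm))⟩
        · exact ⟨1, finSumFinEquiv.injective (Fin.ext (e0.trans ha.symm))⟩
        · exact ⟨0, finSumFinEquiv.injective (Fin.ext (e1.trans hb.symm))⟩
      rw [mk_eq_mk_of_inl σ (blockPerm hb)]
      · exact (hblock b hb).le
      · intro i
        rcases hj : (blockPerm hb).symm (σ (Sum.inl i)) with j | j
        · exact ⟨j, by rw [← hj]; simp⟩
        · obtain ⟨m, hm⟩ := hmem j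
          rw [Equiv.symm_apply_eq, hm] at hj
          simp at hj
    rw [wedgePow, wedge_apply]
    exact Finset.sum_pos' (fun σ _ => hterm σ) ⟨_, Finset.mem_univ _, hblock r le_rfl⟩

/-- The vectors of `U` that are orthogonal to `U`. -/
def radIn (A : V [⋀^Fin 2]→ₗ[ℝ] ℝ) (U : Submodule ℝ V) : Submodule ℝ V where
  carrier := {v | v ∈ U ∧ ∀ w ∈ U, bilin A v w = 0}
  zero_mem' := ⟨U.zero_mem, by simp⟩
  add_mem' := fun {u v} hu hv => ⟨U.add_mem hu.1 hv.1, fun w hw => by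
    rw [map_add, LinearMap.add_apply, hu.2 w hw, hv.2 w hw, add_zero]⟩
  smul_mem' := fun c v hv => ⟨U.smul_mem c hv.1, fun w hw => by
    rw [map_smul, LinearMap.smul_apply, hv.2 w hw, smul_zero]⟩

theorem exists_bilin_eq_one (A : V [⋀^Fin 2]→ₗ[ℝ] ℝ) {U : Submodule ℝ V}
    (hU : ¬ U ≤ radIn A U) : ∃ x ∈ U, ∃ y ∈ U, bilin A x y = 1 := by
  obtain ⟨x, hx, hx'⟩ := SetLike.not_le_iff_exists.1 hU
  obtain ⟨y, hy, hxy⟩ : ∃ y ∈ U, bilin A x y ≠ 0 := by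
    by_contra! h
    exact hx' ⟨hx, h⟩
  exact ⟨x, hx, (bilin A x y)⁻¹ • y, U.smul_mem _ hy, by
    rw [map_smul, smul_eq_mul, inv_mul_cancel₀ hxy]⟩

/-- Symplectic Gram–Schmidt: split off `x`, `y` with `A (x, y) = 1` and pass to their orthogonal in
`U`, which loses at most two dimensions and does not enlarge the radical. The `+ 1` in the
hypothesis replaces the evenness of the rank: a rank of at least 2r - 1 already yields r pairs. -/
theorem exists_isSymplecticFamily [FiniteDimensional ℝ V] (A : V [⋀^Fin 2]→ₗ[ℝ] ℝ) (r : ℕ)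
    (U : Submodule ℝ V) (hU : Module.finrank ℝ (radIn A U) + 2 * r ≤ Module.finrank ℝ U + 1) :
    ∃ v : Fin (2 * r) → V, (∀ i, v i ∈ U) ∧ IsSymplecticFamily A v := by
  induction r generalizing U with
  | zero => exact ⟨fun i => i.elim0, fun i => i.elim0, fun i => i.elim0⟩
  | succ r ih =>
    obtain ⟨x, hx, y, hy, hxy⟩ := exists_bilin_eq_one A (U := U) fun h => by
      have := Submodule.finrank_mono h
      omega
    have hyx : bilin A y x = -1 := by rw [bilin_swap, hxy]
    set U' : Submodule ℝ V := U ⊓ (LinearMap.ker (bilin A x) ⊓ LinearMap.ker (bilin A y)) with hU'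
    have hdec : ∀ u ∈ U, u + bilin A y u • x - bilin A x u • y ∈ U' := fun u hu => by
      refine ⟨U.sub_mem (U.add_mem hu (U.smul_mem _ hx)) (U.smul_mem _ hy), ?_, ?_⟩ <;>
        simp only [SetLike.mem_coe, LinearMap.mem_ker, map_sub, map_add, map_smul, bilin_self, hxy,
          hyx, smul_eq_mul] <;> ring
    have hle : U ≤ U' ⊔ Submodule.span ℝ {x, y} := fun u hu => by
      refine Submodule.mem_sup.2 ⟨_, hdec u hu, -(bilin A y u) • x + bilin A x u • y, ?_, ?_⟩
      · exact Submodule.mem_span_pair.2 ⟨_, _, rfl⟩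
      · module
    have hspan : Module.finrank ℝ (Submodule.span ℝ ({x, y} : Set V)) ≤ 2 := by
      classical
      have := finrank_span_finset_le_card (R := ℝ) ({x, y} : Finset V)
      rw [Finset.coe_pair] at this
      exact this.trans Finset.card_le_two
    have hfin : Module.finrank ℝ U ≤ Module.finrank ℝ U' + 2 :=
      (Submodule.finrank_mono hle).trans
        ((Submodule.finrank_add_le_finrank_add_finrank _ _).trans (by omega))
    have hrad : radIn A U' ≤ radIn A U := fun v hv => by
      refine ⟨hv.1.1, fun u hu => ?_⟩
      have h := hv.2 _ (hdec u hu)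
      have h1 : bilin A x v = 0 := hv.1.2.1
      have h2 : bilin A y v = 0 := hv.1.2.2
      rw [map_sub, map_add, map_smul, map_smul, bilin_swap A v x, bilin_swap A v y, h1, h2] at h
      simpa using h
    obtain ⟨v, hvU, hv⟩ := ih U' (by have := Submodule.finrank_mono hrad; omega)
    refine ⟨(Fin.append v ![x, y] : Fin (2 * r + 2) → V), fun i => ?_, fun i j => ?_⟩
    · change Fin (2 * r + 2) at i
      refine Fin.addCases (fun i => ?_) (fun i => ?_) i
      · rw [Fin.append_left]; exact (hvU i).1
      · rw [Fin.append_right]; fin_cases i <;> simp [hx, hy]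
    · have hxv : ∀ i, bilin A x (v i) = 0 := fun i => (hvU i).2.1
      have hyv : ∀ i, bilin A y (v i) = 0 := fun i => (hvU i).2.2
      have hvx : ∀ i, bilin A (v i) x = 0 := fun i => by rw [bilin_swap, hxv, neg_zero]
      have hvy : ∀ i, bilin A (v i) y = 0 := fun i => by rw [bilin_swap, hyv, neg_zero]
      rw [← bilin_apply]
      change Fin (2 * r + 2) at i j
      refine Fin.addCases (fun i => ?_) (fun i => ?_) i <;>
        refine Fin.addCases (fun j => ?_) (fun j => ?_) j
      · rw [Fin.append_left, Fin.append_left, bilin_apply, hv]; simp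
      · rw [Fin.append_left, Fin.append_right]
        have h1 : ¬ (i : ℕ) = 2 * r + (j : ℕ) + 1 := by omega
        have h2 : ¬ ((i : ℕ) % 2 = 0 ∧ 2 * r + (j : ℕ) = i + 1) := by omega
        fin_cases j <;> simp_all [gram]
      · rw [Fin.append_left, Fin.append_right]
        have h1 : ¬ (j : ℕ) = 2 * r + (i : ℕ) + 1 := by omega
        have h2 : ¬ ((j : ℕ) % 2 = 0 ∧ 2 * r + (i : ℕ) = j + 1) := by omega
        fin_cases i <;> simp_all [gram]
      · rw [Fin.append_right, Fin.append_right]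
        fin_cases i <;> fin_cases j <;> simp_all [gram, bilin_self, -bilin_apply]

/-- Otherwise `U` contains a symplectic family of `r + 1` pairs, on which the power is positive. -/
theorem finrank_le_of_wedgePow_eq_zero [FiniteDimensional ℝ V] (A : V [⋀^Fin 2]→ₗ[ℝ] ℝ) (r : ℕ)
    (U : Submodule ℝ V) (h : (wedgePow A (r + 1)).compLinearMap U.subtype = 0) :
    Module.finrank ℝ U ≤ Module.finrank ℝ (radIn A U) + 2 * r := by
  by_contra! hlt
  obtain ⟨v, hvU, hv⟩ := exists_isSymplecticFamily A (r + 1) U (by omega)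
  have := wedgePow_pos A (r + 1) v hv
  have h0 := DFunLike.congr_fun h (fun i => (⟨v i, hvU i⟩ : U))
  exact this.ne' h0

end Symplectic

/-! ### Linear algebra of a contact-contact pair -/

section Pair

variable {V : Type*} [AddCommGroup V] [Module ℝ V]

/-- The characteristic space of a one-form `a` and a two-form `A`: the vectors of `ker a` that are
`A`-orthogonal to `ker a`. -/
abbrev charSpace (a : V →ₗ[ℝ] ℝ) (A : V [⋀^Fin 2]→ₗ[ℝ] ℝ) : Submodule ℝ V :=
  radIn A (LinearMap.ker a)

/-- A vector `v` of the characteristic space lies in `ker a`, so in the expansion of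
`oneWedge_apply_eq_zero` it is always an argument of the power of `A` restricted to `ker a`; there
it lies in the kernel of `A`, hence of its powers. -/
theorem charSpace_le_ker (a : V →ₗ[ℝ] ℝ) (A : V [⋀^Fin 2]→ₗ[ℝ] ℝ) (r : ℕ) :
    charSpace a A ≤ ker (oneWedge a (wedgePow A r)) := by
  intro v hv w i
  refine oneWedge_apply_eq_zero _ _ _ fun w' hw' hmem => ?_
  obtain ⟨j, hj⟩ := hmem i (by simpa using hv.1)
  rw [Function.update_self] at hj
  have hker : (⟨v, hv.1⟩ : LinearMap.ker a) ∈
      ker (A.compLinearMap (LinearMap.ker a).subtype) := by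
    have h2 : ∀ x : LinearMap.ker a, A ![v, (x : V)] = 0 := fun x => hv.2 x x.2
    intro w i
    have hA : ∀ w : Fin 2 → V, A w = A ![w 0, w 1] := fun w => by
      congr 1; ext i; fin_cases i <;> rfl
    rw [AlternatingMap.compLinearMap_apply, hA]
    fin_cases i
    · simpa using h2 (w 1)
    · rw [two_swap]
      simpa using h2 (w 0)
  have hpow : ∀ r, (⟨v, hv.1⟩ : LinearMap.ker a) ∈
      ker (wedgePow (A.compLinearMap (LinearMap.ker a).subtype) r) ∨ r = 0 := by
    intro r
    induction r with
    | zero => exact Or.inr rfl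
    | succ r ih =>
      left
      refine ker_inf_ker_le _ _ ⟨?_, hker⟩
      rcases ih with ih | rfl
      · exact ih
      · exact fun w i => i.elim0
  rcases hpow r with h | rfl
  · rw [wedgePow_compLinearMap] at h
    exact apply_eq_zero_of_mem_ker h (fun i => ⟨w' i, hw' i⟩) j (Subtype.ext hj)
  · exact j.elim0

theorem ker_le_ker (a : V →ₗ[ℝ] ℝ) (A : V [⋀^Fin 2]→ₗ[ℝ] ℝ) (r : ℕ)
    (h : (wedgePow A r).compLinearMap (LinearMap.ker a).subtype ≠ 0) :
    ker (oneWedge a (wedgePow A r)) ≤ LinearMap.ker a := by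
  intro v hv
  by_contra hav
  exact h (compLinearMap_ker_subtype_eq_zero hv hav)

/-- The pointwise consequences of the contact-contact condition. -/
theorem isCompl_charSpace [FiniteDimensional ℝ V] {h k : ℕ} {a b : V →ₗ[ℝ] ℝ}
    {A B : V [⋀^Fin 2]→ₗ[ℝ] ℝ} (hV : Module.finrank ℝ V = (1 + 2 * h) + (1 + 2 * k))
    (hne : wedge (oneWedge a (wedgePow A h)) (oneWedge b (wedgePow B k)) ≠ 0)
    (hA : oneWedge a (wedgePow A (h + 1)) = 0) (hB : oneWedge b (wedgePow B (k + 1)) = 0) :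
    a ≠ 0 ∧ b ≠ 0 ∧ (wedgePow A h).compLinearMap (LinearMap.ker a).subtype ≠ 0 ∧
      (wedgePow B k).compLinearMap (LinearMap.ker b).subtype ≠ 0 ∧
      IsCompl (charSpace a A) (charSpace b B) := by
  have hA0 : oneWedge a (wedgePow A h) ≠ 0 := fun h0 => hne (by rw [h0, wedge_zero_left])
  have hB0 : oneWedge b (wedgePow B k) ≠ 0 := fun h0 => hne (by rw [h0, wedge_zero_right])
  have one_zero : ∀ {l : ℕ} (θ : V [⋀^Fin l]→ₗ[ℝ] ℝ), oneWedge (0 : V →ₗ[ℝ] ℝ) θ = 0 :=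
    fun θ => by
      ext w
      exact wedge_apply_eq_zero _ _ _ fun σ => by simp
  have ha : a ≠ 0 := by rintro rfl; exact hA0 (one_zero _)
  have hb : b ≠ 0 := by rintro rfl; exact hB0 (one_zero _)
  have hdisj : charSpace a A ⊓ charSpace b B = ⊥ := by
    rw [eq_bot_iff, ← ker_eq_bot_of_finrank hV hne]
    exact (inf_le_inf (charSpace_le_ker a A h) (charSpace_le_ker b B k)).trans
      (ker_inf_ker_le _ _)
  have rank : ∀ {a : V →ₗ[ℝ] ℝ} {A : V [⋀^Fin 2]→ₗ[ℝ] ℝ} {r : ℕ}, a ≠ 0 →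
      oneWedge a (wedgePow A (r + 1)) = 0 →
      Module.finrank ℝ V ≤ Module.finrank ℝ (charSpace a A) + (2 * r + 1) := by
    intro a A r ha h
    have h1 := finrank_le_of_wedgePow_eq_zero A r _
      (compLinearMap_ker_subtype_eq_zero_of_oneWedge ha h)
    have h2 := LinearMap.finrank_range_add_finrank_ker a
    have h3 : Module.finrank ℝ (LinearMap.range a) ≤ 1 := by
      simpa using Submodule.finrank_le (LinearMap.range a)
    change _ ≤ Module.finrank ℝ (radIn A _) + _
    omega
  refine ⟨ha, hb, fun h0 => hA0 (oneWedge_eq_zero _ _ h0), fun h0 => hB0 (oneWedge_eq_zero _ _ h0),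
    disjoint_iff.2 hdisj, codisjoint_iff.2 ?_⟩
  -- The codimensions are at most 2h + 1 and 2k + 1, which add up to dim V; since the intersection
  -- is zero, the sum is everything.
  refine Submodule.eq_top_of_finrank_eq (le_antisymm (Submodule.finrank_le _) ?_)
  have h1 := Submodule.finrank_sup_add_finrank_inf_eq (charSpace a A) (charSpace b B)
  rw [hdisj, finrank_bot] at h1
  have h2 := rank ha hA
  have h3 := rank hb hB
  omega

/-- Orthogonality inside the common kernel is insensitive to a nonzero factor; this makes the
characteristic space independent of the defining form. -/
theorem charSpace_eq_of_smul {a a₀ : V →ₗ[ℝ] ℝ} {A A₀ : V [⋀^Fin 2]→ₗ[ℝ] ℝ} {c : ℝ} (hc : c ≠ 0)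
    (hker : LinearMap.ker a = LinearMap.ker a₀)
    (hA : ∀ v w, a v = 0 → a w = 0 → A₀ ![v, w] = c * A ![v, w]) :
    charSpace a A = charSpace a₀ A₀ := by
  ext v
  refine ⟨fun hv => ⟨hker ▸ hv.1, fun w hw => ?_⟩, fun hv => ⟨hker ▸ hv.1, fun w hw => ?_⟩⟩
  · rw [← hker] at hw
    have := hv.2 w hw
    rw [bilin_apply] at this ⊢
    rw [hA v w hv.1 hw, this, mul_zero]
  · have hw' := hw
    rw [hker] at hw'
    have := hv.2 w hw'
    have hv1 := hv.1
    rw [← hker] at hv1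
    rw [bilin_apply, hA v w hv1 hw] at this
    simpa [hc] using this

theorem wedgePow_ne_zero_of_smul {a a₀ : V →ₗ[ℝ] ℝ} {A A₀ : V [⋀^Fin 2]→ₗ[ℝ] ℝ} {c : ℝ}
    (hker : LinearMap.ker a = LinearMap.ker a₀)
    (hA : ∀ v w, a v = 0 → a w = 0 → A₀ ![v, w] = c * A ![v, w]) {r : ℕ}
    (h : (wedgePow A₀ r).compLinearMap (LinearMap.ker a₀).subtype ≠ 0) :
    (wedgePow A r).compLinearMap (LinearMap.ker a).subtype ≠ 0 := by
  rw [← wedgePow_compLinearMap, ← hker] at h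
  have heq : A₀.compLinearMap (LinearMap.ker a).subtype =
      c • A.compLinearMap (LinearMap.ker a).subtype := by
    have h2 : ∀ (A : V [⋀^Fin 2]→ₗ[ℝ] ℝ) (w : Fin 2 → V), A w = A ![w 0, w 1] := fun A w => by
      congr 1; ext i; fin_cases i <;> rfl
    ext w
    rw [AlternatingMap.compLinearMap_apply, AlternatingMap.smul_apply,
      AlternatingMap.compLinearMap_apply, h2, h2 A]
    exact hA _ _ (w 0).2 (w 1).2
  rw [heq, wedgePow_smul, wedgePow_compLinearMap] at h
  exact right_ne_zero_of_smul h

theorem exists_eq_smul_of_ker {a f : V →ₗ[ℝ] ℝ} (h : ∀ v, a v = 0 → f v = 0) :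
    ∃ c : ℝ, ∀ v, f v = c * a v := by
  by_cases ha : a = 0
  · subst ha
    exact ⟨0, fun v => by simp [h v rfl]⟩
  obtain ⟨u, hu⟩ : ∃ u, a u ≠ 0 := by
    by_contra! h'
    exact ha (LinearMap.ext h')
  refine ⟨f u / a u, fun v => ?_⟩
  have := h (v - (a v / a u) • u) (by simp [hu])
  rw [map_sub, map_smul, sub_eq_zero, smul_eq_mul] at this
  rw [this]
  ring

/-- The space `N` complements `charSpace a A` in `ker a`, and a vector of `N` orthogonal to `N` lies
in both characteristic spaces. So `A` is nondegenerate on `N` and represents `-a'` there by some `X`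
in `N`; on `charSpace a A` both sides vanish. -/
theorem exists_bilin_eq_neg [FiniteDimensional ℝ V] {a b a' : V →ₗ[ℝ] ℝ}
    {A B : V [⋀^Fin 2]→ₗ[ℝ] ℝ} (hc : charSpace a A ⊔ charSpace b B = ⊤)
    (hd : charSpace a A ⊓ charSpace b B = ⊥)
    (ha' : ∀ v ∈ charSpace a A, a' v = 0) :
    ∃ X ∈ charSpace b B, a X = 0 ∧ ∀ v, a v = 0 → bilin A X v = -a' v := by
  set N : Submodule ℝ V := charSpace b B ⊓ LinearMap.ker a with hN
  have hdec : ∀ v, a v = 0 → ∃ v₁ ∈ charSpace a A, ∃ v₂ ∈ N, v₁ + v₂ = v := by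
    intro v hv
    obtain ⟨v₁, h₁, v₂, h₂, rfl⟩ := Submodule.mem_sup.1 (hc ▸ Submodule.mem_top : v ∈ _ ⊔ _)
    refine ⟨v₁, h₁, v₂, ⟨h₂, ?_⟩, rfl⟩
    have : a v₁ = 0 := h₁.1
    simpa [this] using hv
  let T : N →ₗ[ℝ] Module.Dual ℝ N := (bilin A).domRestrict₁₂ N N
  have hT : Function.Injective T := by
    rw [← LinearMap.ker_eq_bot, LinearMap.ker_eq_bot']
    intro x hx
    have : (x : V) ∈ charSpace a A ⊓ charSpace b B := by
      refine ⟨⟨x.2.2, fun w hw => ?_⟩, x.2.1⟩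
      obtain ⟨v₁, h₁, v₂, h₂, rfl⟩ := hdec w hw
      have e1 := h₁.2 x x.2.2
      have e2 : bilin A x v₂ = 0 := DFunLike.congr_fun hx (⟨v₂, h₂⟩ : N)
      rw [map_add, bilin_swap, e1, e2, neg_zero, add_zero]
    rw [hd, Submodule.mem_bot] at this
    exact Subtype.ext this
  obtain ⟨X, hX⟩ := (LinearMap.injective_iff_surjective_of_finrank_eq_finrank
    (Subspace.dual_finrank_eq (K := ℝ) (V := N)).symm).1 hT (-(a'.domRestrict N))
  refine ⟨X, X.2.1, X.2.2, fun v hv => ?_⟩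
  obtain ⟨v₁, h₁, v₂, h₂, rfl⟩ := hdec v hv
  have e1 := h₁.2 X X.2.2
  have e2 : bilin A X v₂ = -a' v₂ := DFunLike.congr_fun hX (⟨v₂, h₂⟩ : N)
  rw [map_add, bilin_swap, e1, e2, map_add, ha' v₁ h₁]
  ring

/-- The linear equations for Moser's vector field are solvable. -/
theorem exists_moser [FiniteDimensional ℝ V] {a b a' b' : V →ₗ[ℝ] ℝ}
    {A B : V [⋀^Fin 2]→ₗ[ℝ] ℝ} (hc : IsCompl (charSpace a A) (charSpace b B))
    (ha' : ∀ v ∈ charSpace a A, a' v = 0) (hb' : ∀ v ∈ charSpace b B, b' v = 0) :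
    ∃ (X : V) (c d : ℝ), a X = 0 ∧ b X = 0 ∧ (∀ v, A ![X, v] = c * a v - a' v) ∧
      ∀ v, B ![X, v] = d * b v - b' v := by
  obtain ⟨X₁, h₁, h₁a, h₁A⟩ := exists_bilin_eq_neg hc.sup_eq_top hc.inf_eq_bot ha'
  obtain ⟨X₂, h₂, h₂b, h₂B⟩ := exists_bilin_eq_neg hc.symm.sup_eq_top hc.symm.inf_eq_bot hb'
  -- The vector `X₂` lies in `charSpace a A`, so it adds nothing to the `A`-equation on `ker a`; a
  -- linear form vanishing on `ker a` is a multiple of `a`. The roles are exchanged for `b`.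
  obtain ⟨c, hcA⟩ := exists_eq_smul_of_ker (a := a) (f := bilin A (X₁ + X₂) + a') fun v hv => by
    have := h₂.2 v hv
    simp only [map_add, LinearMap.add_apply, h₁A v hv, this]
    ring
  obtain ⟨d, hdB⟩ := exists_eq_smul_of_ker (a := b) (f := bilin B (X₁ + X₂) + b') fun v hv => by
    have := h₁.2 v hv
    simp only [map_add, LinearMap.add_apply, h₂B v hv, this]
    ring
  refine ⟨X₁ + X₂, c, d, ?_, ?_, fun v => ?_, fun v => ?_⟩
  · have : a X₂ = 0 := h₂.1
    simp [h₁a, this]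
  · have : b X₁ = 0 := h₁.1
    simp [h₂b, this]
  · rw [← hcA v, LinearMap.add_apply, bilin_apply]
    ring
  · rw [← hdB v, LinearMap.add_apply, bilin_apply]
    ring

/-- The homogeneous equations place `X` in both characteristic spaces, so `X = 0`, and then `c` and
`d` vanish because `a` and `b` do not. -/
theorem moser_unique {a b : V →ₗ[ℝ] ℝ} (ha : a ≠ 0) (hb : b ≠ 0)
    {A B : V [⋀^Fin 2]→ₗ[ℝ] ℝ} (hc : IsCompl (charSpace a A) (charSpace b B)) {X : V} {c d : ℝ}
    (haX : a X = 0) (hbX : b X = 0) (hA : ∀ v, A ![X, v] = c * a v)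
    (hB : ∀ v, B ![X, v] = d * b v) : X = 0 ∧ c = 0 ∧ d = 0 := by
  have hX : X ∈ charSpace a A ⊓ charSpace b B := by
    refine ⟨⟨haX, fun w hw => ?_⟩, ⟨hbX, fun w hw => ?_⟩⟩
    · rw [bilin_apply, hA, LinearMap.mem_ker.1 hw, mul_zero]
    · rw [bilin_apply, hB, LinearMap.mem_ker.1 hw, mul_zero]
  rw [hc.inf_eq_bot, Submodule.mem_bot] at hX
  subst hX
  refine ⟨rfl, ?_, ?_⟩
  · by_contra h0
    refine ha (LinearMap.ext fun v => ?_)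
    have := hA v
    rw [← bilin_apply, map_zero] at this
    simpa [h0] using this.symm
  · by_contra h0
    refine hb (LinearMap.ext fun v => ?_)
    have := hB v
    rw [← bilin_apply, map_zero] at this
    simpa [h0] using this.symm

end Pair

end ExtAlg

end

/-! ### Ordinary differential equations on the closed unit interval -/

section

namespace UnitODE

open Metric Filter

section Basic

variable {Z : Type*} [NormedAddCommGroup Z] [NormedSpace ℝ Z]

/-- `u` solves `u' = V t u` on `[0, 1]`. -/
def Solves (V : ℝ → Z → Z) (u : ℝ → Z) : Prop :=
  ∀ t ∈ Icc (0 : ℝ) 1, HasDerivWithinAt u (V t (u t)) (Icc 0 1) t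

theorem hasDerivWithinAt_Ici {u : ℝ → Z} {u' : Z} {a b t : ℝ} (ht : t ∈ Ico a b)
    (h : HasDerivWithinAt u u' (Icc a b) t) : HasDerivWithinAt u u' (Ici t) t :=
  h.mono_of_mem_nhdsWithin (Icc_mem_nhdsGE_of_mem ht)

/-- The bound `L` holds everywhere and the interval has length one, so Picard–Lindelöf on the ball
of radius `L` covers all of it. -/
theorem exists_solves [CompleteSpace Z] {V : ℝ → Z → Z} {K L : NNReal}
    (hK : ∀ t ∈ Icc (0 : ℝ) 1, LipschitzWith K (V t))
    (hc : ∀ x, ContinuousOn (fun t => V t x) (Icc 0 1))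
    (hL : ∀ t ∈ Icc (0 : ℝ) 1, ∀ x, ‖V t x‖ ≤ L) (s : Icc (0 : ℝ) 1) (x : Z) :
    ∃ u, u s = x ∧ Solves V u := by
  have hP : IsPicardLindelof V s x L 0 L K :=
    { lipschitzOnWith := fun t ht => (hK t ht).lipschitzOnWith
      continuousOn := fun x _ => hc x
      norm_le := fun t ht x _ => hL t ht x
      mul_max_le := by
        have : max (1 - (s : ℝ)) (s - 0) ≤ 1 := max_le (by linarith [s.2.1]) (by linarith [s.2.2])
        simpa using mul_le_mul_of_nonneg_left this L.2 }
  exact hP.exists_eq_forall_mem_Icc_hasDerivWithinAt₀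

theorem Solves.continuousOn {V : ℝ → Z → Z} {u : ℝ → Z} (h : Solves V u) :
    ContinuousOn u (Icc 0 1) := fun t ht => (h t ht).continuousWithinAt

/-- Grönwall's inequality in a convenient form. -/
theorem norm_le_mul_exp {u u' : ℝ → Z} {δ K ε : ℝ} (hK : 0 ≤ K) (hδ : 0 ≤ δ) (hε : 0 ≤ ε)
    (hu : ∀ t ∈ Icc (0 : ℝ) 1, HasDerivWithinAt u (u' t) (Icc 0 1) t) (h0 : ‖u 0‖ ≤ δ)
    (hb : ∀ t ∈ Icc (0 : ℝ) 1, ‖u' t‖ ≤ K * ‖u t‖ + ε) {t : ℝ} (ht : t ∈ Icc (0 : ℝ) 1) :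
    ‖u t‖ ≤ (δ + ε) * Real.exp (K + 1) := by
  -- Weakening `K` to `K + 1` makes the constant nonzero, which selects a single formula for the
  -- Grönwall bound.
  have h := norm_le_gronwallBound_of_norm_deriv_right_le (K := K + 1) (ε := ε)
    (fun t ht => (hu t ht).continuousWithinAt)
    (fun t ht => hasDerivWithinAt_Ici ht (hu t (Ico_subset_Icc_self ht))) h0
    (fun t ht => (hb t (Ico_subset_Icc_self ht)).trans (by
      have := norm_nonneg (u t)
      linarith)) t ht
  rw [gronwallBound_of_K_ne_0 (by positivity), sub_zero] at h
  have h1 : Real.exp ((K + 1) * t) ≤ Real.exp (K + 1) :=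
    Real.exp_le_exp.2 (mul_le_of_le_one_right (by positivity) ht.2)
  have h2 : ε / (K + 1) ≤ ε := div_le_self hε (by linarith)
  have h3 : ε / (K + 1) * (Real.exp ((K + 1) * t) - 1) ≤ ε * Real.exp (K + 1) := by
    have := Real.one_le_exp (x := (K + 1) * t) (mul_nonneg (by linarith) ht.1)
    exact mul_le_mul h2 (by linarith) (by linarith) hε
  have h4 := mul_le_mul_of_nonneg_left h1 hδ
  linarith

theorem Solves.eqOn {V : ℝ → Z → Z} {K : NNReal}
    (hK : ∀ t ∈ Icc (0 : ℝ) 1, LipschitzWith K (V t)) {u w : ℝ → Z} (hu : Solves V u)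
    (hw : Solves V w) (h0 : u 0 = w 0) : EqOn u w (Icc 0 1) := by
  intro t ht
  have := norm_le_mul_exp (u := fun t => u t - w t) K.2 le_rfl le_rfl
    (fun t ht => (hu t ht).sub (hw t ht)) (by simp [h0])
    (fun t ht => by simpa using (hK t ht).norm_sub_le (u t) (w t)) ht
  simpa [sub_eq_zero] using this

theorem exists_solves_linear [FiniteDimensional ℝ Z] {L : ℝ → Z →L[ℝ] Z}
    (hL : ContinuousOn L (Icc 0 1)) (a : Z) : ∃ u, u 0 = a ∧ Solves (fun t z => L t z) u := by
  obtain ⟨ℓ, hℓ⟩ := isCompact_Icc.exists_bound_of_continuousOn hL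
  have hℓ0 : 0 ≤ ℓ := (norm_nonneg _).trans (hℓ 0 (by simp))
  -- A linear field is not bounded, so it is cut off outside the ball of radius `R`. The cut-off
  -- field still grows at most linearly with constant `ℓ`, and `R` exceeds the resulting Grönwall
  -- bound, so the solution never meets the cut-off.
  set R : ℝ := ‖a‖ * Real.exp (ℓ + 1) + 1 with hR
  have hRpos : 0 < R := by positivity
  let χ : ContDiffBump (0 : Z) := ⟨R, R + 1, hRpos, by linarith⟩
  obtain ⟨C, hC⟩ : ∃ C, LipschitzWith C (fun z => χ z • z) :=
    ContDiff.lipschitzWith_of_hasCompactSupport (𝕂 := ℝ) (n := 1)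
      (χ.hasCompactSupport.smul_right (f' := fun z => z)) (χ.contDiff.smul contDiff_id) one_ne_zero
  have hχ : ∀ z, ‖χ z • z‖ ≤ ‖z‖ := fun z => by
    rw [norm_smul, Real.norm_of_nonneg χ.nonneg]
    exact mul_le_of_le_one_left (norm_nonneg _) χ.le_one
  have hχ' : ∀ z, ‖χ z • z‖ ≤ R + 1 := fun z => by
    by_cases hz : ‖z‖ ≤ R + 1
    · exact (hχ z).trans hz
    · rw [χ.zero_of_le_dist (by simpa using (not_le.1 hz).le), zero_smul, norm_zero]
      positivity
  obtain ⟨u, hu0, hu⟩ := exists_solves (V := fun t z => L t (χ z • z)) (K := ℓ.toNNReal * C)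
    (L := (ℓ * (R + 1)).toNNReal)
    (fun t ht => by
      have h1 : LipschitzWith ℓ.toNNReal (L t) :=
        (L t).lipschitz.weaken (by
          rw [← NNReal.coe_le_coe, Real.coe_toNNReal _ hℓ0]; exact hℓ t ht)
      exact h1.comp hC)
    (fun z => hL.clm_apply continuousOn_const)
    (fun t ht z => by
      rw [Real.coe_toNNReal _ (by positivity)]
      exact ((L t).le_opNorm _).trans
        (mul_le_mul (hℓ t ht) (hχ' z) (norm_nonneg _) hℓ0)) ⟨0, by simp⟩ a
  refine ⟨u, hu0, fun t ht => ?_⟩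
  have hbound := norm_le_mul_exp hℓ0 (norm_nonneg a) le_rfl hu (by rw [← hu0]) (fun t ht => by
    rw [add_zero]
    exact ((L t).le_opNorm _).trans
        (mul_le_mul (hℓ t ht) (hχ _) (norm_nonneg _) hℓ0)) ht
  have h1 : χ (u t) = 1 := χ.one_of_mem_closedBall (by
    rw [mem_closedBall_zero_iff]; change ‖u t‖ ≤ R; linarith)
  simpa [h1] using hu t ht

end Basic

section Parameters

variable {Z P : Type*} [NormedAddCommGroup Z]

/-- Compactness of [0, 1] makes continuity in the parameter uniform in time. -/
theorem eventually_forall_norm_sub_lt {T : Type*} [TopologicalSpace T] {g : ℝ × T → Z}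
    (hg : ContinuousOn g (Icc (0 : ℝ) 1 ×ˢ univ)) (p₀ : T) {ε : ℝ} (hε : 0 < ε) :
    ∀ᶠ p in 𝓝 p₀, ∀ t ∈ Icc (0 : ℝ) 1, ‖g (t, p) - g (t, p₀)‖ < ε := by
  obtain ⟨v, hv, h⟩ := IsCompact.mem_uniformity_of_prod (f := fun (p : T) (t : ℝ) => g (t, p))
    (s := univ) (k := Icc (0 : ℝ) 1) (q := p₀) isCompact_Icc
    (hg.comp continuous_swap.continuousOn (fun x hx => ⟨hx.2, trivial⟩)) trivial
    (Metric.dist_mem_uniformity hε)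
  rw [nhdsWithin_univ] at hv
  filter_upwards [hv] with p hp t ht
  rw [← dist_eq_norm]
  exact h p hp t ht

theorem continuousOn_of_uniform {T : Type*} [TopologicalSpace T] {a : ℝ × T → Z}
    (ht : ∀ p, ContinuousOn (fun t => a (t, p)) (Icc 0 1))
    (hp : ∀ p₀, ∀ ε > 0, ∀ᶠ p in 𝓝 p₀, ∀ t ∈ Icc (0 : ℝ) 1, ‖a (t, p) - a (t, p₀)‖ ≤ ε) :
    ContinuousOn a (Icc (0 : ℝ) 1 ×ˢ univ) := by
  rintro ⟨t₀, p₀⟩ ⟨ht₀, -⟩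
  rw [Metric.continuousWithinAt_iff'] 
  intro ε hε
  rw [nhdsWithin_prod_eq, nhdsWithin_univ]
  have h1 := Metric.continuousWithinAt_iff'.1 (ht p₀ t₀ ht₀) (ε / 2) (half_pos hε)
  have h2 := hp p₀ (ε / 2 / 2) (by positivity)
  filter_upwards [(h1.and self_mem_nhdsWithin).prod_mk h2] with x hx
  obtain ⟨⟨h3, h4⟩, h5⟩ := hx
  have h6 := h5 x.1 h4
  rw [← dist_eq_norm] at h6
  calc dist (a x) (a (t₀, p₀)) ≤ dist (a x) (a (x.1, p₀)) + dist (a (x.1, p₀)) (a (t₀, p₀)) :=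
        dist_triangle _ _ _
    _ < ε := by
      have : dist (a x) (a (x.1, p₀)) ≤ ε / 2 / 2 := h6
      linarith

variable [NormedSpace ℝ Z] [NormedAddCommGroup P] [NormedSpace ℝ P]

/-- Go from (t₀, p₀) to (t₀, p) and then to (t, p). The first increment uses differentiability at
`p₀` only; the second uses the mean value inequality in time and the joint continuity of the time
derivative `G`. -/
theorem hasFDerivWithinAt_of_partial {x : ℝ × P → Z} {G : ℝ × P → Z} {A : P →L[ℝ] Z} {t₀ : ℝ}
    {p₀ : P} (ht₀ : t₀ ∈ Icc (0 : ℝ) 1) (hG : ContinuousOn G (Icc (0 : ℝ) 1 ×ˢ univ))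
    (hx : ∀ p, ∀ t ∈ Icc (0 : ℝ) 1, HasDerivWithinAt (fun s => x (s, p)) (G (t, p)) (Icc 0 1) t)
    (hA : HasFDerivAt (fun p => x (t₀, p)) A p₀) :
    HasFDerivWithinAt x ((ContinuousLinearMap.toSpanSingleton ℝ (G (t₀, p₀))).coprod A)
      (Icc (0 : ℝ) 1 ×ˢ univ) (t₀, p₀) := by
  rw [hasFDerivWithinAt_iff_isLittleO, Asymptotics.isLittleO_iff]
  intro c hc
  have h1 := Metric.continuousWithinAt_iff.1 (hG (t₀, p₀) ⟨ht₀, trivial⟩) (c / 2) (half_pos hc)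
  obtain ⟨δ, hδ, h1⟩ := h1
  have h2 := (hasFDerivAt_iff_isLittleO.1 hA)
  have h2 := (Asymptotics.isLittleO_iff.1 h2) (half_pos hc)
  obtain ⟨δ', hδ', h2⟩ := Metric.eventually_nhds_iff.1 h2
  have hball : ball (t₀, p₀) (min δ δ') ∈ 𝓝[Icc (0 : ℝ) 1 ×ˢ univ] (t₀, p₀) :=
    mem_nhdsWithin_of_mem_nhds (ball_mem_nhds _ (lt_min hδ hδ'))
  filter_upwards [hball, self_mem_nhdsWithin] with y hy hyI
  obtain ⟨t, p⟩ := y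
  have ht : t ∈ Icc (0 : ℝ) 1 := hyI.1
  rw [mem_ball, Prod.dist_eq, max_lt_iff] at hy
  have hdt : dist t t₀ < δ := hy.1.trans_le (min_le_left _ _)
  have hdp : dist p p₀ < δ := hy.2.trans_le (min_le_left _ _)
  have hdp' : dist p p₀ < δ' := hy.2.trans_le (min_le_right _ _)
  have hconv : Convex ℝ (Icc (0 : ℝ) 1 ∩ ball t₀ δ) := (convex_Icc 0 1).inter (convex_ball _ _)
  have h3 : ‖(x (t, p) - t • G (t₀, p₀)) - (x (t₀, p) - t₀ • G (t₀, p₀))‖ ≤ c / 2 * ‖t - t₀‖ := by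
    refine hconv.norm_image_sub_le_of_norm_hasDerivWithin_le
      (f := fun s => x (s, p) - s • G (t₀, p₀)) (f' := fun s => G (s, p) - G (t₀, p₀))
      (fun s hs => ?_) (fun s hs => ?_) ⟨ht₀, mem_ball_self hδ⟩ ⟨ht, hdt⟩
    · have := ((hx p s hs.1).mono inter_subset_left).fun_sub
        (((hasDerivAt_id s).smul_const (G (t₀, p₀))).hasDerivWithinAt
          (s := Icc (0 : ℝ) 1 ∩ ball t₀ δ))
      simpa using this
    · rw [← dist_eq_norm]
      exact (h1 ⟨hs.1, trivial⟩ (by rw [Prod.dist_eq]; exact max_lt hs.2 hdp)).le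
  have h4 := h2 hdp'
  have h5 : x (t, p) - x (t₀, p₀) - ((ContinuousLinearMap.toSpanSingleton ℝ (G (t₀, p₀))).coprod A)
      ((t, p) - (t₀, p₀)) = ((x (t, p) - t • G (t₀, p₀)) - (x (t₀, p) - t₀ • G (t₀, p₀))) +
        (x (t₀, p) - x (t₀, p₀) - A (p - p₀)) := by
    simp [sub_smul]
    abel
  rw [h5]
  have h6 : ‖t - t₀‖ ≤ ‖(t, p) - (t₀, p₀)‖ := norm_fst_le ((t, p) - (t₀, p₀))
  have h7 : ‖p - p₀‖ ≤ ‖(t, p) - (t₀, p₀)‖ := norm_snd_le ((t, p) - (t₀, p₀))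
  have h8 := norm_add_le ((x (t, p) - t • G (t₀, p₀)) - (x (t₀, p) - t₀ • G (t₀, p₀)))
    (x (t₀, p) - x (t₀, p₀) - A (p - p₀))
  nlinarith

/-- The difference of two solutions solves the linear equation with the source (L_p - L_{p₀})
a_{p₀}, which is uniformly small; Grönwall's inequality applies. -/
theorem continuousOn_linear_solution {T : Type*} [TopologicalSpace T] {L : ℝ × T → Z →L[ℝ] Z}
    (hL : ContinuousOn L (Icc (0 : ℝ) 1 ×ˢ univ)) {a : ℝ × T → Z}
    (ha0 : Continuous fun p => a (0, p))
    (ha : ∀ p, Solves (fun t z => L (t, p) z) (fun t => a (t, p))) :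
    ContinuousOn a (Icc (0 : ℝ) 1 ×ˢ univ) := by
  refine continuousOn_of_uniform (fun p => (ha p).continuousOn) fun p₀ ε hε => ?_
  obtain ⟨ℓ, hℓ⟩ := isCompact_Icc.exists_bound_of_continuousOn
    (hL.comp (f := fun t : ℝ => (t, p₀)) (s := Icc 0 1) (by fun_prop) fun t ht => ⟨ht, trivial⟩)
  obtain ⟨C, hC⟩ := isCompact_Icc.exists_bound_of_continuousOn (ha p₀).continuousOn
  have hℓ0 : 0 ≤ ℓ := (norm_nonneg _).trans (hℓ 0 (by simp))
  have hC0 : 0 ≤ C := (norm_nonneg _).trans (hC 0 (by simp))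
  set η : ℝ := min 1 (ε / ((1 + C) * Real.exp (ℓ + 1 + 1))) with hη
  have hηpos : 0 < η := by positivity
  have h0 : ∀ᶠ p in 𝓝 p₀, ‖a (0, p) - a (0, p₀)‖ < η := by
    have := Metric.tendsto_nhds.1 (ha0.tendsto p₀) η hηpos
    simpa [dist_eq_norm] using this
  filter_upwards [h0, eventually_forall_norm_sub_lt hL p₀ hηpos] with p hp0 hpL t ht
  have hb := norm_le_mul_exp (u := fun t => a (t, p) - a (t, p₀)) (K := ℓ + 1) (δ := η)
    (ε := η * C) (by positivity) hηpos.le (by positivity)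
    (fun t ht => (ha p t ht).sub (ha p₀ t ht)) hp0.le (fun t ht => by
      have e : L (t, p) (a (t, p)) - L (t, p₀) (a (t, p₀)) =
        L (t, p) (a (t, p) - a (t, p₀)) + (L (t, p) - L (t, p₀)) (a (t, p₀)) := by
        simp
      rw [e]
      have e1 : ‖L (t, p)‖ ≤ ℓ + 1 := by
        have := norm_sub_norm_le (L (t, p)) (L (t, p₀))
        have h1 := hpL t ht
        have h2 := hℓ t ht
        have h3 : η ≤ 1 := min_le_left _ _
        simp only [Function.comp_apply] at h2
        linarith
      refine (norm_add_le _ _).trans (add_le_add ?_ ?_)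
      · exact ((L (t, p)).le_opNorm _).trans (mul_le_mul_of_nonneg_right e1 (norm_nonneg _))
      · exact (ContinuousLinearMap.le_opNorm _ _).trans
          (mul_le_mul (hpL t ht).le (hC t ht) (norm_nonneg _) hηpos.le)) ht
  refine hb.trans ?_
  have h1 : η ≤ ε / ((1 + C) * Real.exp (ℓ + 1 + 1)) := min_le_right _ _
  rw [le_div_iff₀ (by positivity)] at h1
  linarith

end Parameters

end UnitODE

end

/-! ### Smooth dependence on parameters -/

section

namespace UnitODE

open Metric Filter

theorem uniqueDiffOn_strip {Z : Type*} [NormedAddCommGroup Z] [NormedSpace ℝ Z] :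
    UniqueDiffOn ℝ (Icc (0 : ℝ) 1 ×ˢ (univ : Set Z)) :=
  (uniqueDiffOn_Icc zero_lt_one).prod uniqueDiffOn_univ

section

variable {Z P : Type*} [NormedAddCommGroup Z] [NormedSpace ℝ Z] [NormedAddCommGroup P]
  [NormedSpace ℝ P]

/-- The derivative in the space variable of a function on `[0, 1] × Z`. -/
noncomputable def spaceDeriv {W : Type*} [NormedAddCommGroup W] [NormedSpace ℝ W]
    (V : ℝ × Z → W) (x : ℝ × Z) : Z →L[ℝ] W :=
  (fderivWithin ℝ V (Icc (0 : ℝ) 1 ×ˢ univ) x).comp (ContinuousLinearMap.inr ℝ ℝ Z)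

theorem hasFDerivAt_spaceDeriv {W : Type*} [NormedAddCommGroup W] [NormedSpace ℝ W]
    {V : ℝ × Z → W} {t : ℝ} {z : Z} (ht : t ∈ Icc (0 : ℝ) 1)
    (hV : DifferentiableWithinAt ℝ V (Icc (0 : ℝ) 1 ×ˢ univ) (t, z)) :
    HasFDerivAt (fun z => V (t, z)) (spaceDeriv V (t, z)) z := by
  rw [← hasFDerivWithinAt_univ]
  exact hV.hasFDerivWithinAt.comp (t := Icc (0 : ℝ) 1 ×ˢ univ) z
    (hasFDerivAt_prodMk_right t z).hasFDerivWithinAt (fun w _ => ⟨ht, trivial⟩)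

theorem contDiffOn_spaceDeriv {W : Type*} [NormedAddCommGroup W] [NormedSpace ℝ W]
    {V : ℝ × Z → W} {m n : WithTop ℕ∞} (hV : ContDiffOn ℝ n V (Icc (0 : ℝ) 1 ×ˢ univ))
    (hmn : m + 1 ≤ n) : ContDiffOn ℝ m (spaceDeriv V) (Icc (0 : ℝ) 1 ×ˢ univ) :=
  (hV.fderivWithin uniqueDiffOn_strip hmn).clm_comp contDiffOn_const

/-- The solutions of an equation depend differentiably on parameters, and the derivative solves the
linearized equation. -/
theorem hasFDerivAt_solution {V : ℝ × Z → Z} (hV : ContDiffOn ℝ 1 V (Icc (0 : ℝ) 1 ×ˢ univ))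
    {x : ℝ × P → Z} (hx : ContinuousOn x (Icc (0 : ℝ) 1 ×ˢ univ))
    (hsol : ∀ p, Solves (fun t z => V (t, z)) (fun t => x (t, p))) {p₀ : P} {A : ℝ → P →L[ℝ] Z}
    (hA0 : HasFDerivAt (fun p => x (0, p)) (A 0) p₀)
    (hA : Solves (fun t a => (spaceDeriv V (t, x (t, p₀))).comp a) A) {t : ℝ}
    (ht : t ∈ Icc (0 : ℝ) 1) : HasFDerivAt (fun p => x (t, p)) (A t) p₀ := by
  have hx0 : ContinuousOn (fun t : ℝ => x (t, p₀)) (Icc 0 1) :=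
    hx.comp (f := fun t : ℝ => (t, p₀)) (by fun_prop) fun t ht => ⟨ht, trivial⟩
  have hD : ContinuousOn (spaceDeriv V) (Icc (0 : ℝ) 1 ×ˢ univ) :=
    (contDiffOn_spaceDeriv (m := 0) hV (by simp)).continuousOn
  have hder : ∀ t ∈ Icc (0 : ℝ) 1, ∀ z, HasFDerivAt (fun z => V (t, z)) (spaceDeriv V (t, z)) z :=
    fun t ht z => hasFDerivAt_spaceDeriv ht (hV.differentiableOn one_ne_zero _ ⟨ht, trivial⟩)
  obtain ⟨ℓ, hℓ⟩ := isCompact_Icc.exists_bound_of_continuousOn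
    (hD.comp (f := fun t : ℝ => (t, x (t, p₀))) (s := Icc 0 1)
      (continuousOn_id.prodMk hx0) fun t ht => ⟨ht, trivial⟩)
  simp only [Function.comp_apply] at hℓ
  have hℓ0 : 0 ≤ ℓ := (norm_nonneg _).trans (hℓ 0 (by simp))
  have hD' : ContinuousOn (fun y : ℝ × Z => spaceDeriv V (y.1, x (y.1, p₀) + y.2))
      (Icc (0 : ℝ) 1 ×ˢ univ) := by
    refine hD.comp (f := fun y : ℝ × Z => (y.1, x (y.1, p₀) + y.2))
      (continuousOn_fst.prodMk (ContinuousOn.add ?_ continuousOn_snd)) fun y hy => ⟨hy.1, trivial⟩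
    exact hx0.comp continuousOn_fst fun y hy => hy.1
  -- First-order expansion along the reference solution, uniform in time: the space derivative is
  -- uniformly close to its values on this compact curve.
  have taylor : ∀ ε > 0, ∀ᶠ p in 𝓝 p₀, ∀ t ∈ Icc (0 : ℝ) 1,
      ‖V (t, x (t, p)) - V (t, x (t, p₀)) - spaceDeriv V (t, x (t, p₀)) (x (t, p) - x (t, p₀))‖ ≤
        ε * ‖x (t, p) - x (t, p₀)‖ := by
    intro ε hε
    obtain ⟨δ, hδ, hδ'⟩ := Metric.eventually_nhds_iff_ball.1
      (eventually_forall_norm_sub_lt hD' (0 : Z) hε)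
    filter_upwards [eventually_forall_norm_sub_lt hx p₀ hδ] with p hp t ht
    refine (convex_ball (x (t, p₀)) δ).norm_image_sub_le_of_norm_hasFDerivWithin_le'
      (f := fun z => V (t, z)) (fun z _ => (hder t ht z).hasFDerivWithinAt) (fun z hz => ?_)
      (mem_ball_self hδ) (by rw [mem_ball, dist_eq_norm]; exact hp t ht)
    have := hδ' (z - x (t, p₀)) (by simpa [dist_eq_norm] using hz) t ht
    simpa using this.le
  obtain ⟨c, hc0, hc⟩ : ∃ c > 0, ∀ᶠ p in 𝓝 p₀, ‖x (0, p) - x (0, p₀)‖ ≤ c * ‖p - p₀‖ :=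
    hA0.isBigO_sub.exists_pos.imp fun c hc => ⟨hc.1, hc.2.bound⟩
  set C := c * Real.exp (ℓ + 1 + 1) with hC
  -- Taking the error constant to be 1 gives a growth constant `ℓ + 1`, and Grönwall's inequality
  -- yields a Lipschitz estimate at `p₀`.
  have hlip : ∀ᶠ p in 𝓝 p₀, ∀ t ∈ Icc (0 : ℝ) 1, ‖x (t, p) - x (t, p₀)‖ ≤ C * ‖p - p₀‖ := by
    filter_upwards [taylor 1 one_pos, hc] with p hp hp0 t ht
    have := norm_le_mul_exp (u := fun t => x (t, p) - x (t, p₀)) (K := ℓ + 1) (by positivity)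
      (by positivity) le_rfl (fun t ht => (hsol p t ht).fun_sub (hsol p₀ t ht)) hp0
      (fun t ht => by
        have h1 := hp t ht
        have h2 := ((spaceDeriv V (t, x (t, p₀))).le_opNorm (x (t, p) - x (t, p₀))).trans
          (mul_le_mul_of_nonneg_right (hℓ t ht) (norm_nonneg _))
        have h3 := norm_sub_norm_le (V (t, x (t, p)) - V (t, x (t, p₀)))
          (spaceDeriv V (t, x (t, p₀)) (x (t, p) - x (t, p₀)))
        linarith) ht
    rw [hC]
    linarith
  rw [hasFDerivAt_iff_isLittleO, Asymptotics.isLittleO_iff]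
  intro η hη
  -- The remainder starts below ε‖p - p₀‖ and has source at most εC‖p - p₀‖, so Grönwall's
  -- inequality bounds it by ε(1 + C)exp(ℓ + 1)‖p - p₀‖ = η‖p - p₀‖.
  set ε := η / ((1 + C) * Real.exp (ℓ + 1)) with hε
  have hCpos : 0 < C := by positivity
  have hεpos : 0 < ε := by positivity
  have h0 := Asymptotics.isLittleO_iff.1 (hasFDerivAt_iff_isLittleO.1 hA0) hεpos
  filter_upwards [taylor ε hεpos, hlip, h0] with p hp hlp hp0
  have := norm_le_mul_exp (u := fun t => x (t, p) - x (t, p₀) - A t (p - p₀)) (K := ℓ)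
    (δ := ε * ‖p - p₀‖) (ε := ε * (C * ‖p - p₀‖)) hℓ0 (by positivity) (by positivity)
    (fun t ht => ((hsol p t ht).fun_sub (hsol p₀ t ht)).fun_sub
      ((hA t ht).clm_apply (hasDerivWithinAt_const _ _ (p - p₀)))) hp0 (fun t ht => by
        have h1 := hp t ht
        have h2 := ((spaceDeriv V (t, x (t, p₀))).le_opNorm
          (x (t, p) - x (t, p₀) - A t (p - p₀))).trans
          (mul_le_mul_of_nonneg_right (hℓ t ht) (norm_nonneg _))
        have h3 : V (t, x (t, p)) - V (t, x (t, p₀)) -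
            (((spaceDeriv V (t, x (t, p₀))).comp (A t)) (p - p₀) + A t 0) =
            (V (t, x (t, p)) - V (t, x (t, p₀)) -
              spaceDeriv V (t, x (t, p₀)) (x (t, p) - x (t, p₀))) +
              spaceDeriv V (t, x (t, p₀)) (x (t, p) - x (t, p₀) - A t (p - p₀)) := by
          simp
        rw [h3]
        refine (norm_add_le _ _).trans ?_
        have h4 := mul_le_mul_of_nonneg_left (hlp t ht) hεpos.le
        linarith) ht
  refine this.trans (le_of_eq ?_)
  rw [hε]
  field_simp

end

section

universe u

/-- Bootstrapping: solve the linearized equation for `A`, identify `A` with the derivative of `x` in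
the parameter, and note that the pair (x, A) solves an equation whose right-hand side is one degree
less smooth. By induction (x, A) is of class C^n, and then so is the full derivative (V(t, x), A) of
`x`. The induction changes the state space to `Z × (P →L[ℝ] Z)`, hence the common universe. -/
theorem contDiffOn_solution (n : ℕ) {Z P : Type u} [NormedAddCommGroup Z] [NormedSpace ℝ Z]
    [FiniteDimensional ℝ Z] [NormedAddCommGroup P] [NormedSpace ℝ P] [FiniteDimensional ℝ P]
    {V : ℝ × Z → Z} (hV : ContDiffOn ℝ n V (Icc (0 : ℝ) 1 ×ˢ univ))
    {x : ℝ × P → Z} (hx : ContinuousOn x (Icc (0 : ℝ) 1 ×ˢ univ))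
    (hx0 : ContDiff ℝ n fun p => x (0, p))
    (hsol : ∀ p, Solves (fun t z => V (t, z)) (fun t => x (t, p))) :
    ContDiffOn ℝ n x (Icc (0 : ℝ) 1 ×ˢ univ) := by
  induction n generalizing Z with
  | zero => exact contDiffOn_zero.2 hx
  | succ n ih =>
    have hD : ContDiffOn ℝ n (spaceDeriv V) (Icc (0 : ℝ) 1 ×ˢ univ) :=
      contDiffOn_spaceDeriv hV le_rfl
    have hV1 : ContDiffOn ℝ 1 V (Icc (0 : ℝ) 1 ×ˢ univ) := hV.of_le (by simp)
    have hid : ContinuousOn (fun y : ℝ × P => (y.1, x y)) (Icc (0 : ℝ) 1 ×ˢ univ) :=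
      continuousOn_fst.prodMk hx
    have hDx : ContinuousOn (fun y : ℝ × P => spaceDeriv V (y.1, x y)) (Icc (0 : ℝ) 1 ×ˢ univ) :=
      hD.continuousOn.comp hid fun y hy => ⟨hy.1, trivial⟩
    let L : ℝ × P → (P →L[ℝ] Z) →L[ℝ] (P →L[ℝ] Z) := fun y =>
      ContinuousLinearMap.compL ℝ P Z Z (spaceDeriv V (y.1, x y))
    have hL : ContinuousOn L (Icc (0 : ℝ) 1 ×ˢ univ) :=
      (ContinuousLinearMap.compL ℝ P Z Z).continuous.comp_continuousOn hDx
    have hex : ∀ p, ∃ A : ℝ → P →L[ℝ] Z, A 0 = fderiv ℝ (fun p => x (0, p)) p ∧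
        Solves (fun t a => L (t, p) a) A := fun p =>
      exists_solves_linear (L := fun t => L (t, p))
        (hL.comp (f := fun t : ℝ => (t, p)) (by fun_prop) fun t ht => ⟨ht, trivial⟩) _
    choose A hA0 hA using hex
    have hAc : ContDiff ℝ n fun p => A p 0 := by
      simp only [hA0]
      exact hx0.fderiv_right le_rfl
    have hAcont : ContinuousOn (fun y : ℝ × P => A y.2 y.1) (Icc (0 : ℝ) 1 ×ˢ univ) :=
      continuousOn_linear_solution (a := fun y : ℝ × P => A y.2 y.1) hL hAc.continuous hA
    have hder : ∀ p, ∀ t ∈ Icc (0 : ℝ) 1, HasFDerivAt (fun p => x (t, p)) (A p t) p :=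
      fun p t ht => hasFDerivAt_solution hV1 hx hsol
        (by rw [hA0]; exact (hx0.differentiable (by simp) p).hasFDerivAt) (hA p) ht
    have hVn : ContDiffOn ℝ n V (Icc (0 : ℝ) 1 ×ˢ univ) := hV.of_le (by simp)
    have hpair : ContDiffOn ℝ n (fun y : ℝ × P => (x y, A y.2 y.1)) (Icc (0 : ℝ) 1 ×ˢ univ) := by
      refine ih (Z := Z × (P →L[ℝ] Z))
        (V := fun y => (V (y.1, y.2.1), (spaceDeriv V (y.1, y.2.1)).comp y.2.2))
        ?_ (hx.prodMk hAcont) ((hx0.of_le (by simp)).prodMk hAc)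
        (fun p t ht => (hsol p t ht).prodMk (hA p t ht))
      have hproj : ContDiffOn ℝ n (fun y : ℝ × (Z × (P →L[ℝ] Z)) => (y.1, y.2.1))
        (Icc (0 : ℝ) 1 ×ˢ univ) := by fun_prop
      refine (hVn.comp hproj fun y hy => ⟨hy.1, trivial⟩).prodMk ?_
      exact (hD.comp hproj fun y hy => ⟨hy.1, trivial⟩).clm_comp (by fun_prop)
    have hxn : ContDiffOn ℝ n x (Icc (0 : ℝ) 1 ×ˢ univ) :=
      contDiff_fst.comp_contDiffOn hpair
    have hAn : ContDiffOn ℝ n (fun y : ℝ × P => A y.2 y.1) (Icc (0 : ℝ) 1 ×ˢ univ) :=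
      contDiff_snd.comp_contDiffOn hpair
    have hG : ContDiffOn ℝ n (fun y : ℝ × P => V (y.1, x y)) (Icc (0 : ℝ) 1 ×ˢ univ) :=
      hVn.comp (contDiffOn_fst.prodMk hxn) fun y hy => ⟨hy.1, trivial⟩
    push_cast
    refine (contDiffOn_succ_iff_hasFDerivWithinAt_of_uniqueDiffOn uniqueDiffOn_strip).2
      ⟨by simp, fun y => (ContinuousLinearMap.toSpanSingleton ℝ (V (y.1, x y))).coprod (A y.2 y.1),
        ?_, ?_⟩
    · have h1 : ContDiffOn ℝ n (fun y : ℝ × P => ContinuousLinearMap.toSpanSingleton ℝ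
          (V (y.1, x y))) (Icc (0 : ℝ) 1 ×ˢ univ) :=
        ((ContinuousLinearMap.toSpanSingletonCLE (𝕜 := ℝ) (E := Z)).contDiff.comp_contDiffOn hG)
      have h2 : (fun y : ℝ × P => (ContinuousLinearMap.toSpanSingleton ℝ (V (y.1, x y))).coprod
          (A y.2 y.1)) = fun y => (ContinuousLinearMap.toSpanSingleton ℝ (V (y.1, x y))).comp
            (ContinuousLinearMap.fst ℝ ℝ P) + (A y.2 y.1).comp (ContinuousLinearMap.snd ℝ ℝ P) := by
        ext y <;> simp
      rw [h2]
      exact (h1.clm_comp contDiffOn_const).add (hAn.clm_comp contDiffOn_const)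
    · rintro ⟨t, p⟩ ⟨ht, -⟩
      exact hasFDerivWithinAt_of_partial ht hG.continuousOn hsol (hder p t ht)

end

section

universe u

/-- The flow of a smooth, bounded and Lipschitz time-dependent vector field on `[0, 1]`, with
initial values depending smoothly on parameters. -/
theorem exists_smooth_solution {Z P : Type u} [NormedAddCommGroup Z] [NormedSpace ℝ Z]
    [FiniteDimensional ℝ Z] [NormedAddCommGroup P] [NormedSpace ℝ P] [FiniteDimensional ℝ P]
    {V : ℝ × Z → Z} (hV : ContDiffOn ℝ ∞ V (Icc (0 : ℝ) 1 ×ˢ univ)) {K L : NNReal}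
    (hK : ∀ t ∈ Icc (0 : ℝ) 1, LipschitzWith K fun z => V (t, z))
    (hL : ∀ t ∈ Icc (0 : ℝ) 1, ∀ z, ‖V (t, z)‖ ≤ L) {x₀ : P → Z} (hx₀ : ContDiff ℝ ∞ x₀) :
    ∃ x : ℝ × P → Z, ContDiffOn ℝ ∞ x (Icc (0 : ℝ) 1 ×ˢ univ) ∧ (∀ p, x (0, p) = x₀ p) ∧
      ∀ p, Solves (fun t z => V (t, z)) (fun t => x (t, p)) := by
  have hex : ∀ p, ∃ u : ℝ → Z, u 0 = x₀ p ∧ Solves (fun t z => V (t, z)) u := fun p =>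
    exists_solves hK (fun z => hV.continuousOn.comp (f := fun t : ℝ => (t, z)) (by fun_prop)
      fun t ht => ⟨ht, trivial⟩) hL ⟨0, by simp⟩ (x₀ p)
  choose u hu0 hu using hex
  have hcont : ContinuousOn (fun y : ℝ × P => u y.2 y.1) (Icc (0 : ℝ) 1 ×ˢ univ) := by
    refine continuousOn_of_uniform (fun p => (hu p).continuousOn) fun p₀ ε hε => ?_
    have h0 := Metric.tendsto_nhds.1 (hx₀.continuous.tendsto p₀) (ε / Real.exp (K + 1))
      (by positivity)
    filter_upwards [h0] with p hp t ht
    rw [dist_eq_norm] at hp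
    have := norm_le_mul_exp (u := fun t => u p t - u p₀ t) K.2
      (δ := ε / Real.exp (K + 1)) (by positivity) le_rfl
      (fun t ht => (hu p t ht).fun_sub (hu p₀ t ht)) (by rw [hu0, hu0]; exact hp.le)
      (fun t ht => by simpa using (hK t ht).norm_sub_le (u p t) (u p₀ t)) ht
    refine this.trans (le_of_eq ?_)
    simp
  refine ⟨fun y => u y.2 y.1, contDiffOn_infty.2 fun n => ?_, hu0, hu⟩
  refine contDiffOn_solution n (hV.of_le (mod_cast le_top)) hcont ?_ hu
  simp only [hu0]
  exact hx₀.of_le (mod_cast le_top)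

end

end UnitODE

end

/-! ### Embedding with local retractions, and extension of functions -/

section

open Metric Filter

universe u

section

variable {m : ℕ} {M : Type*} [TopologicalSpace M] [ChartedSpace (EuclideanSpace ℝ (Fin m)) M]

/-- A smooth map `e` to a vector space with smooth local left inverses `r i`, defined on finitely
many open sets `U i` that cover the image. -/
structure RetractedEmbedding (m : ℕ) (M : Type*) [TopologicalSpace M]
    [ChartedSpace (EuclideanSpace ℝ (Fin m)) M] (ι Y : Type*) [NormedAddCommGroup Y]
    [NormedSpace ℝ Y] where
  /-- the embedding -/
  e : M → Y
  /-- the domains of the local left inverses -/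
  U : ι → Set Y
  /-- the local left inverses -/
  r : ι → Y → M
  smooth_e : ContMDiff (𝓡 m) 𝓘(ℝ, Y) ∞ e
  isOpen_U : ∀ i, IsOpen (U i)
  smooth_r : ∀ i, ContMDiffOn 𝓘(ℝ, Y) (𝓡 m) ∞ (r i) (U i)
  r_e : ∀ i p, e p ∈ U i → r i (e p) = p
  cover : ∀ p, ∃ i, e p ∈ U i

/-- Whitney's construction: record the bump functions f_i together with the products f_i ψ_i, where
ψ_i are the charts. Where the coordinate f_i is nonzero, dividing by it and applying the inverse
chart recovers the point, also off the image; no tubular neighbourhood is needed. -/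
theorem exists_retractedEmbedding {m : ℕ} {M : Type u} [TopologicalSpace M]
    [ChartedSpace (EuclideanSpace ℝ (Fin m)) M] [IsManifold (𝓡 m) ∞ M] [T2Space M] [CompactSpace M] :
    ∃ (ι : Type u) (_ : Fintype ι),
      Nonempty (RetractedEmbedding m M ι (ι → EuclideanSpace ℝ (Fin m) × ℝ)) := by
  obtain ⟨ι, f, -⟩ := SmoothBumpCovering.exists_isSubordinate (𝓡 m) (isClosed_univ (X := M))
    fun (x : M) _ => univ_mem
  let _ := f.fintype
  refine ⟨ι, f.fintype, ⟨?_⟩⟩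
  exact
    { e := fun p i => (f i p • extChartAt (𝓡 m) (f.c i) p, f i p)
      U := fun i => {y | (y i).2 ≠ 0} ∩
        (fun y => (y i).2⁻¹ • (y i).1) ⁻¹' (extChartAt (𝓡 m) (f.c i)).target
      r := fun i y => (extChartAt (𝓡 m) (f.c i)).symm ((y i).2⁻¹ • (y i).1)
      smooth_e := contMDiff_pi_space.2 fun i =>
        ((f i).contMDiff_smul contMDiffOn_extChartAt).prodMk_space (f i).contMDiff
      isOpen_U := fun i => by
        refine ContinuousOn.isOpen_inter_preimage ?_ ?_ (isOpen_extChartAt_target _)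
        · intro y hy
          have h : Continuous fun y : ι → EuclideanSpace ℝ (Fin m) × ℝ => y i := continuous_apply i
          exact (((continuous_snd.comp h).continuousAt.inv₀ hy).smul
            (continuous_fst.comp h).continuousAt).continuousWithinAt
        · exact isOpen_ne_fun (continuous_snd.comp (continuous_apply i)) continuous_const
      smooth_r := fun i => by
        refine (contMDiffOn_extChartAt_symm (f.c i)).comp ?_ fun y hy => hy.2
        refine ContDiffOn.contMDiffOn (ContDiffOn.smul (ContDiffOn.inv
          (contDiff_snd.comp (contDiff_apply ℝ _ i)).contDiffOn fun y hy => hy.1)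
          (contDiff_fst.comp (contDiff_apply ℝ _ i)).contDiffOn)
      r_e := fun i p hp => by
        have hfp : f i p ≠ 0 := hp.1
        have hsrc : p ∈ (extChartAt (𝓡 m) (f.c i)).source := by
          rw [extChartAt_source]
          exact (f i).support_subset_source hfp
        change (extChartAt (𝓡 m) (f.c i)).symm ((f i p)⁻¹ • f i p • extChartAt (𝓡 m) (f.c i) p) = p
        rw [smul_smul, inv_mul_cancel₀ hfp, one_smul, (extChartAt (𝓡 m) (f.c i)).left_inv hsrc]
      cover := fun p => by
        have h1 : f (f.ind p (mem_univ p)) p = 1 := f.apply_ind p (mem_univ p)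
        refine ⟨f.ind p (mem_univ p), ?_, ?_⟩
        · change f (f.ind p (mem_univ p)) p ≠ 0
          rw [h1]
          exact one_ne_zero
        · rw [mem_preimage]
          simp only [h1, inv_one, one_smul]
          exact (extChartAt (𝓡 m) _).map_source (f.mem_extChartAt_ind_source p (mem_univ p)) }

end

namespace UnitODE

/-- A compactly supported smooth function on `[0, 1] × Y` is bounded and Lipschitz in space. -/
theorem exists_lipschitz_bound {Y F : Type*} [NormedAddCommGroup Y] [NormedSpace ℝ Y]
    [FiniteDimensional ℝ Y] [NormedAddCommGroup F] [NormedSpace ℝ F] {G : ℝ × Y → F}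
    (hG : ContDiffOn ℝ 1 G (Icc (0 : ℝ) 1 ×ˢ univ)) {R : ℝ} (hR : ∀ t y, R < ‖y‖ → G (t, y) = 0) :
    ∃ K L : NNReal, (∀ t ∈ Icc (0 : ℝ) 1, LipschitzWith K fun y => G (t, y)) ∧
      ∀ t ∈ Icc (0 : ℝ) 1, ∀ y, ‖G (t, y)‖ ≤ L := by
  have hc : IsCompact (Icc (0 : ℝ) 1 ×ˢ closedBall (0 : Y) R) :=
    isCompact_Icc.prod (isCompact_closedBall _ _)
  have hsub : Icc (0 : ℝ) 1 ×ˢ closedBall (0 : Y) R ⊆ Icc (0 : ℝ) 1 ×ˢ univ :=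
    prod_mono le_rfl (subset_univ _)
  obtain ⟨L, hL⟩ := hc.exists_bound_of_continuousOn (hG.continuousOn.mono hsub)
  obtain ⟨K, hK⟩ := hc.exists_bound_of_continuousOn
    ((contDiffOn_spaceDeriv (m := 0) hG (by simp)).continuousOn.mono hsub)
  have hder : ∀ t ∈ Icc (0 : ℝ) 1, ∀ y, HasFDerivAt (fun y => G (t, y)) (spaceDeriv G (t, y)) y :=
    fun t ht y => hasFDerivAt_spaceDeriv ht (hG.differentiableOn one_ne_zero _ ⟨ht, trivial⟩)
  refine ⟨K.toNNReal, L.toNNReal, fun t ht => ?_, fun t ht y => ?_⟩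
  · refine lipschitzWith_of_nnnorm_fderiv_le (𝕜 := ℝ) (fun y => (hder t ht y).differentiableAt)
      fun y => ?_
    by_cases hy : ‖y‖ ≤ R
    · rw [(hder t ht y).fderiv, ← NNReal.coe_le_coe, coe_nnnorm]
      exact (hK (t, y) ⟨ht, by simpa using hy⟩).trans (Real.le_coe_toNNReal _)
    · have : (fun y => G (t, y)) =ᶠ[𝓝 y] fun _ => 0 := by
        filter_upwards [continuous_norm.continuousAt.eventually (lt_mem_nhds (not_le.1 hy))]
          with z hz using hR t z hz
      rw [this.fderiv_eq, fderiv_fun_const]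
      simp
  · by_cases hy : ‖y‖ ≤ R
    · exact (hL (t, y) ⟨ht, by simpa using hy⟩).trans (Real.le_coe_toNNReal _)
    · rw [hR t y (not_le.1 hy), norm_zero]
      positivity

end UnitODE

namespace RetractedEmbedding

variable {m : ℕ} {M : Type*} [TopologicalSpace M] [ChartedSpace (EuclideanSpace ℝ (Fin m)) M]
  {ι Y : Type*} [NormedAddCommGroup Y] [NormedSpace ℝ Y] (R : RetractedEmbedding m M ι Y)

theorem injective : Function.Injective R.e := fun p q h => by
  obtain ⟨i, hi⟩ := R.cover p
  rw [← R.r_e i p hi, ← R.r_e i q (h ▸ hi), h]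

/-- Smooth functions on `[0, 1] × M` extend to compactly supported smooth functions on
`[0, 1] × Y`. -/
theorem exists_extension [CompactSpace M] [Finite ι] [FiniteDimensional ℝ Y] {F : Type*}
    [NormedAddCommGroup F] [NormedSpace ℝ F] {g : ℝ × M → F}
    (hg : ContMDiffOn (𝓘(ℝ, ℝ).prod (𝓡 m)) 𝓘(ℝ, F) ∞ g (Icc (0 : ℝ) 1 ×ˢ univ)) :
    ∃ G : ℝ × Y → F, ContDiffOn ℝ ∞ G (Icc (0 : ℝ) 1 ×ˢ univ) ∧
      (∀ t p, G (t, R.e p) = g (t, p)) ∧ ∃ B : ℝ, ∀ t y, B < ‖y‖ → G (t, y) = 0 := by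
  cases nonempty_fintype ι
  have hcomp : IsCompact (range R.e) := isCompact_range R.smooth_e.continuous
  obtain ⟨B, hB⟩ := hcomp.isBounded.subset_ball (0 : Y)
  obtain ⟨ρ, hρ⟩ := SmoothPartitionOfUnity.exists_isSubordinate 𝓘(ℝ, Y) hcomp.isClosed
    (fun i => R.U i ∩ ball 0 B) (fun i => (R.isOpen_U i).inter isOpen_ball) (by
      rintro _ ⟨p, rfl⟩
      obtain ⟨i, hi⟩ := R.cover p
      exact mem_iUnion.2 ⟨i, hi, hB ⟨p, rfl⟩⟩)
  have hzero : ∀ i y, y ∉ R.U i ∩ ball 0 B → ρ i y = 0 := fun i y hy =>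
    image_eq_zero_of_notMem_tsupport fun h => hy (hρ i h)
  -- Off the image the local left inverses disagree, so the functions g(t, r_i y) are averaged with
  -- a partition of unity; at a point e(p) every active term takes the value g(t, p).
  refine ⟨fun x => ∑ i, ρ i x.2 • g (x.1, R.r i x.2), ?_, fun t p => ?_, B, fun t y hy => ?_⟩
  · refine ContDiffOn.sum fun i _ => ?_
    have hcomp : ContDiffOn ℝ ∞ (fun x : ℝ × Y => g (x.1, R.r i x.2))
        (Icc (0 : ℝ) 1 ×ˢ R.U i) := by
      rw [← contMDiffOn_iff_contDiffOn]
      refine hg.comp (f := fun x : ℝ × Y => (x.1, R.r i x.2)) (ContMDiffOn.prodMk ?_ ?_)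
        fun x hx => ⟨hx.1, trivial⟩
      · exact contDiff_fst.contMDiff.contMDiffOn
      · exact (R.smooth_r i).comp contDiff_snd.contMDiff.contMDiffOn fun x hx => hx.2
    have hρi : ContDiff ℝ ∞ fun x : ℝ × Y => ρ i x.2 :=
      ((ρ i).contMDiff.contDiff).comp contDiff_snd
    rintro ⟨t, y⟩ ⟨ht, -⟩
    by_cases hy : y ∈ R.U i
    · refine hρi.contDiffAt.contDiffWithinAt.smul ?_
      refine (hcomp (t, y) ⟨ht, hy⟩).mono_of_mem_nhdsWithin ?_
      rw [nhdsWithin_prod_eq, nhdsWithin_univ]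
      exact Filter.prod_mem_prod self_mem_nhdsWithin ((R.isOpen_U i).mem_nhds hy)
    · have hy' : y ∉ tsupport (ρ i) := fun h => hy (hρ i h).1
      have h0 : (fun x : ℝ × Y => ρ i x.2 • g (x.1, R.r i x.2)) =ᶠ[𝓝 (t, y)] fun _ => 0 := by
        have h1 : ∀ᶠ x : ℝ × Y in 𝓝 (t, y), ρ i x.2 = 0 :=
          continuous_snd.continuousAt.eventually (notMem_tsupport_iff_eventuallyEq.1 hy')
        filter_upwards [h1] with x hx
        rw [hx, zero_smul]
      exact (contDiffAt_const.congr_of_eventuallyEq h0).contDiffWithinAt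
  · have h1 : ∀ i, ρ i (R.e p) • g (t, R.r i (R.e p)) = ρ i (R.e p) • g (t, p) := fun i => by
      by_cases hi : R.e p ∈ R.U i
      · rw [R.r_e i p hi]
      · rw [hzero i _ fun h => hi h.1, zero_smul, zero_smul]
    simp only [h1]
    rw [← Finset.sum_smul, ← finsum_eq_sum_of_fintype, ρ.sum_eq_one ⟨p, rfl⟩, one_smul]
  · refine Finset.sum_eq_zero fun i _ => ?_
    rw [hzero i y, zero_smul]
    rintro ⟨-, h⟩
    rw [mem_ball_zero_iff] at h
    exact hy.not_gt h

end RetractedEmbedding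

end

/-! ### Integral curves stay on the image of the manifold -/

section

open Metric Filter

namespace RetractedEmbedding

variable {m : ℕ} {M : Type*} [TopologicalSpace M] [ChartedSpace (EuclideanSpace ℝ (Fin m)) M]
  {ι Y : Type*} [NormedAddCommGroup Y] [NormedSpace ℝ Y] (R : RetractedEmbedding m M ι Y)

/-- `c` is an integral curve, over `[0, 1]`, of the time-dependent vector field on `M` that the
embedding maps to `g`. -/
def IsCurve (g : ℝ × M → Y) (c : ℝ → M) : Prop :=
  ∀ t ∈ Icc (0 : ℝ) 1, HasDerivWithinAt (fun t => R.e (c t)) (g (t, c t)) (Icc 0 1) t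

theorem IsCurve.comp_affine {R : RetractedEmbedding m M ι Y} {g : ℝ × M → Y} {c : ℝ → M}
    (hc : R.IsCurve g c) (a b : ℝ) (hab : MapsTo (fun s => a + b * s) (Icc 0 1) (Icc (0 : ℝ) 1)) :
    R.IsCurve (fun x => b • g (a + b * x.1, x.2)) (fun s => c (a + b * s)) := by
  intro s hs
  have h1 : HasDerivWithinAt (fun s : ℝ => a + b * s) b (Icc 0 1) s := by
    simpa using (((hasDerivAt_id s).const_mul b).const_add a).hasDerivWithinAt
  exact (hc _ (hab hs)).scomp s h1 hab

theorem IsCurve.eqOn {R : RetractedEmbedding m M ι Y} [CompactSpace M] [Finite ι]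
    [FiniteDimensional ℝ Y] {g : ℝ × M → Y}
    (hg : ContMDiffOn (𝓘(ℝ, ℝ).prod (𝓡 m)) 𝓘(ℝ, Y) ∞ g (Icc (0 : ℝ) 1 ×ˢ univ)) {c c' : ℝ → M}
    (hc : R.IsCurve g c) (hc' : R.IsCurve g c') (h0 : c 0 = c' 0) : EqOn c c' (Icc 0 1) := by
  obtain ⟨G, hG, hGe, B, hB⟩ := R.exists_extension hg
  obtain ⟨K, L, hK, hL⟩ := UnitODE.exists_lipschitz_bound (hG.of_le (by simp)) hB
  have hs : ∀ {c : ℝ → M}, R.IsCurve g c → UnitODE.Solves (fun t y => G (t, y)) fun t => R.e (c t) :=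
    fun h t ht => by
      have := h t ht
      rwa [← hGe] at this
  exact fun t ht => R.injective (UnitODE.Solves.eqOn hK (hs hc) (hs hc') (by simp [h0]) ht)

/-- The local projections onto the image of the embedding fix its tangent vectors. -/
theorem fderiv_proj_mfderiv (i : ι) {p : M} (hp : R.e p ∈ R.U i) (v : TangentSpace (𝓡 m) p) :
    fderiv ℝ (fun y => R.e (R.r i y)) (R.e p) (mfderiv (𝓡 m) 𝓘(ℝ, Y) R.e p v) =
      mfderiv (𝓡 m) 𝓘(ℝ, Y) R.e p v := by
  have he : MDifferentiableAt (𝓡 m) 𝓘(ℝ, Y) R.e p := (R.smooth_e p).mdifferentiableAt (by simp)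
  have hr : MDifferentiableAt 𝓘(ℝ, Y) (𝓡 m) (R.r i) (R.e p) :=
    ((R.smooth_r i).contMDiffAt ((R.isOpen_U i).mem_nhds hp)).mdifferentiableAt (by simp)
  have he' : MDifferentiableAt (𝓡 m) 𝓘(ℝ, Y) R.e (R.r i (R.e p)) := by rwa [R.r_e i p hp]
  have h1 : (fun q => R.e (R.r i (R.e q))) =ᶠ[𝓝 p] R.e := by
    filter_upwards [R.smooth_e.continuous.continuousAt.eventually ((R.isOpen_U i).mem_nhds hp)]
      with q hq
    rw [R.r_e i q hq]
  have h2 := mfderiv_comp p (I := 𝓡 m) (I' := 𝓘(ℝ, Y)) (I'' := 𝓘(ℝ, Y))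
    (g := fun y => R.e (R.r i y)) (he'.comp (R.e p) hr) he
  have h3 : mfderiv (𝓡 m) 𝓘(ℝ, Y) ((fun y => R.e (R.r i y)) ∘ R.e) p =
    mfderiv (𝓡 m) 𝓘(ℝ, Y) R.e p := h1.mfderiv_eq
  rw [h3] at h2
  have h4 := congrArg (fun T => T v) h2
  rw [mfderiv_eq_fderiv] at h4
  exact h4.symm

theorem contDiffOn_proj (i : ι) :
    ContDiffOn ℝ ∞ (fun y => R.e (R.r i y)) (R.U i) := by
  rw [← contMDiffOn_iff_contDiffOn]
  exact R.smooth_e.comp_contMDiffOn (R.smooth_r i)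

/-- Let σ = e ∘ r_i. The defect σ(u) - u has derivative H(t, u) with H = Dσ·V - V. On the image `V`
is tangent and Dσ fixes tangent vectors, so `H` vanishes there; being locally Lipschitz, it
satisfies |H(t, u)| = |H(t, u) - H(t, σ(u))| ≤ K|u - σ(u)|. The defect starts at zero, so it remains
zero. -/
theorem eventually_mem_range {V : ℝ × Y → Y} (hV : ContDiffOn ℝ ∞ V (Icc (0 : ℝ) 1 ×ˢ univ))
    (htan : ∀ t ∈ Icc (0 : ℝ) 1, ∀ p, ∃ v : TangentSpace (𝓡 m) p,
      V (t, R.e p) = mfderiv (𝓡 m) 𝓘(ℝ, Y) R.e p v)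
    {u : ℝ → Y} (hu : UnitODE.Solves (fun t y => V (t, y)) u) {t₀ : ℝ} (ht₀ : t₀ ∈ Ico (0 : ℝ) 1)
    (h₀ : u t₀ ∈ range R.e) : ∀ᶠ t in 𝓝[>] t₀, u t ∈ range R.e := by
  obtain ⟨p, hp⟩ := h₀
  obtain ⟨i, hi⟩ := R.cover p
  have ht₀' : t₀ ∈ Icc (0 : ℝ) 1 := Ico_subset_Icc_self ht₀
  set σ : Y → Y := fun y => R.e (R.r i y) with hσdef
  have hσ := R.contDiffOn_proj i
  have hUo := R.isOpen_U i
  have hσp : σ (R.e p) = R.e p := by simp only [hσdef, R.r_e i p hi]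
  set H : ℝ × Y → Y := fun x => fderiv ℝ σ x.2 (V x) - V x with hH
  have hHtan : ∀ t ∈ Icc (0 : ℝ) 1, ∀ q, R.e q ∈ R.U i → H (t, R.e q) = 0 := by
    intro t ht q hq
    obtain ⟨v, hv⟩ := htan t ht q
    simp only [hH, hv, hσdef, R.fderiv_proj_mfderiv i hq v]
    exact sub_self (G := Y) _
  obtain ⟨ε, hε, hball⟩ := Metric.isOpen_iff.1 hUo _ hi
  have hHs : ContDiffOn ℝ 1 H (Icc (0 : ℝ) 1 ×ˢ ball (R.e p) ε) := by
    have h1 : ContDiffOn ℝ 1 (fun x : ℝ × Y => fderiv ℝ σ x.2) (Icc (0 : ℝ) 1 ×ˢ ball (R.e p) ε) :=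
      (hσ.fderiv_of_isOpen (m := 1) hUo (by norm_cast)).comp contDiff_snd.contDiffOn
        fun x hx => hball hx.2
    have h2 : ContDiffOn ℝ 1 V (Icc (0 : ℝ) 1 ×ˢ ball (R.e p) ε) :=
      (hV.of_le (by simp)).mono (prod_mono le_rfl (subset_univ _))
    exact (h1.clm_apply h2).sub h2
  obtain ⟨K, s, hs, hK⟩ := (hHs (t₀, R.e p) ⟨ht₀', mem_ball_self hε⟩).exists_lipschitzOnWith
    ((convex_Icc 0 1).prod (convex_ball _ _))
  have huc : ContinuousWithinAt u (Icc 0 1) t₀ := (hu t₀ ht₀').continuousWithinAt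
  have hσc : ContinuousAt σ (u t₀) := by
    rw [← hp]
    exact (hσ.continuousOn).continuousAt (hUo.mem_nhds hi)
  have hσuc : ContinuousWithinAt (fun t => σ (u t)) (Icc 0 1) t₀ :=
    ContinuousAt.comp_continuousWithinAt (g := σ) hσc huc
  have hI : Icc (0 : ℝ) 1 ∈ 𝓝[Icc 0 1] t₀ := self_mem_nhdsWithin
  have hbU : ∀ {w : ℝ → Y}, ContinuousWithinAt w (Icc 0 1) t₀ → w t₀ = R.e p →
      ∀ᶠ t in 𝓝[Icc 0 1] t₀, (t, w t) ∈ s ∧ w t ∈ ball (R.e p) ε := by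
    intro w hw hw0
    have hb : ∀ᶠ t in 𝓝[Icc 0 1] t₀, w t ∈ ball (R.e p) ε :=
      hw (by rw [hw0]; exact isOpen_ball.mem_nhds (mem_ball_self hε))
    have hwt : Tendsto (fun t => (t, w t)) (𝓝[Icc 0 1] t₀)
        (𝓝[Icc (0 : ℝ) 1 ×ˢ ball (R.e p) ε] (t₀, R.e p)) := by
      refine tendsto_nhdsWithin_iff.2 ⟨?_, ?_⟩
      · rw [← hw0]
        exact continuousWithinAt_id.prodMk hw
      · filter_upwards [hI, hb] with t ht hbt using ⟨ht, hbt⟩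
    exact (hwt.eventually hs).and hb
  have hev := (hbU huc hp.symm).and (hbU hσuc (by rw [← hp, hσp]))
  obtain ⟨δ, hδ, hδ'⟩ := Metric.mem_nhdsWithin_iff.1 hev
  set t₁ := min 1 (t₀ + δ / 2) with ht₁
  have ht₀₁ : t₀ < t₁ := lt_min ht₀.2 (by linarith)
  have hsub : ∀ t ∈ Icc t₀ t₁, t ∈ Icc (0 : ℝ) 1 ∧ t ∈ ball t₀ δ ∩ Icc 0 1 := by
    intro t ht
    have h1 : t ∈ Icc (0 : ℝ) 1 := ⟨ht₀.1.trans ht.1, ht.2.trans (min_le_left _ _)⟩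
    refine ⟨h1, ?_, h1⟩
    rw [mem_ball, Real.dist_eq, abs_of_nonneg (by linarith [ht.1])]
    linarith [ht.2.trans (min_le_right _ _)]
  have key : ∀ t ∈ Icc t₀ t₁, σ (u t) - u t = 0 := by
    have hd : ∀ t ∈ Icc t₀ t₁, HasDerivWithinAt (fun t => σ (u t) - u t) (H (t, u t)) (Icc 0 1) t := by
      intro t ht
      have hb := (hδ' (hsub t ht).2).1.2
      have hσd : HasFDerivAt σ (fderiv ℝ σ (u t)) (u t) :=
        ((hσ.differentiableOn (by simp)).differentiableAt (hUo.mem_nhds (hball hb))).hasFDerivAt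
      exact (hσd.comp_hasDerivWithinAt t (hu t (hsub t ht).1)).sub (hu t (hsub t ht).1)
    refine fun t ht => eq_zero_of_abs_deriv_le_mul_abs_self_of_eq_zero_right
      (f := fun t => σ (u t) - u t) (f' := fun t => H (t, u t)) (K := K) ?_ ?_ ?_ ?_ t ht
    · exact fun t ht => ((hd t ht).continuousWithinAt).mono fun s hs => (hsub s hs).1
    · intro t ht
      exact UnitODE.hasDerivWithinAt_Ici
        ⟨(hsub t (Ico_subset_Icc_self ht)).1.1, ht.2.trans_le (min_le_left _ _)⟩
        (hd t (Ico_subset_Icc_self ht))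
    · rw [← hp, hσp, sub_self]
    · intro t ht
      obtain ⟨⟨h1, h2⟩, h3, h4⟩ := hδ' (hsub t (Ico_subset_Icc_self ht)).2
      have h5 := hK.dist_le_mul _ h1 _ h3
      rw [hHtan t (hsub t (Ico_subset_Icc_self ht)).1 _ (hball h4), dist_zero_right] at h5
      refine h5.trans (le_of_eq ?_)
      rw [Prod.dist_eq, dist_self, max_eq_right dist_nonneg, dist_comm, dist_eq_norm]
  filter_upwards [Ioc_mem_nhdsGT ht₀₁] with t ht
  exact ⟨R.r i (u t), sub_eq_zero.1 (key t (Ioc_subset_Icc_self ht))⟩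

/-- The set of times spent on the compact image is closed in [0, 1], and open to the right by
`eventually_mem_range`. -/
theorem mem_range [CompactSpace M] {V : ℝ × Y → Y}
    (hV : ContDiffOn ℝ ∞ V (Icc (0 : ℝ) 1 ×ˢ univ))
    (htan : ∀ t ∈ Icc (0 : ℝ) 1, ∀ p, ∃ v : TangentSpace (𝓡 m) p,
      V (t, R.e p) = mfderiv (𝓡 m) 𝓘(ℝ, Y) R.e p v)
    {u : ℝ → Y} (hu : UnitODE.Solves (fun t y => V (t, y)) u) (h₀ : u 0 ∈ range R.e) :
    ∀ t ∈ Icc (0 : ℝ) 1, u t ∈ range R.e := by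
  refine IsClosed.Icc_subset_of_forall_mem_nhdsWithin (s := {t | u t ∈ range R.e}) ?_ h₀ ?_
  · rw [inter_comm]
    have hc : ContinuousOn u (Icc 0 1) := fun t ht => (hu t ht).continuousWithinAt
    exact hc.preimage_isClosed_of_isClosed isClosed_Icc
      (isCompact_range R.smooth_e.continuous).isClosed
  · exact fun t ht => R.eventually_mem_range hV htan hu ht.2 ht.1

end RetractedEmbedding

end

/-! ### Flows on a compact manifold -/

section

open Filter

universe u

namespace RetractedEmbedding

variable {m : ℕ} {M : Type*} [TopologicalSpace M] [ChartedSpace (EuclideanSpace ℝ (Fin m)) M]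
  {ι : Type*} {Y : Type u} [NormedAddCommGroup Y] [NormedSpace ℝ Y] (R : RetractedEmbedding m M ι Y)

/-- The flow of a time-dependent vector field on a compact manifold, together with the integrals of
two functions along it. -/
theorem exists_flow [CompactSpace M] [Finite ι] [FiniteDimensional ℝ Y]
    {g : ℝ × M → Y} {l : ℝ × M → ℝ × ℝ}
    (hg : ContMDiffOn (𝓘(ℝ, ℝ).prod (𝓡 m)) 𝓘(ℝ, Y) ∞ g (Icc (0 : ℝ) 1 ×ˢ univ))
    (hl : ContMDiffOn (𝓘(ℝ, ℝ).prod (𝓡 m)) 𝓘(ℝ, ℝ × ℝ) ∞ l (Icc (0 : ℝ) 1 ×ˢ univ))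
    (htan : ∀ t ∈ Icc (0 : ℝ) 1, ∀ p, ∃ v : TangentSpace (𝓡 m) p,
      g (t, p) = mfderiv (𝓡 m) 𝓘(ℝ, Y) R.e p v) :
    ∃ (φ : ℝ → M → M) (z : ℝ → M → ℝ × ℝ), φ 0 = id ∧ z 0 = 0 ∧
      ContMDiffOn (𝓘(ℝ, ℝ).prod (𝓡 m)) (𝓡 m) ∞ (fun x : ℝ × M => φ x.1 x.2)
        (Icc (0 : ℝ) 1 ×ˢ univ) ∧
      ContMDiffOn (𝓘(ℝ, ℝ).prod (𝓡 m)) 𝓘(ℝ, ℝ × ℝ) ∞ (fun x : ℝ × M => z x.1 x.2)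
        (Icc (0 : ℝ) 1 ×ˢ univ) ∧
      (∀ p, R.IsCurve g fun t => φ t p) ∧
      ∀ p, ∀ t ∈ Icc (0 : ℝ) 1, HasDerivWithinAt (fun t => z t p) (l (t, φ t p)) (Icc 0 1) t := by
  obtain ⟨G, hG, hGe, B, hB⟩ := R.exists_extension (hg.prodMk_space hl)
  obtain ⟨K, L, hK, hL⟩ := UnitODE.exists_lipschitz_bound (hG.of_le (by simp)) hB
  -- The integrals of `l` are extra coordinates of the system, with right-hand side depending on the
  -- `Y`-coordinate only, so their smoothness comes with that of the flow.
  obtain ⟨x, hx, hx0, hxs⟩ := UnitODE.exists_smooth_solution (Z := Y × (ℝ × ℝ)) (P := Y)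
    (V := fun w => G (w.1, w.2.1)) (K := K) (L := L)
    (hG.comp (contDiff_fst.prodMk (contDiff_fst.comp contDiff_snd)).contDiffOn
      fun w hw => ⟨hw.1, trivial⟩)
    (fun t ht => LipschitzWith.of_dist_le_mul fun z w =>
      ((hK t ht).dist_le_mul z.1 w.1).trans (by gcongr; exact le_max_left _ _))
    (fun t ht z => hL t ht z.1) (x₀ := fun y => (y, 0)) (contDiff_id.prodMk contDiff_const)
  have hV : ContDiffOn ℝ ∞ (fun w => (G w).1) (Icc (0 : ℝ) 1 ×ˢ univ) := contDiff_fst.comp_contDiffOn hG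
  have hsol : ∀ y, UnitODE.Solves (fun t y => (G (t, y)).1) fun t => (x (t, y)).1 :=
    fun y t ht => (hasFDerivAt_fst (𝕜 := ℝ) (E := Y) (F := ℝ × ℝ)).comp_hasDerivWithinAt t (hxs y t ht)
  have hrange : ∀ t ∈ Icc (0 : ℝ) 1, ∀ p, ∃ q, R.e q = (x (t, R.e p)).1 := fun t ht p =>
    R.mem_range (V := fun w => (G w).1) hV (fun t ht p => by
      obtain ⟨v, hv⟩ := htan t ht p
      exact ⟨v, by rw [← hv, hGe]⟩) (hsol (R.e p)) ⟨p, by rw [hx0]⟩ t ht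
  have : ∀ t p, ∃ q, t ∈ Icc (0 : ℝ) 1 → R.e q = (x (t, R.e p)).1 := fun t p => by
    by_cases ht : t ∈ Icc (0 : ℝ) 1
    · obtain ⟨q, hq⟩ := hrange t ht p
      exact ⟨q, fun _ => hq⟩
    · exact ⟨p, fun h => absurd h ht⟩
  choose φ hφ using this
  have hxe : ContMDiffOn (𝓘(ℝ, ℝ).prod (𝓡 m)) 𝓘(ℝ, Y × (ℝ × ℝ)) ∞
      (fun w : ℝ × M => x (w.1, R.e w.2)) (Icc (0 : ℝ) 1 ×ˢ univ) :=
    hx.contMDiffOn.comp (contMDiff_fst.prodMk_space (R.smooth_e.comp contMDiff_snd)).contMDiffOn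
      fun w hw => ⟨hw.1, trivial⟩
  have hxe1 : ContMDiffOn (𝓘(ℝ, ℝ).prod (𝓡 m)) 𝓘(ℝ, Y) ∞
      (fun w : ℝ × M => (x (w.1, R.e w.2)).1) (Icc (0 : ℝ) 1 ×ˢ univ) :=
    contDiff_fst.contMDiff.comp_contMDiffOn hxe
  have h0 : (0 : ℝ) ∈ Icc (0 : ℝ) 1 := ⟨le_rfl, zero_le_one⟩
  refine ⟨φ, fun t p => (x (t, R.e p)).2, ?_, ?_, ?_, contDiff_snd.contMDiff.comp_contMDiffOn hxe,
    fun p t ht => ?_, fun p t ht => ?_⟩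
  · ext1 p
    exact R.injective (by rw [hφ 0 p h0, hx0, id])
  · ext1 p
    change (x (0, R.e p)).2 = 0
    rw [hx0]
  · rintro ⟨t, p⟩ ⟨ht, -⟩
    -- Near (t, p) the flow is the solution in `Y` followed by one of the smooth maps r_i.
    obtain ⟨i, hi⟩ := R.cover (φ t p)
    rw [hφ t p ht] at hi
    have hr := ((R.smooth_r i).contMDiffAt ((R.isOpen_U i).mem_nhds hi))
    have h1 := hxe1 (t, p) ⟨ht, trivial⟩
    refine (ContMDiffAt.comp_contMDiffWithinAt (t, p) hr h1).congr_of_eventuallyEq_of_mem ?_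
      ⟨ht, trivial⟩
    filter_upwards [self_mem_nhdsWithin,
      h1.continuousWithinAt.eventually ((R.isOpen_U i).mem_nhds hi)] with w hw hwU
    rw [Function.comp_apply, ← hφ _ _ hw.1, R.r_e]
    rwa [hφ _ _ hw.1]
  · have := hsol (R.e p) t ht
    simp only [← hφ t p ht, hGe] at this
    exact this.congr_of_mem (fun s hs => hφ s p hs) ht
  · have := (hasFDerivAt_snd (𝕜 := ℝ) (E := Y) (F := ℝ × ℝ)).comp_hasDerivWithinAt t (hxs (R.e p) t ht)
    simp only [← hφ t p ht, hGe] at this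
    exact this

/-- Each stage of a flow on `[0, 1]` is a diffeomorphism. -/
theorem isIsotopy_of_isCurve [CompactSpace M] [Finite ι] [FiniteDimensional ℝ Y] {g : ℝ × M → Y}
    (hg : ContMDiffOn (𝓘(ℝ, ℝ).prod (𝓡 m)) 𝓘(ℝ, Y) ∞ g (Icc (0 : ℝ) 1 ×ˢ univ))
    (htan : ∀ t ∈ Icc (0 : ℝ) 1, ∀ p, ∃ v : TangentSpace (𝓡 m) p,
      g (t, p) = mfderiv (𝓡 m) 𝓘(ℝ, Y) R.e p v)
    {φ : ℝ → M → M} (h0 : φ 0 = id)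
    (hφ : ContMDiffOn (𝓘(ℝ, ℝ).prod (𝓡 m)) (𝓡 m) ∞ (fun x : ℝ × M => φ x.1 x.2)
        (Icc (0 : ℝ) 1 ×ˢ univ)) (hc : ∀ p, R.IsCurve g fun t => φ t p) :
    IsIsotopy (m := m) φ := by
  refine ⟨h0, hφ, fun T hT => ?_⟩
  have hstage : ∀ {φ : ℝ → M → M}, ContMDiffOn (𝓘(ℝ, ℝ).prod (𝓡 m)) (𝓡 m) ∞
      (fun x : ℝ × M => φ x.1 x.2) (Icc (0 : ℝ) 1 ×ˢ univ) → ∀ t ∈ Icc (0 : ℝ) 1,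
      ContMDiff (𝓡 m) (𝓡 m) ∞ (φ t) := fun hφ t ht => by
    rw [← contMDiffOn_univ]
    exact hφ.comp (contMDiff_const.prodMk contMDiff_id).contMDiffOn fun p _ => ⟨ht, trivial⟩
  have hmaps : ∀ {a b : ℝ}, a ∈ Icc (0 : ℝ) 1 → a + b ∈ Icc (0 : ℝ) 1 →
      MapsTo (fun s => a + b * s) (Icc 0 1) (Icc (0 : ℝ) 1) := by
    rintro a b ⟨ha0, ha1⟩ ⟨hb0, hb1⟩ s ⟨hs0, hs1⟩
    constructor <;> nlinarith
  have hsmooth : ∀ {a b : ℝ}, a ∈ Icc (0 : ℝ) 1 → a + b ∈ Icc (0 : ℝ) 1 →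
      ContMDiffOn (𝓘(ℝ, ℝ).prod (𝓡 m)) 𝓘(ℝ, Y) ∞ (fun x : ℝ × M => b • g (a + b * x.1, x.2))
        (Icc (0 : ℝ) 1 ×ˢ univ) := fun {a b} ha hb => by
    have h1 : ContDiff ℝ ∞ fun s : ℝ => a + b * s := contDiff_const.add (contDiff_const.mul contDiff_id)
    have h3 : ContMDiff (𝓘(ℝ, ℝ).prod (𝓡 m)) (𝓘(ℝ, ℝ).prod (𝓡 m)) ∞
        fun x : ℝ × M => (a + b * x.1, x.2) := (h1.contMDiff.comp contMDiff_fst).prodMk contMDiff_snd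
    have h2 := hg.comp (h3.contMDiffOn (s := Icc (0 : ℝ) 1 ×ˢ univ))
      fun x hx => ⟨hmaps ha hb hx.1, trivial⟩
    exact (contDiff_id.const_smul b).contMDiff.comp_contMDiffOn h2
  have h00 : (0 : ℝ) ∈ Icc (0 : ℝ) 1 := ⟨le_rfl, zero_le_one⟩
  have h11 : (1 : ℝ) ∈ Icc (0 : ℝ) 1 := ⟨zero_le_one, le_rfl⟩
  have hT0 : T + -T ∈ Icc (0 : ℝ) 1 := by simp
  -- The field -T g(T - Ts) runs the flow backwards from time T, so its time-one map is the
  -- candidate inverse of `φ T`.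
  obtain ⟨χ, -, hχ0, -, hχ, -, hχc, -⟩ := R.exists_flow (hsmooth hT hT0)
    (l := fun _ => 0) contMDiffOn_const (fun t ht p => by
      obtain ⟨v, hv⟩ := htan _ (hmaps hT hT0 ht) p
      exact ⟨-T • v, by rw [map_smul, ← hv]; rfl⟩)
  have hleft : ∀ p, χ 1 (φ T p) = p := fun p => by
    have := IsCurve.eqOn (hsmooth hT hT0) (hχc (φ T p)) ((hc p).comp_affine T (-T) (hmaps hT hT0))
      (by simp [hχ0]) h11
    simpa [h0] using this
  have hright : ∀ q, φ T (χ 1 q) = q := fun q => by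
    have hT' : 0 + T ∈ Icc (0 : ℝ) 1 := by simpa using hT
    -- Reversing the backward curve gives a curve of T g(Ts) starting at `χ 1 q` and ending at `q`;
    -- uniqueness compares it with the flow `φ` started at `χ 1 q`.
    have h1 := (hχc q).comp_affine 1 (-1) (hmaps h11 (by simp))
    have h2 := (hc (χ 1 q)).comp_affine 0 T (hmaps h00 hT')
    have h3 : (fun x : ℝ × M => (-1 : ℝ) • (-T • g (T + -T * (1 + -1 * x.1), x.2))) =
        fun x : ℝ × M => T • g (0 + T * x.1, x.2) := by
      ext1 x
      rw [smul_smul]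
      congr 1
      · ring
      · congr 2
        ring
    rw [h3] at h1
    have := IsCurve.eqOn (hsmooth h00 hT') h1 h2 (by simp [h0]) h11
    simpa [hχ0] using this.symm
  exact ⟨⟨⟨φ T, χ 1, hleft, hright⟩, hstage hφ T hT, hstage hχ 1 h11⟩, rfl⟩

end RetractedEmbedding

end

/-! ### One-forms and exterior derivatives in charts -/

section

open Filter

namespace OneForm

section VectorSpace

variable {E : Type*} [NormedAddCommGroup E] [NormedSpace ℝ E]

theorem differentiableAt_ofSubsingleton {a : E → E →L[ℝ] ℝ} {y : E} (ha : DifferentiableAt ℝ a y) :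
    DifferentiableAt ℝ
      (fun y => ContinuousAlternatingMap.ofSubsingleton ℝ E ℝ (0 : Fin 1) (a y)) y := by
  exact (ContinuousAlternatingMap.ofSubsingletonLIE (𝕜 := ℝ) (E := E) (F := ℝ)
    (0 : Fin 1)).toContinuousLinearEquiv.differentiableAt.comp y ha

theorem extDeriv_ofSubsingleton_apply {a : E → E →L[ℝ] ℝ} {y : E} (ha : DifferentiableAt ℝ a y)
    (u v : E) :
    extDeriv (fun y => ContinuousAlternatingMap.ofSubsingleton ℝ E ℝ (0 : Fin 1) (a y)) y ![u, v] =
      fderiv ℝ a y u v - fderiv ℝ a y v u := by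
  rw [extDeriv_apply (differentiableAt_ofSubsingleton ha), Fin.sum_univ_two]
  have h : ∀ w w' : E, fderiv ℝ (fun z => a z w) y w' = fderiv ℝ a y w' w := fun w w' => by
    rw [fderiv_clm_apply ha (differentiableAt_const w)]
    simp
  simp [Fin.removeNth, h, sub_eq_add_neg]

end VectorSpace

variable {m : ℕ} {M : Type*} [TopologicalSpace M] [ChartedSpace (EuclideanSpace ℝ (Fin m)) M]

local notation "𝔼" => EuclideanSpace ℝ (Fin m)

/-- The differential at `p` of the chart around `p₀`. -/
noncomputable def toChart (p₀ p : M) : TangentSpace (𝓡 m) p →L[ℝ] 𝔼 :=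
  mfderiv (𝓡 m) 𝓘(ℝ, 𝔼) (extChartAt (𝓡 m) p₀) p

/-- The differential, at the image of `p`, of the inverse of the chart around `p₀`. -/
noncomputable def ofChart (p₀ p : M) : 𝔼 →L[ℝ] TangentSpace (𝓡 m) p :=
  mfderiv 𝓘(ℝ, 𝔼) (𝓡 m) (extChartAt (𝓡 m) p₀).symm (extChartAt (𝓡 m) p₀ p)

theorem inChart_apply (α : OneForm m M) {p₀ p : M} (hp : p ∈ (extChartAt (𝓡 m) p₀).source) (w : 𝔼) :
    α.inChart p₀ (extChartAt (𝓡 m) p₀ p) w = α p (ofChart p₀ p w) := by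
  simp only [inChart]
  rw [(extChartAt (𝓡 m) p₀).left_inv hp]
  rfl

variable [IsManifold (𝓡 m) ∞ M]

theorem ofChart_toChart {p₀ p : M} (hp : p ∈ (extChartAt (𝓡 m) p₀).source)
    (v : TangentSpace (𝓡 m) p) : ofChart p₀ p (toChart p₀ p v) = v := by
  have h := mfderivWithin_extChartAt_symm_comp_mfderiv_extChartAt' (I := 𝓡 m) hp
  rw [ModelWithCorners.range_eq_univ, mfderivWithin_univ] at h
  exact congrArg (fun T => T v) h

theorem toChart_ofChart {p₀ p : M} (hp : p ∈ (extChartAt (𝓡 m) p₀).source) (w : 𝔼) :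
    toChart p₀ p (ofChart p₀ p w) = w := by
  have h := mfderiv_extChartAt_comp_mfderivWithin_extChartAt_symm' (I := 𝓡 m) hp
  rw [ModelWithCorners.range_eq_univ, mfderivWithin_univ] at h
  exact congrArg (fun T => T w) h

theorem inChart_toChart (α : OneForm m M) {p₀ p : M} (hp : p ∈ (extChartAt (𝓡 m) p₀).source)
    (v : TangentSpace (𝓡 m) p) :
    α.inChart p₀ (extChartAt (𝓡 m) p₀ p) (toChart p₀ p v) = α p v := by
  rw [inChart_apply α hp, ofChart_toChart hp]

/-- The trivialization of the tangent bundle at `p₀` is inverted by the differential of the inverse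
chart, so the cotangent trivialization turns the form into exactly this coordinate expression. -/
theorem contMDiffOn_inChart {α : ℝ → OneForm m M} (hα : IsSmoothFamily α) (p₀ : M) :
    ContMDiffOn (𝓘(ℝ, ℝ).prod (𝓡 m)) 𝓘(ℝ, 𝔼 →L[ℝ] ℝ) ∞
      (fun x : ℝ × M => (α x.1).inChart p₀ (extChartAt (𝓡 m) p₀ x.2))
      (Icc (0 : ℝ) 1 ×ˢ (extChartAt (𝓡 m) p₀).source) := by
  rintro ⟨t, p⟩ ⟨ht, hp⟩
  have h := (hα (t, p) ⟨ht, trivial⟩).mono (prod_mono le_rfl (subset_univ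
    (extChartAt (𝓡 m) p₀).source))
  rw [Trivialization.contMDiffWithinAt_iff
    (e := trivializationAt (𝔼 →L[ℝ] ℝ) (fun p : M => TangentSpace (𝓡 m) p →L[ℝ] Trivial M ℝ p) p₀)
    (by
      rw [extChartAt_source] at hp
      rw [hom_trivializationAt_source]
      exact ⟨hp, trivial⟩)] at h
  refine h.2.congr_of_mem (fun x hx => ?_) ⟨ht, hp⟩
  have hx2 := hx.2
  rw [extChartAt_source] at hx2
  have hs := TangentBundle.symmL_trivializationAt (I := 𝓡 m) hx2
  rw [ModelWithCorners.range_eq_univ, mfderivWithin_univ] at hs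
  ext1 w
  rw [inChart_apply _ hx.2, hom_trivializationAt_apply, ContinuousLinearMap.inCoordinates, ofChart,
    ← hs]
  simp

theorem contDiffOn_inChart {α : ℝ → OneForm m M} (hα : IsSmoothFamily α) (p₀ : M) :
    ContDiffOn ℝ ∞ (fun x : ℝ × 𝔼 => (α x.1).inChart p₀ x.2)
      (Icc (0 : ℝ) 1 ×ˢ (extChartAt (𝓡 m) p₀).target) := by
  rw [← contMDiffOn_iff_contDiffOn]
  have h1 : ContMDiffOn 𝓘(ℝ, ℝ × 𝔼) (𝓘(ℝ, ℝ).prod (𝓡 m)) ∞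
      (fun x : ℝ × 𝔼 => (x.1, (extChartAt (𝓡 m) p₀).symm x.2))
      (Icc (0 : ℝ) 1 ×ˢ (extChartAt (𝓡 m) p₀).target) :=
    contDiff_fst.contMDiff.contMDiffOn.prodMk
      ((contMDiffOn_extChartAt_symm p₀).comp contDiff_snd.contMDiff.contMDiffOn fun x hx => hx.2)
  refine ((contMDiffOn_inChart hα p₀).comp h1 fun x hx =>
    ⟨hx.1, (extChartAt (𝓡 m) p₀).map_target hx.2⟩).congr fun x hx => ?_
  simp only [Function.comp_apply]
  rw [(extChartAt (𝓡 m) p₀).right_inv hx.2]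

theorem IsSmooth.isSmoothFamily {α : OneForm m M} (hα : α.IsSmooth) :
    IsSmoothFamily fun _ => α :=
  (ContMDiff.comp (I := 𝓘(ℝ, ℝ).prod (𝓡 m)) hα contMDiff_snd).contMDiffOn

theorem differentiableAt_inChart {α : ℝ → OneForm m M} (hα : IsSmoothFamily α) {t : ℝ}
    (ht : t ∈ Icc (0 : ℝ) 1) {p₀ : M} {y : 𝔼} (hy : y ∈ (extChartAt (𝓡 m) p₀).target) :
    DifferentiableAt ℝ ((α t).inChart p₀) y := by
  have h := (contDiffOn_inChart hα p₀).comp (f := fun y : 𝔼 => (t, y))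
    (contDiff_const.prodMk contDiff_id).contDiffOn (s := (extChartAt (𝓡 m) p₀).target)
    fun y hy => ⟨ht, hy⟩
  exact (h.differentiableOn (by simp)).differentiableAt
    ((isOpen_extChartAt_target p₀).mem_nhds hy)

/-- The exterior derivative can be computed in any chart. -/
theorem d_apply {α : OneForm m M} {p₀ p : M} (hp : p ∈ (extChartAt (𝓡 m) p₀).source)
    (hd : DifferentiableAt ℝ (α.inChart p₀) (extChartAt (𝓡 m) p₀ p)) (u v : TangentSpace (𝓡 m) p) :
    α.d p ![u, v] =
      fderiv ℝ (α.inChart p₀) (extChartAt (𝓡 m) p₀ p) (toChart p₀ p u) (toChart p₀ p v) -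
      fderiv ℝ (α.inChart p₀) (extChartAt (𝓡 m) p₀ p) (toChart p₀ p v) (toChart p₀ p u) := by
  -- The definition of `d` uses a chart that varies with the point; the transition map τ compares it
  -- with the fixed chart at `p₀`.
  set τ : 𝔼 → 𝔼 := fun y => extChartAt (𝓡 m) p₀ ((extChartAt (𝓡 m) p).symm y) with hτ
  set y := extChartAt (𝓡 m) p p with hy
  have hyp : (extChartAt (𝓡 m) p).symm y = p := extChartAt_to_inv p
  have hτy : τ y = extChartAt (𝓡 m) p₀ p := by simp only [hτ, hyp]
  have hmem : ∀ᶠ z in 𝓝 y, z ∈ (extChartAt (𝓡 m) p).target ∧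
      (extChartAt (𝓡 m) p).symm z ∈ (extChartAt (𝓡 m) p₀).source := by
    refine Eventually.and ((isOpen_extChartAt_target p).mem_nhds (mem_extChartAt_target p)) ?_
    exact (continuousAt_extChartAt_symm p).eventually
      ((isOpen_extChartAt_source p₀).mem_nhds (by rw [hyp]; exact hp))
  have hτd : ∀ z, z ∈ (extChartAt (𝓡 m) p).target →
      (extChartAt (𝓡 m) p).symm z ∈ (extChartAt (𝓡 m) p₀).source → ∀ w,
      fderiv ℝ τ z w = toChart p₀ ((extChartAt (𝓡 m) p).symm z)
        (mfderiv 𝓘(ℝ, 𝔼) (𝓡 m) (extChartAt (𝓡 m) p).symm z w) := by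
    intro z hz hz' w
    have h1 : MDifferentiableAt (𝓡 m) 𝓘(ℝ, 𝔼) (extChartAt (𝓡 m) p₀)
        ((extChartAt (𝓡 m) p).symm z) := mdifferentiableAt_extChartAt (by rwa [extChartAt_source] at hz')
    have h2 : MDifferentiableAt 𝓘(ℝ, 𝔼) (𝓡 m) (extChartAt (𝓡 m) p).symm z := by
      have := mdifferentiableWithinAt_extChartAt_symm (I := 𝓡 m) hz
      rwa [ModelWithCorners.range_eq_univ, mdifferentiableWithinAt_univ] at this
    rw [← mfderiv_eq_fderiv]
    exact congrArg (fun T => T w) (mfderiv_comp z h1 h2)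
  have hsmooth : ContDiffAt ℝ ∞ τ y := by
    rw [← contMDiffAt_iff_contDiffAt]
    refine ContMDiffAt.comp (I' := 𝓡 m) y ?_ ?_
    · rw [hyp]
      exact contMDiffOn_extChartAt.contMDiffAt
        ((chartAt 𝔼 p₀).open_source.mem_nhds (by rwa [extChartAt_source] at hp))
    · exact (contMDiffOn_extChartAt_symm p).contMDiffAt
        ((isOpen_extChartAt_target p).mem_nhds (mem_extChartAt_target p))
  have hev : (fun z => ContinuousAlternatingMap.ofSubsingleton ℝ 𝔼 ℝ (0 : Fin 1) (α.inChart p z))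
      =ᶠ[𝓝 y] fun z => (ContinuousAlternatingMap.ofSubsingleton ℝ 𝔼 ℝ (0 : Fin 1)
        (α.inChart p₀ (τ z))).compContinuousLinearMap (fderiv ℝ τ z) := by
    filter_upwards [hmem] with z hz
    ext w
    change α.inChart p z (w 0) = α.inChart p₀ (τ z) (fderiv ℝ τ z (w 0))
    rw [hτd z hz.1 hz.2, hτ, inChart_toChart α hz.2]
    rfl
  -- Naturality of the exterior derivative under τ.
  have hmain : extDeriv (fun z => (ContinuousAlternatingMap.ofSubsingleton ℝ 𝔼 ℝ (0 : Fin 1)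
        (α.inChart p₀ (τ z))).compContinuousLinearMap (fderiv ℝ τ z)) y =
      (extDeriv (fun z => ContinuousAlternatingMap.ofSubsingleton ℝ 𝔼 ℝ (0 : Fin 1)
        (α.inChart p₀ z)) (τ y)).compContinuousLinearMap (fderiv ℝ τ y) :=
    extDeriv_pullback (differentiableAt_ofSubsingleton (by rwa [hτy])) hsmooth
      (by
        rw [minSmoothness_of_isRCLikeNormedField]
        exact WithTop.coe_le_coe.2 (le_top (a := (2 : ℕ∞))))
  have hT : ∀ w : TangentSpace (𝓡 m) p, fderiv ℝ τ y (chartDeriv p w) = toChart p₀ p w := by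
    intro w
    rw [hτd y hmem.self_of_nhds.1 hmem.self_of_nhds.2, hyp]
    exact congrArg _ (ofChart_toChart (mem_extChartAt_source p) w)
  rw [d, dInChart, ← hy, hev.extDeriv_eq, hmain, hτy, ← hT u, ← hT v,
    ← extDeriv_ofSubsingleton_apply hd]
  change extDeriv _ _ (fun i => fderiv ℝ τ y (chartDeriv p (![u, v] i))) = _
  congr 1
  ext1 i
  fin_cases i <;> rfl

end OneForm

end

/-! ### Independence of the defining form -/

section

open Filter

/-- One-forms with the same kernels have proportional exterior derivatives on these kernels. -/
theorem exists_fderiv_eq_smul_of_ker_eq {E : Type*} [NormedAddCommGroup E] [NormedSpace ℝ E]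
    {a b : E → E →L[ℝ] ℝ} {y : E} (ha : DifferentiableAt ℝ a y) (hb : DifferentiableAt ℝ b y)
    (hker : ∀ᶠ z in 𝓝 y, ∀ w, a z w = 0 ↔ b z w = 0) (hne : a y ≠ 0) :
    ∃ c : ℝ, c ≠ 0 ∧ ∀ u v, a y v = 0 → fderiv ℝ b y u v = c * fderiv ℝ a y u v := by
  obtain ⟨w, hw⟩ : ∃ w, a y w ≠ 0 := by
    by_contra! h
    exact hne (ContinuousLinearMap.ext h)
  have haw : DifferentiableAt ℝ (fun z => a z w) y := ha.clm_apply (differentiableAt_const w)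
  have hbw : DifferentiableAt ℝ (fun z => b z w) y := hb.clm_apply (differentiableAt_const w)
  -- Near `y`, `b` is a function times `a`, the factor being the quotient of their values on the
  -- fixed vector `w`. Differentiating, the term with the derivative of the factor contains `a y v`
  -- and drops out.
  have hev : b =ᶠ[𝓝 y] fun z => (b z w / a z w) • a z := by
    filter_upwards [hker, haw.continuousAt.eventually_ne hw] with z hz hzw
    ext v
    have h1 : b z (v - (a z v / a z w) • w) = 0 := by
      rw [← hz]
      simp [hzw]
    simp only [map_sub, map_smul, smul_eq_mul] at h1
    simp only [_root_.smul_apply, smul_eq_mul]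
    field_simp at h1 ⊢
    linarith
  have hu : DifferentiableAt ℝ (fun z => b z w / a z w) y := by
    simp only [div_eq_mul_inv]
    exact hbw.mul (haw.inv hw)
  have hbw0 : b y w ≠ 0 := fun h => hw ((hker.self_of_nhds w).2 h)
  refine ⟨b y w / a y w, div_ne_zero hbw0 hw, fun u v hv => ?_⟩
  rw [hev.fderiv_eq, fderiv_fun_smul hu ha]
  simp [hv]

namespace OneForm

variable {m : ℕ} {M : Type*} [TopologicalSpace M] [ChartedSpace (EuclideanSpace ℝ (Fin m)) M]

local notation "𝔼" => EuclideanSpace ℝ (Fin m)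

/-- The characteristic subspace of `α` at `p`. -/
noncomputable def charField (α : OneForm m M) : TangentSubspaceField m M := fun p =>
  ExtAlg.charSpace (α p : TangentSpace (𝓡 m) p →ₗ[ℝ] ℝ) (α.d p).toAlternatingMap

theorem charField_le_charDistribution (α : OneForm m M) (r : ℕ) (p : M) :
    α.charField p ≤ α.charDistribution r p :=
  ExtAlg.charSpace_le_ker _ _ _

variable [IsManifold (𝓡 m) ∞ M]

theorem exists_d_eq_smul_of_kernelField_eq {α β : OneForm m M} {p : M}
    (hα : DifferentiableAt ℝ (α.inChart p) (extChartAt (𝓡 m) p p))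
    (hβ : DifferentiableAt ℝ (β.inChart p) (extChartAt (𝓡 m) p p))
    (hker : α.kernelField = β.kernelField) (hne : α p ≠ 0) :
    ∃ c : ℝ, c ≠ 0 ∧ ∀ u v, α p u = 0 → α p v = 0 → β.d p ![u, v] = c * α.d p ![u, v] := by
  have hp := mem_extChartAt_source (I := 𝓡 m) p
  have hk : ∀ q v, α q v = 0 ↔ β q v = 0 := fun q v => by
    have := congrArg (fun W => v ∈ W) (congrFun hker q)
    simpa [kernelField] using this
  obtain ⟨c, hc, h⟩ := exists_fderiv_eq_smul_of_ker_eq hα hβ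
    (Eventually.of_forall fun z w => hk _ _) (fun h0 => hne (by
      ext v
      rw [← inChart_toChart α hp, h0]
      rfl))
  refine ⟨c, hc, fun u v hu hv => ?_⟩
  rw [d_apply hp hα, d_apply hp hβ, h _ _ (by rwa [inChart_toChart α hp]),
    h _ _ (by rwa [inChart_toChart α hp])]
  ring

/-- The pointwise consequences of the contact-contact condition, for arbitrary defining forms. -/
theorem isCompl_charField {α β : ℝ → OneForm m M} (hα : IsSmoothFamily α) (hβ : IsSmoothFamily β)
    {t : ℝ} (ht : t ∈ Icc (0 : ℝ) 1) {h k : ℕ} (hm : m = (1 + 2 * h) + (1 + 2 * k))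
    (hst : IsContactContactStructure h k (α t).kernelField (β t).kernelField) (p : M) :
    α t p ≠ 0 ∧ β t p ≠ 0 ∧ IsCompl ((α t).charField p) ((β t).charField p) ∧
      (α t).charDistribution h p ≤ (α t).kernelField p ∧
      (β t).charDistribution k p ≤ (β t).kernelField p := by
  obtain ⟨α', β', hα', hβ', hkα, hkβ, hall⟩ := hst
  obtain ⟨hne, hA, hB⟩ := hall p
  have hrank : Module.finrank ℝ (TangentSpace (𝓡 m) p) = (1 + 2 * h) + (1 + 2 * k) := by
    rw [← hm]
    exact finrank_euclideanSpace_fin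
  have : FiniteDimensional ℝ (TangentSpace (𝓡 m) p) :=
    inferInstanceAs (FiniteDimensional ℝ (EuclideanSpace ℝ (Fin m)))
  obtain ⟨ha0, hb0, hA0, hB0, hcompl⟩ := ExtAlg.isCompl_charSpace hrank hne hA hB
  -- The structure provides forms α', β' with the right kernels, not the given ones. As dα' is a
  -- nonzero multiple of dα_t on the common kernel, the characteristic space and the nonvanishing of
  -- the restricted power carry over.
  have key : ∀ {α : ℝ → OneForm m M} {α' : OneForm m M} {r : ℕ}, IsSmoothFamily α → α'.IsSmooth →
      α'.kernelField = (α t).kernelField →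
      (α' p : TangentSpace (𝓡 m) p →ₗ[ℝ] ℝ) ≠ 0 →
      (ExtAlg.wedgePow (α'.d p).toAlternatingMap r).compLinearMap
        (LinearMap.ker (α' p : TangentSpace (𝓡 m) p →ₗ[ℝ] ℝ)).subtype ≠ 0 →
      α t p ≠ 0 ∧ α'.charField p = (α t).charField p ∧ (α t).charDistribution r p ≤ (α t).kernelField p := by
    intro α α' r hα hα' hk h0 hw
    have hk' : LinearMap.ker (α' p : TangentSpace (𝓡 m) p →ₗ[ℝ] ℝ) =
        LinearMap.ker (α t p : TangentSpace (𝓡 m) p →ₗ[ℝ] ℝ) := congrFun hk p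
    obtain ⟨w, hw0⟩ : ∃ w, α' p w ≠ 0 := by
      by_contra! h
      exact h0 (LinearMap.ext h)
    have hne : α t p ≠ 0 := fun h => hw0 (by
      have : w ∈ LinearMap.ker (α t p : TangentSpace (𝓡 m) p →ₗ[ℝ] ℝ) := by rw [h]; rfl
      rw [← hk'] at this
      exact this)
    have hd := differentiableAt_inChart hα ht (mem_extChartAt_target (I := 𝓡 m) p)
    have hd' := differentiableAt_inChart hα'.isSmoothFamily ht (mem_extChartAt_target (I := 𝓡 m) p)
    obtain ⟨c, hc, hcd⟩ := exists_d_eq_smul_of_kernelField_eq hd hd' hk.symm hne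
    have hcd' : ∀ u v, (α t p : TangentSpace (𝓡 m) p →ₗ[ℝ] ℝ) u = 0 →
        (α t p : TangentSpace (𝓡 m) p →ₗ[ℝ] ℝ) v = 0 →
        (α'.d p).toAlternatingMap ![u, v] = c * ((α t).d p).toAlternatingMap ![u, v] := hcd
    exact ⟨hne, (ExtAlg.charSpace_eq_of_smul hc hk'.symm hcd').symm,
      ExtAlg.ker_le_ker _ _ _ (ExtAlg.wedgePow_ne_zero_of_smul hk'.symm hcd' hw)⟩
  obtain ⟨hα0, h1, h2⟩ := key hα hα' hkα ha0 hA0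
  obtain ⟨hβ0, h3, h4⟩ := key hβ hβ' hkβ hb0 hB0
  refine ⟨hα0, hβ0, ?_, h2, h4⟩
  rw [← h1, ← h3]
  exact hcompl

end OneForm

end

/-! ### Smoothness of solutions of the Moser equations -/

section

open Filter

/-- The solution of an injective linear system depends smoothly on the parameters. -/
theorem contDiffOn_of_linear_system {W H K : Type*} [NormedAddCommGroup W] [NormedSpace ℝ W]
    [NormedAddCommGroup H] [NormedSpace ℝ H] [FiniteDimensional ℝ H] [NormedAddCommGroup K]
    [NormedSpace ℝ K] [FiniteDimensional ℝ K] {n : WithTop ℕ∞} {s : Set W}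
    {T : W → H →ₗ[ℝ] K} (hT : ∀ v, ContDiffOn ℝ n (fun w => T w v) s) {k : W → K}
    (hk : ContDiffOn ℝ n k s) (hinj : ∀ w ∈ s, Function.Injective (T w)) {x : W → H}
    (hx : ∀ w ∈ s, T w (x w) = k w) : ContDiffOn ℝ n x s := by
  intro w₀ hw₀
  -- With `S` a left inverse of `T w₀`, the endomorphism S ∘ T(w) is the identity at `w₀`, hence
  -- invertible nearby, and x = (S ∘ T)⁻¹ S k there.
  obtain ⟨S, hS⟩ := (T w₀).exists_leftInverse_of_injective (LinearMap.ker_eq_bot.2 (hinj w₀ hw₀))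
  let A : W → H →L[ℝ] H := fun w => LinearMap.toContinuousLinearMap (S ∘ₗ T w)
  have hScont : ContDiff ℝ n S := S.toContinuousLinearMap.contDiff
  have hA : ContDiffOn ℝ n A s := contDiffOn_clm_apply.2 fun v => hScont.comp_contDiffOn (hT v)
  have hA0 : A w₀ = ((1 : (H →L[ℝ] H)ˣ) : H →L[ℝ] H) := by
    ext v
    exact LinearMap.congr_fun hS v
  have hinv : ContDiffWithinAt ℝ n (fun w => Ring.inverse (A w)) s w₀ := by
    have h1 : ContDiffAt ℝ n Ring.inverse (A w₀) := by
      rw [hA0]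
      exact contDiffAt_ringInverse ℝ _
    exact h1.comp_contDiffWithinAt w₀ (hA w₀ hw₀)
  have hunit : ∀ᶠ w in 𝓝[s] w₀, IsUnit (A w) :=
    (hA w₀ hw₀).continuousWithinAt.eventually
      (by rw [hA0]; exact Units.nhds 1)
  refine (hinv.clm_apply (hScont.comp_contDiffOn hk w₀ hw₀)).congr_of_eventuallyEq_of_mem ?_ hw₀
  filter_upwards [hunit, self_mem_nhdsWithin] with w hw hws
  have h1 : A w (x w) = S (k w) := by
    rw [← hx w hws]
    rfl
  rw [Function.comp_apply, ← h1, ← mul_apply_eq_comp, Ring.inverse_mul_cancel _ hw]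
  rfl

section

variable {E : Type*} [NormedAddCommGroup E] [NormedSpace ℝ E]

/-- The equation `i_X da = c a - ∂_t a`, `a(X) = 0`, for a time-dependent one-form `F` on an open set
`N` of a vector space and a vector `X` at a point `x` of `[0, 1] × N`. -/
def IsMoserAt (F : ℝ × E → E →L[ℝ] ℝ) (N : Set E) (x : ℝ × E) (X : E) (c : ℝ) : Prop :=
  F x X = 0 ∧ ∀ w, fderivWithin ℝ F (Icc (0 : ℝ) 1 ×ˢ N) x (0, X) w -
    fderivWithin ℝ F (Icc (0 : ℝ) 1 ×ˢ N) x (0, w) X =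
      c * F x w - fderivWithin ℝ F (Icc (0 : ℝ) 1 ×ˢ N) x (1, 0) w

theorem uniqueDiffOn_Icc_prod {N : Set E} (hN : IsOpen N) :
    UniqueDiffOn ℝ (Icc (0 : ℝ) 1 ×ˢ N) :=
  (uniqueDiffOn_Icc zero_lt_one).prod hN.uniqueDiffOn

variable [FiniteDimensional ℝ E]

/-- The triple (X, c, d) solves a linear system with smooth coefficients, overdetermined but
injective by `huniq`; so any pointwise choice of solutions is automatically smooth. -/
theorem contDiffOn_of_isMoserAt {F G : ℝ × E → E →L[ℝ] ℝ} {N : Set E} (hN : IsOpen N)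
    (hF : ContDiffOn ℝ ∞ F (Icc (0 : ℝ) 1 ×ˢ N)) (hG : ContDiffOn ℝ ∞ G (Icc (0 : ℝ) 1 ×ˢ N))
    (huniq : ∀ x ∈ Icc (0 : ℝ) 1 ×ˢ N, ∀ X c d, F x X = 0 → G x X = 0 →
      (∀ w, fderivWithin ℝ F (Icc (0 : ℝ) 1 ×ˢ N) x (0, X) w -
        fderivWithin ℝ F (Icc (0 : ℝ) 1 ×ˢ N) x (0, w) X = c * F x w) →
      (∀ w, fderivWithin ℝ G (Icc (0 : ℝ) 1 ×ˢ N) x (0, X) w -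
        fderivWithin ℝ G (Icc (0 : ℝ) 1 ×ˢ N) x (0, w) X = d * G x w) →
      X = 0 ∧ c = 0 ∧ d = 0)
    {X : ℝ × E → E} {c d : ℝ × E → ℝ} (hX : ∀ x ∈ Icc (0 : ℝ) 1 ×ˢ N, IsMoserAt F N x (X x) (c x))
    (hX' : ∀ x ∈ Icc (0 : ℝ) 1 ×ˢ N, IsMoserAt G N x (X x) (d x)) :
    ContDiffOn ℝ ∞ (fun x => (X x, c x, d x)) (Icc (0 : ℝ) 1 ×ˢ N) := by
  let D : (ℝ × E → E →L[ℝ] ℝ) → ℝ × E → (ℝ × E) →L[ℝ] E →L[ℝ] ℝ := fun F x =>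
    fderivWithin ℝ F (Icc (0 : ℝ) 1 ×ˢ N) x
  have hD : ∀ {F}, ContDiffOn ℝ ∞ F (Icc (0 : ℝ) 1 ×ˢ N) →
      ContDiffOn ℝ ∞ (D F) (Icc (0 : ℝ) 1 ×ˢ N) := fun hF =>
    hF.fderivWithin (uniqueDiffOn_Icc_prod hN) (by simp)
  let J : E →ₗ[ℝ] ℝ × E := LinearMap.inr ℝ ℝ E
  let C : (ℝ × E → E →L[ℝ] ℝ) → ℝ × E → E →ₗ[ℝ] E →L[ℝ] ℝ := fun F x =>
    (D F x : ℝ × E →ₗ[ℝ] E →L[ℝ] ℝ) ∘ₗ J -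
      LinearMap.toContinuousLinearMap.toLinearMap ∘ₗ
        (((ContinuousLinearMap.coeLM ℝ) ∘ₗ (D F x : ℝ × E →ₗ[ℝ] E →L[ℝ] ℝ) ∘ₗ J).flip)
  have hCapply : ∀ F x X w, C F x X w = D F x (0, X) w - D F x (0, w) X := fun F x X w => rfl
  have hC : ∀ {F}, ContDiffOn ℝ ∞ F (Icc (0 : ℝ) 1 ×ˢ N) → ∀ X,
      ContDiffOn ℝ ∞ (fun x => C F x X) (Icc (0 : ℝ) 1 ×ˢ N) := fun {F} hF X => by
    refine contDiffOn_clm_apply.2 fun w => ?_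
    simp only [hCapply]
    exact (((hD hF).clm_apply contDiffOn_const).clm_apply contDiffOn_const).sub
      (((hD hF).clm_apply contDiffOn_const).clm_apply contDiffOn_const)
  let p₁ : E × ℝ × ℝ →ₗ[ℝ] E := LinearMap.fst ℝ E (ℝ × ℝ)
  let p₂ : E × ℝ × ℝ →ₗ[ℝ] ℝ := LinearMap.fst ℝ ℝ ℝ ∘ₗ LinearMap.snd ℝ E (ℝ × ℝ)
  let p₃ : E × ℝ × ℝ →ₗ[ℝ] ℝ := LinearMap.snd ℝ ℝ ℝ ∘ₗ LinearMap.snd ℝ E (ℝ × ℝ)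
  let T : ℝ × E → (E × ℝ × ℝ) →ₗ[ℝ] ((E →L[ℝ] ℝ) × (E →L[ℝ] ℝ)) × ℝ × ℝ := fun x =>
    ((C F x ∘ₗ p₁ - p₂.smulRight (F x)).prod (C G x ∘ₗ p₁ - p₃.smulRight (G x))).prod
      (((F x : E →ₗ[ℝ] ℝ) ∘ₗ p₁).prod ((G x : E →ₗ[ℝ] ℝ) ∘ₗ p₁))
  have hTapply : ∀ x z, T x z = ((C F x z.1 - z.2.1 • F x, C G x z.1 - z.2.2 • G x),
      (F x z.1, G x z.1)) := fun x z => rfl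
  refine contDiffOn_of_linear_system (T := T)
    (k := fun x => ((-D F x (1, 0), -D G x (1, 0)), (0, 0))) (fun z => ?_) ?_ ?_ ?_
  · simp only [hTapply]
    exact ((((hC hF z.1).sub (ContDiffOn.smul (contDiffOn_const (c := z.2.1)) hF)).prodMk
      ((hC hG z.1).sub (ContDiffOn.smul (contDiffOn_const (c := z.2.2)) hG)))).prodMk
      ((hF.clm_apply contDiffOn_const).prodMk (hG.clm_apply contDiffOn_const))
  · exact ((((hD hF).clm_apply contDiffOn_const).neg).prodMk
      (((hD hG).clm_apply contDiffOn_const).neg)).prodMk contDiffOn_const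
  · intro x hx
    rw [← LinearMap.ker_eq_bot, LinearMap.ker_eq_bot']
    rintro ⟨X, c, d⟩ hz
    rw [hTapply] at hz
    simp only [Prod.mk_eq_zero, sub_eq_zero] at hz
    obtain ⟨⟨h1, h2⟩, h3, h4⟩ := hz
    obtain ⟨rfl, rfl, rfl⟩ := huniq x hx X c d h3 h4
      (fun w => by simpa [hCapply] using congrArg (fun L => L w) h1)
      (fun w => by simpa [hCapply] using congrArg (fun L => L w) h2)
    rfl
  · intro x hx
    obtain ⟨h1, h2⟩ := hX x hx
    obtain ⟨h3, h4⟩ := hX' x hx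
    rw [hTapply]
    refine Prod.ext (Prod.ext ?_ ?_) (Prod.ext h1 h3)
    · ext w
      have := h2 w
      simp only [sub_apply, neg_apply, hCapply, _root_.smul_apply, smul_eq_mul, D]
      linarith
    · ext w
      have := h4 w
      simp only [sub_apply, neg_apply, hCapply, _root_.smul_apply, smul_eq_mul, D]
      linarith

end

end

/-! ### The Moser equations on the manifold -/

section

open Filter

section

variable {E F : Type*} [NormedAddCommGroup E] [NormedSpace ℝ E] [NormedAddCommGroup F]
  [NormedSpace ℝ F] {f : ℝ × E → F} {J : Set ℝ} {N : Set E} {t : ℝ} {y : E}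

theorem hasFDerivAt_space_of_isOpen (hN : IsOpen N) (ht : t ∈ J) (hy : y ∈ N)
    (hf : DifferentiableWithinAt ℝ f (J ×ˢ N) (t, y)) :
    HasFDerivAt (fun y => f (t, y)) ((fderivWithin ℝ f (J ×ˢ N) (t, y)).comp
      (ContinuousLinearMap.inr ℝ ℝ E)) y := by
  have h := hf.hasFDerivWithinAt.comp (f := fun y : E => (t, y)) (s := N) y
    (hasFDerivAt_prodMk_right t y).hasFDerivWithinAt fun z hz => ⟨ht, hz⟩
  exact h.hasFDerivAt (hN.mem_nhds hy)

theorem hasDerivWithinAt_time (hy : y ∈ N)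
    (hf : DifferentiableWithinAt ℝ f (J ×ˢ N) (t, y)) :
    HasDerivWithinAt (fun s => f (s, y)) (fderivWithin ℝ f (J ×ˢ N) (t, y) (1, 0))
      J t := by
  exact hf.hasFDerivWithinAt.comp_hasDerivWithinAt (f := fun s : ℝ => (s, y)) t
    ((hasDerivWithinAt_id t _).prodMk (hasDerivWithinAt_const t _ y)) fun z hz => ⟨hz, hy⟩

end

namespace OneForm

variable {m : ℕ} {M : Type*} [TopologicalSpace M] [ChartedSpace (EuclideanSpace ℝ (Fin m)) M]

local notation "𝔼" => EuclideanSpace ℝ (Fin m)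

/-- The equation `i_X dα_t = c α_t - ∂_t α_t`, `α_t(X) = 0`, at a point. -/
def IsMoser (α : ℝ → OneForm m M) (t : ℝ) (p : M) (X : TangentSpace (𝓡 m) p) (c : ℝ) : Prop :=
  α t p X = 0 ∧ ∀ v, (α t).d p ![X, v] =
    c * α t p v - derivWithin (fun s => α s p v) (Icc 0 1) t

/-- The coordinate expression of a family of one-forms. -/
noncomputable def familyInChart (α : ℝ → OneForm m M) (p₀ : M) (x : ℝ × 𝔼) : 𝔼 →L[ℝ] ℝ :=
  (α x.1).inChart p₀ x.2

variable [IsManifold (𝓡 m) ∞ M]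

theorem fderiv_inChart {α : ℝ → OneForm m M} (hα : IsSmoothFamily α) {t : ℝ}
    (ht : t ∈ Icc (0 : ℝ) 1) {p₀ : M} {y : 𝔼} (hy : y ∈ (extChartAt (𝓡 m) p₀).target) (u : 𝔼) :
    fderiv ℝ ((α t).inChart p₀) y u =
      fderivWithin ℝ (familyInChart α p₀) (Icc (0 : ℝ) 1 ×ˢ (extChartAt (𝓡 m) p₀).target)
        (t, y) (0, u) :=
  congrArg (fun L => L u) (hasFDerivAt_space_of_isOpen (isOpen_extChartAt_target p₀) ht hy
    ((contDiffOn_inChart hα p₀).differentiableOn (by simp) (t, y) ⟨ht, hy⟩)).fderiv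

theorem derivWithin_apply {α : ℝ → OneForm m M} (hα : IsSmoothFamily α) {t : ℝ}
    (ht : t ∈ Icc (0 : ℝ) 1) {p₀ p : M} (hp : p ∈ (extChartAt (𝓡 m) p₀).source)
    (v : TangentSpace (𝓡 m) p) :
    derivWithin (fun s => α s p v) (Icc 0 1) t =
      fderivWithin ℝ (familyInChart α p₀) (Icc (0 : ℝ) 1 ×ˢ (extChartAt (𝓡 m) p₀).target)
        (t, extChartAt (𝓡 m) p₀ p) (1, 0) (toChart p₀ p v) := by
  have hy := (extChartAt (𝓡 m) p₀).map_source hp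
  have h := (hasDerivWithinAt_time hy ((contDiffOn_inChart hα p₀).differentiableOn (by simp)
    (t, extChartAt (𝓡 m) p₀ p) ⟨ht, hy⟩)).clm_apply (hasDerivWithinAt_const t _ (toChart p₀ p v))
  simp only [map_zero, add_zero, inChart_toChart _ hp] at h
  exact h.derivWithin (uniqueDiffOn_Icc zero_lt_one t ht)

theorem d_apply_familyInChart {α : ℝ → OneForm m M} (hα : IsSmoothFamily α) {t : ℝ}
    (ht : t ∈ Icc (0 : ℝ) 1) {p₀ p : M} (hp : p ∈ (extChartAt (𝓡 m) p₀).source)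
    (u v : TangentSpace (𝓡 m) p) :
    (α t).d p ![u, v] =
      fderivWithin ℝ (familyInChart α p₀) (Icc (0 : ℝ) 1 ×ˢ (extChartAt (𝓡 m) p₀).target)
        (t, extChartAt (𝓡 m) p₀ p) (0, toChart p₀ p u) (toChart p₀ p v) -
      fderivWithin ℝ (familyInChart α p₀) (Icc (0 : ℝ) 1 ×ˢ (extChartAt (𝓡 m) p₀).target)
        (t, extChartAt (𝓡 m) p₀ p) (0, toChart p₀ p v) (toChart p₀ p u) := by
  have hy := (extChartAt (𝓡 m) p₀).map_source hp
  rw [d_apply hp (differentiableAt_inChart hα ht hy), fderiv_inChart hα ht hy,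
    fderiv_inChart hα ht hy]

theorem IsMoser.isMoserAt {α : ℝ → OneForm m M} (hα : IsSmoothFamily α) {t : ℝ}
    (ht : t ∈ Icc (0 : ℝ) 1) {p₀ p : M} (hp : p ∈ (extChartAt (𝓡 m) p₀).source)
    {X : TangentSpace (𝓡 m) p} {c : ℝ} (h : IsMoser α t p X c) :
    IsMoserAt (familyInChart α p₀) (extChartAt (𝓡 m) p₀).target (t, extChartAt (𝓡 m) p₀ p)
      (toChart p₀ p X) c := by
  refine ⟨?_, fun w => ?_⟩
  · rw [familyInChart, inChart_toChart _ hp, h.1]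
  · have h2 := h.2 (ofChart p₀ p w)
    rwa [d_apply_familyInChart hα ht hp, derivWithin_apply hα ht hp, toChart_ofChart hp,
      ← inChart_apply _ hp] at h2

theorem exists_isMoser {α β : ℝ → OneForm m M} (hα : IsSmoothFamily α) (hβ : IsSmoothFamily β)
    (hcompl : ∀ t ∈ Icc (0 : ℝ) 1, ∀ p, IsCompl ((α t).charField p) ((β t).charField p))
    (hαc : ∀ s ∈ Icc (0 : ℝ) 1, ∀ t ∈ Icc (0 : ℝ) 1, ∀ p, ∀ v ∈ (α t).charField p, α s p v = 0)
    (hβc : ∀ s ∈ Icc (0 : ℝ) 1, ∀ t ∈ Icc (0 : ℝ) 1, ∀ p, ∀ v ∈ (β t).charField p, β s p v = 0)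
    {t : ℝ} (ht : t ∈ Icc (0 : ℝ) 1) (p : M) :
    ∃ (X : TangentSpace (𝓡 m) p) (c d : ℝ), IsMoser α t p X c ∧ IsMoser β t p X d := by
  have : FiniteDimensional ℝ (TangentSpace (𝓡 m) p) :=
    inferInstanceAs (FiniteDimensional ℝ (EuclideanSpace ℝ (Fin m)))
  have hp := mem_extChartAt_source (I := 𝓡 m) p
  let D : (ℝ → OneForm m M) → TangentSpace (𝓡 m) p →ₗ[ℝ] ℝ := fun α =>
    ((fderivWithin ℝ (familyInChart α p) (Icc (0 : ℝ) 1 ×ˢ (extChartAt (𝓡 m) p).target)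
      (t, extChartAt (𝓡 m) p p) (1, 0)).comp (toChart p p) : TangentSpace (𝓡 m) p →L[ℝ] ℝ)
  have hD : ∀ {α}, IsSmoothFamily α → ∀ v, D α v = derivWithin (fun s => α s p v) (Icc 0 1) t :=
    fun hα v => (derivWithin_apply hα ht hp v).symm
  -- For `v` in the characteristic space at time `t`, the function s ↦ α_s(v) vanishes on [0, 1],
  -- and so does its derivative.
  have hD0 : ∀ {α}, IsSmoothFamily α →
      (∀ s ∈ Icc (0 : ℝ) 1, ∀ t ∈ Icc (0 : ℝ) 1, ∀ p, ∀ v ∈ (α t).charField p, α s p v = 0) →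
      ∀ v ∈ (α t).charField p, D α v = 0 := fun {α} hα hαc v hv => by
    have hz : EqOn (fun s => α s p v) (fun _ => (0 : ℝ)) (Icc 0 1) := fun s hs => hαc s hs t ht p v hv
    rw [hD hα, derivWithin_congr hz (hz ht)]
    simp
  obtain ⟨X, c, d, h1, h2, h3, h4⟩ := ExtAlg.exists_moser (hcompl t ht p) (hD0 hα hαc) (hD0 hβ hβc)
  refine ⟨X, c, d, ⟨h1, fun v => ?_⟩, h2, fun v => ?_⟩
  · rw [← hD hα]
    exact h3 v
  · rw [← hD hβ]
    exact h4 v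

theorem contDiffOn_of_isMoser {α β : ℝ → OneForm m M} (hα : IsSmoothFamily α)
    (hβ : IsSmoothFamily β) (hα0 : ∀ t ∈ Icc (0 : ℝ) 1, ∀ p, α t p ≠ 0)
    (hβ0 : ∀ t ∈ Icc (0 : ℝ) 1, ∀ p, β t p ≠ 0)
    (hcompl : ∀ t ∈ Icc (0 : ℝ) 1, ∀ p, IsCompl ((α t).charField p) ((β t).charField p)) {X : (t : ℝ) → (p : M) → TangentSpace (𝓡 m) p} {c d : ℝ → M → ℝ}
    (hX : ∀ t ∈ Icc (0 : ℝ) 1, ∀ p, IsMoser α t p (X t p) (c t p))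
    (hX' : ∀ t ∈ Icc (0 : ℝ) 1, ∀ p, IsMoser β t p (X t p) (d t p)) (p₀ : M) :
    ContDiffOn ℝ ∞ (fun x : ℝ × 𝔼 =>
      (toChart p₀ ((extChartAt (𝓡 m) p₀).symm x.2) (X x.1 ((extChartAt (𝓡 m) p₀).symm x.2)),
        c x.1 ((extChartAt (𝓡 m) p₀).symm x.2), d x.1 ((extChartAt (𝓡 m) p₀).symm x.2)))
      (Icc (0 : ℝ) 1 ×ˢ (extChartAt (𝓡 m) p₀).target) := by
  refine contDiffOn_of_isMoserAt (isOpen_extChartAt_target p₀) (contDiffOn_inChart hα p₀)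
    (contDiffOn_inChart hβ p₀) ?_ ?_ ?_
  · rintro ⟨t, y⟩ ⟨ht, hy⟩ X c d h1 h2 h3 h4
    obtain ⟨p, hp, rfl⟩ : ∃ p, p ∈ (extChartAt (𝓡 m) p₀).source ∧ extChartAt (𝓡 m) p₀ p = y :=
      ⟨_, (extChartAt (𝓡 m) p₀).map_target hy, (extChartAt (𝓡 m) p₀).right_inv hy⟩
    have key : ∀ {α : ℝ → OneForm m M} {c : ℝ}, IsSmoothFamily α →
        (∀ w, fderivWithin ℝ (familyInChart α p₀) (Icc (0 : ℝ) 1 ×ˢ (extChartAt (𝓡 m) p₀).target)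
            (t, extChartAt (𝓡 m) p₀ p) (0, X) w -
          fderivWithin ℝ (familyInChart α p₀) (Icc (0 : ℝ) 1 ×ˢ (extChartAt (𝓡 m) p₀).target)
            (t, extChartAt (𝓡 m) p₀ p) (0, w) X =
          c * familyInChart α p₀ (t, extChartAt (𝓡 m) p₀ p) w) →
        ∀ v, (α t).d p ![ofChart p₀ p X, v] = c * α t p v := fun {α c} hα h v => by
      rw [d_apply_familyInChart hα ht hp, toChart_ofChart hp, h, familyInChart,
        inChart_toChart _ hp]
    have hne : ∀ {a : TangentSpace (𝓡 m) p →L[ℝ] ℝ}, a ≠ 0 →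
        (a : TangentSpace (𝓡 m) p →ₗ[ℝ] ℝ) ≠ 0 := fun h h0 =>
      h (ContinuousLinearMap.ext fun v => LinearMap.congr_fun h0 v)
    obtain ⟨h5, h6, h7⟩ := ExtAlg.moser_unique (hne (hα0 t ht p)) (hne (hβ0 t ht p))
      (hcompl t ht p) (X := ofChart p₀ p X) (c := c) (d := d)
      ((inChart_apply (α t) hp X).symm.trans h1) ((inChart_apply (β t) hp X).symm.trans h2)
      (key hα h3) (key hβ h4)
    refine ⟨?_, h6, h7⟩
    rw [← toChart_ofChart hp X, h5, map_zero]
  · rintro ⟨t, y⟩ ⟨ht, hy⟩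
    have := (hX t ht ((extChartAt (𝓡 m) p₀).symm y)).isMoserAt hα ht
      ((extChartAt (𝓡 m) p₀).map_target hy)
    rwa [(extChartAt (𝓡 m) p₀).right_inv hy] at this
  · rintro ⟨t, y⟩ ⟨ht, hy⟩
    have := (hX' t ht ((extChartAt (𝓡 m) p₀).symm y)).isMoserAt hβ ht
      ((extChartAt (𝓡 m) p₀).map_target hy)
    rwa [(extChartAt (𝓡 m) p₀).right_inv hy] at this

end OneForm

end

/-! ### Derivative of the pull-back in coordinates -/

section

open Filter

section

variable {E F : Type*} [NormedAddCommGroup E] [NormedSpace ℝ E] [NormedAddCommGroup F]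
  [NormedSpace ℝ F]

/-- The space derivative of a smooth family of curves satisfies the linearized equation. -/
theorem hasDerivWithinAt_fderivWithin {f g : ℝ × E → F} {a b : ℝ} (hab : a < b) {N : Set E}
    (hN : IsOpen N) (hf : ContDiffOn ℝ ∞ f (Icc a b ×ˢ N))
    (hg : ∀ t ∈ Icc a b, ∀ x ∈ N, HasDerivWithinAt (fun s => f (s, x)) (g (t, x)) (Icc a b) t)
    {t : ℝ} (ht : t ∈ Icc a b) {x : E} (hx : x ∈ N) {L : E →L[ℝ] F}
    (hL : HasFDerivAt (fun x => g (t, x)) L x) (v : E) :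
    HasDerivWithinAt (fun s => fderivWithin ℝ f (Icc a b ×ˢ N) (s, x) (0, v)) (L v) (Icc a b) t := by
  have hu : UniqueDiffOn ℝ (Icc a b ×ˢ N) := (uniqueDiffOn_Icc hab).prod hN.uniqueDiffOn
  have hD : ContDiffOn ℝ ∞ (fderivWithin ℝ f (Icc a b ×ˢ N)) (Icc a b ×ˢ N) :=
    hf.fderivWithin hu (by simp)
  have hDd := hD.differentiableOn (by simp) (t, x) ⟨ht, hx⟩
  have hgD : ∀ z ∈ N, fderivWithin ℝ f (Icc a b ×ˢ N) (t, z) (1, 0) = g (t, z) := fun z hz =>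
    ((uniqueDiffOn_Icc hab t ht).eq_deriv _ (hasDerivWithinAt_time hz
      (hf.differentiableOn (by simp) (t, z) ⟨ht, hz⟩)) (hg t ht z hz))
  have h1 := (hasDerivWithinAt_time hx hDd).clm_apply
    (hasDerivWithinAt_const t (Icc a b) ((0 : ℝ), v))
  have h2 := (hasFDerivAt_space_of_isOpen hN ht hx hDd).clm_apply
    (hasFDerivAt_const ((1 : ℝ), (0 : E)) x)
  have hev : (fun z => fderivWithin ℝ f (Icc a b ×ˢ N) (t, z) (1, 0)) =ᶠ[𝓝 x] fun z => g (t, z) := by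
    filter_upwards [hN.mem_nhds hx] with z hz using hgD z hz
  have h3 := (hL.congr_of_eventuallyEq hev).unique h2
  -- Time and space derivatives commute also at the end times, since the point lies in the closure
  -- of the interior of the strip.
  have hsymm : IsSymmSndFDerivWithinAt ℝ f (Icc a b ×ˢ N) (t, x) := by
    refine (hf (t, x) ⟨ht, hx⟩).isSymmSndFDerivWithinAt ?_ hu ?_ ⟨ht, hx⟩
    · rw [minSmoothness_of_isRCLikeNormedField]
      exact WithTop.coe_le_coe.2 (le_top (a := (2 : ℕ∞)))
    · rw [interior_prod_eq, closure_prod_eq, interior_Icc, closure_Ioo hab.ne, hN.interior_eq]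
      exact ⟨ht, subset_closure hx⟩
  have h4 := hsymm (1, 0) (0, v)
  rw [h3]
  simpa [h4] using h1

end

section

variable {E : Type*} [NormedAddCommGroup E] [NormedSpace ℝ E]

/-- The derivative along the flow of a solution of the Moser equation of the pull-back of the form,
in coordinates. -/
theorem IsMoserAt.hasDerivWithinAt {F : ℝ × E → E →L[ℝ] ℝ} {X : ℝ × E → E} {c : ℝ × E → ℝ} {N' : Set E}
    (hN' : IsOpen N') (hF : ContDiffOn ℝ ∞ F (Icc (0 : ℝ) 1 ×ˢ N'))
    (hX : ContDiffOn ℝ ∞ X (Icc (0 : ℝ) 1 ×ˢ N'))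
    (hm : ∀ x ∈ Icc (0 : ℝ) 1 ×ˢ N', IsMoserAt F N' x (X x) (c x)) {a b : ℝ} (hab : a < b)
    (hJ : Icc a b ⊆ Icc 0 1) {N : Set E} (hN : IsOpen N) {f : ℝ × E → E}
    (hf : ContDiffOn ℝ ∞ f (Icc a b ×ˢ N)) (hmaps : ∀ t ∈ Icc a b, ∀ x ∈ N, f (t, x) ∈ N')
    (hg : ∀ t ∈ Icc a b, ∀ x ∈ N,
      HasDerivWithinAt (fun s => f (s, x)) (X (t, f (t, x))) (Icc a b) t)
    {t : ℝ} (ht : t ∈ Icc a b) {x : E} (hx : x ∈ N) (v : E) :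
    HasDerivWithinAt (fun s => F (s, f (s, x)) (fderivWithin ℝ f (Icc a b ×ˢ N) (s, x) (0, v)))
      (c (t, f (t, x)) * F (t, f (t, x)) (fderivWithin ℝ f (Icc a b ×ˢ N) (t, x) (0, v)))
      (Icc a b) t := by
  have hy := hmaps t ht x hx
  set y := f (t, x) with hydef
  set w := fderivWithin ℝ f (Icc a b ×ˢ N) (t, x) (0, v) with hw
  have hFd := hF.differentiableOn (by simp) (t, y) ⟨hJ ht, hy⟩
  have hXd := hX.differentiableOn (by simp) (t, y) ⟨hJ ht, hy⟩
  set D := fderivWithin ℝ F (Icc (0 : ℝ) 1 ×ˢ N') (t, y) with hD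
  have hXs := hasFDerivAt_space_of_isOpen hN' (hJ ht) hy hXd
  have hFs := hasFDerivAt_space_of_isOpen hN' (hJ ht) hy hFd
  set DX := (fderivWithin ℝ X (Icc (0 : ℝ) 1 ×ˢ N') (t, y)).comp (ContinuousLinearMap.inr ℝ ℝ E)
  have hfs := hasFDerivAt_space_of_isOpen hN ht hx (hf.differentiableOn (by simp) (t, x) ⟨ht, hx⟩)
  have h1 := hasDerivWithinAt_fderivWithin hab hN hf (g := fun z => X (z.1, f z)) hg ht hx
    (HasFDerivAt.comp (f := fun z => f (t, z)) x hXs hfs) v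
  have h2 : HasDerivWithinAt (fun s => F (s, f (s, x))) (D (1, X (t, y))) (Icc a b) t :=
    hFd.hasFDerivWithinAt.comp_hasDerivWithinAt (f := fun s => (s, f (s, x))) t
      ((hasDerivWithinAt_id t _).prodMk (hg t ht x hx)) fun s hs => ⟨hJ hs, hmaps s hs x hx⟩
  -- Differentiating F(X) = 0 in the direction `w` trades F(DX w) for -D(0, w)X; this produces the
  -- second half of i_X dF, as in Cartan's formula.
  have h3 : D (0, w) (X (t, y)) + F (t, y) (DX w) = 0 := by
    have hz : (fun z => F (t, z) (X (t, z))) =ᶠ[𝓝 y] fun _ => (0 : ℝ) := by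
      filter_upwards [hN'.mem_nhds hy] with z hz using (hm (t, z) ⟨hJ ht, hz⟩).1
    have h4 := ((hasFDerivAt_const (0 : ℝ) y).congr_of_eventuallyEq hz).unique (hFs.clm_apply hXs)
    have h5 := congrArg (fun L => L w) h4
    simp at h5
    linarith
  have h4 := (hm (t, y) ⟨hJ ht, hy⟩).2 w
  have h5 : D (1, X (t, y)) = D (1, 0) + D (0, X (t, y)) := by
    rw [← map_add]
    simp
  refine (h2.clm_apply h1).congr_deriv ?_
  change D (1, X (t, y)) w + F (t, y) (DX w) = _
  rw [h5, add_apply]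
  linarith

/-- Solutions of `u' = l u` are exponentials of integrals of `l`. -/
theorem eq_exp_mul_of_hasDerivWithinAt {u z l : ℝ → ℝ}
    (hu : ∀ t ∈ Icc (0 : ℝ) 1, HasDerivWithinAt u (l t * u t) (Icc 0 1) t)
    (hz : ∀ t ∈ Icc (0 : ℝ) 1, HasDerivWithinAt z (l t) (Icc 0 1) t) (hz0 : z 0 = 0) {t : ℝ}
    (ht : t ∈ Icc (0 : ℝ) 1) : u t = Real.exp (z t) * u 0 := by
  have hd : ∀ t ∈ Icc (0 : ℝ) 1,
      HasDerivWithinAt (fun t => Real.exp (-z t) * u t) 0 (Icc 0 1) t := fun t ht => by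
    refine ((hz t ht).neg.exp.mul (hu t ht)).congr_deriv ?_
    ring
  have h := constant_of_has_deriv_right_zero (fun t ht => (hd t ht).continuousWithinAt)
    (fun t ht => UnitODE.hasDerivWithinAt_Ici ht (hd t (Ico_subset_Icc_self ht))) t ht
  simp only [hz0, neg_zero, Real.exp_zero, one_mul] at h
  rw [← h, ← mul_assoc, ← Real.exp_add]
  simp

end

end

/-! ### Derivative of the pull-back on the manifold -/

section

open Filter

namespace OneForm

variable {m : ℕ} {M : Type*} [TopologicalSpace M] [ChartedSpace (EuclideanSpace ℝ (Fin m)) M]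
  [IsManifold (𝓡 m) ∞ M]

local notation "𝔼" => EuclideanSpace ℝ (Fin m)

theorem contMDiffOn_of_chart {F : Type*} [NormedAddCommGroup F] [NormedSpace ℝ F] {f : ℝ × M → F}
    (h : ∀ p₀ : M, ContDiffOn ℝ ∞ (fun x : ℝ × 𝔼 => f (x.1, (extChartAt (𝓡 m) p₀).symm x.2))
      (Icc (0 : ℝ) 1 ×ˢ (extChartAt (𝓡 m) p₀).target)) :
    ContMDiffOn (𝓘(ℝ, ℝ).prod (𝓡 m)) 𝓘(ℝ, F) ∞ f (Icc (0 : ℝ) 1 ×ˢ univ) := by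
  rintro ⟨t, p⟩ ⟨ht, -⟩
  have h1 : ContMDiffOn (𝓘(ℝ, ℝ).prod (𝓡 m)) 𝓘(ℝ, ℝ × 𝔼) ∞
      (fun x : ℝ × M => (x.1, extChartAt (𝓡 m) p x.2))
      (Icc (0 : ℝ) 1 ×ˢ (extChartAt (𝓡 m) p).source) :=
    contMDiff_fst.contMDiffOn.prodMk_space ((contMDiffOn_extChartAt (x := p)).comp
      contMDiff_snd.contMDiffOn fun x hx => by rw [← extChartAt_source (𝓡 m)]; exact hx.2)
  have h2 : ContMDiffOn (𝓘(ℝ, ℝ).prod (𝓡 m)) 𝓘(ℝ, F) ∞ f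
      (Icc (0 : ℝ) 1 ×ˢ (extChartAt (𝓡 m) p).source) :=
    ((h p).contMDiffOn.comp h1 fun x hx => ⟨hx.1, (extChartAt (𝓡 m) p).map_source hx.2⟩).congr
      fun x hx => by
        simp only [Function.comp_apply]
        rw [(extChartAt (𝓡 m) p).left_inv hx.2]
  refine (h2 (t, p) ⟨ht, mem_extChartAt_source p⟩).mono_of_mem_nhdsWithin ?_
  rw [nhdsWithin_prod_eq, nhdsWithin_univ]
  exact Filter.prod_mem_prod self_mem_nhdsWithin (extChartAt_source_mem_nhds p)

theorem mfderiv_eq_fderiv_toChart {F : Type*} [NormedAddCommGroup F] [NormedSpace ℝ F] {f : M → F}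
    {p₀ p : M} (hp : p ∈ (extChartAt (𝓡 m) p₀).source)
    (hf : MDifferentiableAt (𝓡 m) 𝓘(ℝ, F) f p) (v : TangentSpace (𝓡 m) p) :
    mfderiv (𝓡 m) 𝓘(ℝ, F) f p v =
      fderiv ℝ (fun y => f ((extChartAt (𝓡 m) p₀).symm y)) (extChartAt (𝓡 m) p₀ p)
        (toChart p₀ p v) := by
  have h2 : MDifferentiableAt 𝓘(ℝ, 𝔼) (𝓡 m) (extChartAt (𝓡 m) p₀).symm (extChartAt (𝓡 m) p₀ p) := by
    have := mdifferentiableWithinAt_extChartAt_symm (I := 𝓡 m) ((extChartAt (𝓡 m) p₀).map_source hp)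
    rwa [ModelWithCorners.range_eq_univ, mdifferentiableWithinAt_univ] at this
  have hinv := (extChartAt (𝓡 m) p₀).left_inv hp
  have h3 := mfderiv_comp (I := 𝓘(ℝ, 𝔼)) (I' := 𝓡 m) (I'' := 𝓘(ℝ, F)) (extChartAt (𝓡 m) p₀ p)
    (g := f) (by rwa [hinv]) h2
  have h4 : fderiv ℝ (fun y => f ((extChartAt (𝓡 m) p₀).symm y)) (extChartAt (𝓡 m) p₀ p)
      (toChart p₀ p v) = mfderiv (𝓡 m) 𝓘(ℝ, F) f ((extChartAt (𝓡 m) p₀).symm (extChartAt (𝓡 m) p₀ p))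
        (ofChart p₀ p (toChart p₀ p v)) := by
    rw [← mfderiv_eq_fderiv]
    exact congrArg (fun T => T (toChart p₀ p v)) h3
  rw [h4, hinv, ofChart_toChart hp]

/-- A smooth map sends a vector field that is smooth in charts to a smooth function. -/
theorem contMDiffOn_mfderiv {F : Type*} [NormedAddCommGroup F] [NormedSpace ℝ F] {f : M → F}
    (hf : ContMDiff (𝓡 m) 𝓘(ℝ, F) ∞ f) {X : (t : ℝ) → (p : M) → TangentSpace (𝓡 m) p}
    (hX : ∀ p₀ : M, ContDiffOn ℝ ∞ (fun x : ℝ × 𝔼 =>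
      toChart p₀ ((extChartAt (𝓡 m) p₀).symm x.2) (X x.1 ((extChartAt (𝓡 m) p₀).symm x.2)))
      (Icc (0 : ℝ) 1 ×ˢ (extChartAt (𝓡 m) p₀).target)) :
    ContMDiffOn (𝓘(ℝ, ℝ).prod (𝓡 m)) 𝓘(ℝ, F) ∞
      (fun x : ℝ × M => (mfderiv (𝓡 m) 𝓘(ℝ, F) f x.2 (X x.1 x.2) : F)) (Icc (0 : ℝ) 1 ×ˢ univ) := by
  refine contMDiffOn_of_chart fun p₀ => ?_
  have h1 : ContDiffOn ℝ ∞ (fun y => f ((extChartAt (𝓡 m) p₀).symm y))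
      (extChartAt (𝓡 m) p₀).target := by
    rw [← contMDiffOn_iff_contDiffOn]
    exact hf.comp_contMDiffOn (contMDiffOn_extChartAt_symm p₀)
  have h2 : ContDiffOn ℝ ∞ (fun x : ℝ × 𝔼 =>
      fderiv ℝ (fun y => f ((extChartAt (𝓡 m) p₀).symm y)) x.2)
      (Icc (0 : ℝ) 1 ×ˢ (extChartAt (𝓡 m) p₀).target) :=
    (h1.fderiv_of_isOpen (m := ∞) (isOpen_extChartAt_target p₀) (by simp)).comp
      contDiff_snd.contDiffOn fun x hx => hx.2
  refine (h2.clm_apply (hX p₀)).congr fun x hx => ?_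
  have hs := (extChartAt (𝓡 m) p₀).map_target hx.2
  rw [mfderiv_eq_fderiv_toChart hs ((hf _).mdifferentiableAt (by simp)),
    (extChartAt (𝓡 m) p₀).right_inv hx.2]

/-- Curves are defined through the embedding. Near `c t` the chart factors as (chart ∘ r_i) ∘ e, so
the chain rule converts the velocity in `Y` into the velocity in the chart. -/
theorem hasDerivWithinAt_extChartAt {ι Y : Type*} [NormedAddCommGroup Y] [NormedSpace ℝ Y]
    {R : RetractedEmbedding m M ι Y} {X : (t : ℝ) → (p : M) → TangentSpace (𝓡 m) p} {c : ℝ → M}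
    (hc : R.IsCurve (fun x => mfderiv (𝓡 m) 𝓘(ℝ, Y) R.e x.2 (X x.1 x.2)) c) {t : ℝ}
    (ht : t ∈ Icc (0 : ℝ) 1) {p₀ : M} (hp : c t ∈ (extChartAt (𝓡 m) p₀).source) :
    HasDerivWithinAt (fun s => extChartAt (𝓡 m) p₀ (c s)) (toChart p₀ (c t) (X t (c t)))
      (Icc 0 1) t := by
  obtain ⟨i, hi⟩ := R.cover (c t)
  have hr := (R.smooth_r i).contMDiffAt ((R.isOpen_U i).mem_nhds hi)
  have he := R.smooth_e.contMDiffAt (x := c t)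
  have hs : ContMDiffAt (𝓡 m) 𝓘(ℝ, 𝔼) ∞ (extChartAt (𝓡 m) p₀) (R.r i (R.e (c t))) := by
    rw [R.r_e i _ hi]
    exact contMDiffOn_extChartAt.contMDiffAt
      ((chartAt 𝔼 p₀).open_source.mem_nhds (by rwa [extChartAt_source] at hp))
  have hsr : MDifferentiableAt 𝓘(ℝ, Y) 𝓘(ℝ, 𝔼) (fun y => extChartAt (𝓡 m) p₀ (R.r i y)) (R.e (c t)) :=
    (hs.comp (R.e (c t)) hr).mdifferentiableAt (by simp)
  have hcomp := mfderiv_comp (c t) hsr (he.mdifferentiableAt (by simp))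
  have hev : (fun y => extChartAt (𝓡 m) p₀ (R.r i y)) ∘ R.e =ᶠ[𝓝 (c t)] extChartAt (𝓡 m) p₀ := by
    filter_upwards [R.smooth_e.continuous.continuousAt.eventually ((R.isOpen_U i).mem_nhds hi)]
      with q hq
    rw [Function.comp_apply, R.r_e i q hq]
  rw [hev.mfderiv_eq] at hcomp
  have h1 := (hsr.differentiableAt.hasFDerivAt).comp_hasDerivWithinAt t (hc t ht)
  have h2 : fderiv ℝ (fun y => extChartAt (𝓡 m) p₀ (R.r i y)) (R.e (c t))
      (mfderiv (𝓡 m) 𝓘(ℝ, Y) R.e (c t) (X t (c t))) = toChart p₀ (c t) (X t (c t)) := by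
    rw [← mfderiv_eq_fderiv]
    exact (congrArg (fun T => T (X t (c t))) hcomp).symm
  refine (h1.congr_deriv h2).congr_of_eventuallyEq_of_mem ?_ ht
  filter_upwards [(hc t ht).continuousWithinAt.eventually ((R.isOpen_U i).mem_nhds hi)] with s hs
  rw [Function.comp_apply, R.r_e i _ hs]

/-- The pull-back of a one-form by the flow of a solution of the Moser equation satisfies a linear
differential equation. -/
theorem hasDerivWithinAt_pullback {α : ℝ → OneForm m M} (hα : IsSmoothFamily α)
    {ι Y : Type*} [NormedAddCommGroup Y] [NormedSpace ℝ Y]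
    {R : RetractedEmbedding m M ι Y} {X : (t : ℝ) → (p : M) → TangentSpace (𝓡 m) p}
    (hX : ∀ p₀ : M, ContDiffOn ℝ ∞ (fun x : ℝ × 𝔼 =>
      toChart p₀ ((extChartAt (𝓡 m) p₀).symm x.2) (X x.1 ((extChartAt (𝓡 m) p₀).symm x.2)))
      (Icc (0 : ℝ) 1 ×ˢ (extChartAt (𝓡 m) p₀).target))
    {c : ℝ → M → ℝ} (hm : ∀ t ∈ Icc (0 : ℝ) 1, ∀ p, IsMoser α t p (X t p) (c t p))
    {φ : ℝ → M → M} (hφ : ContMDiffOn (𝓘(ℝ, ℝ).prod (𝓡 m)) (𝓡 m) ∞ (fun x : ℝ × M => φ x.1 x.2)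
        (Icc (0 : ℝ) 1 ×ˢ univ))
    (hc : ∀ p, R.IsCurve (fun x => mfderiv (𝓡 m) 𝓘(ℝ, Y) R.e x.2 (X x.1 x.2)) fun t => φ t p)
    (p : M) (v : TangentSpace (𝓡 m) p) {t : ℝ} (ht : t ∈ Icc (0 : ℝ) 1) :
    HasDerivWithinAt (fun s => pullback (φ s) (α s) p v)
      (c t (φ t p) * pullback (φ t) (α t) p v) (Icc 0 1) t := by
  set p₀ := φ t p with hp₀
  have hpo := isOpen_extChartAt_source (I := 𝓡 m) p₀
  have hf₀ : ContMDiffOn 𝓘(ℝ, ℝ × 𝔼) (𝓡 m) ∞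
      (fun x : ℝ × 𝔼 => φ x.1 ((extChartAt (𝓡 m) p).symm x.2))
      (Icc (0 : ℝ) 1 ×ˢ (extChartAt (𝓡 m) p).target) := by
    have h1 : ContMDiffOn 𝓘(ℝ, ℝ × 𝔼) (𝓘(ℝ, ℝ).prod (𝓡 m)) ∞
        (fun x : ℝ × 𝔼 => (x.1, (extChartAt (𝓡 m) p).symm x.2))
        (Icc (0 : ℝ) 1 ×ˢ (extChartAt (𝓡 m) p).target) :=
      contDiff_fst.contMDiff.contMDiffOn.prodMk
        ((contMDiffOn_extChartAt_symm p).comp contDiff_snd.contMDiff.contMDiffOn fun x hx => hx.2)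
    exact hφ.comp h1 fun x hx => ⟨hx.1, trivial⟩
  set x := extChartAt (𝓡 m) p p with hx
  have hxt : x ∈ (extChartAt (𝓡 m) p).target := mem_extChartAt_target p
  have hxp : (extChartAt (𝓡 m) p).symm x = p := extChartAt_to_inv p
  -- Localize to a nondegenerate time interval around `t`, relatively a neighbourhood in [0, 1], and
  -- to points near `p` whose images all stay in one chart around `φ t p`.
  obtain ⟨a, b, N, hab, hJ, hJt, htJ, hN, hxN, hNt, hmaps⟩ : ∃ (a b : ℝ) (N : Set 𝔼), a < b ∧
      Icc a b ⊆ Icc 0 1 ∧ Icc a b ∈ 𝓝[Icc 0 1] t ∧ t ∈ Icc a b ∧ IsOpen N ∧ x ∈ N ∧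
      N ⊆ (extChartAt (𝓡 m) p).target ∧ ∀ s ∈ Icc a b, ∀ z ∈ N,
        φ s ((extChartAt (𝓡 m) p).symm z) ∈ (extChartAt (𝓡 m) p₀).source := by
    have hev := (hf₀ (t, x) ⟨ht, hxt⟩).continuousWithinAt.eventually
      (hpo.mem_nhds (by simp only [hxp]; exact mem_extChartAt_source p₀))
    rw [nhdsWithin_prod_eq, (isOpen_extChartAt_target p).nhdsWithin_eq hxt] at hev
    obtain ⟨P, hP, Q, hQ, hPQ⟩ := Filter.eventually_prod_iff.1 hev
    obtain ⟨N, hN, hNo, hxN⟩ := mem_nhds_iff.1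
      (Filter.inter_mem hQ ((isOpen_extChartAt_target p).mem_nhds hxt))
    obtain ⟨δ, hδ, hδP⟩ := Metric.mem_nhdsWithin_iff.1 hP
    refine ⟨max 0 (t - δ / 2), min 1 (t + δ / 2), N, ?_, ?_, ?_, ?_, hNo, hxN, fun z hz => (hN hz).2,
      fun s hs z hz => hPQ (hδP ⟨?_, ?_⟩) (hN hz).1⟩
    · rw [max_lt_iff, lt_min_iff, lt_min_iff]
      refine ⟨⟨zero_lt_one, ?_⟩, ?_, ?_⟩ <;> linarith [ht.1, ht.2]
    · exact Icc_subset_Icc (le_max_left _ _) (min_le_left _ _)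
    · rw [← Icc_inter_Icc]
      exact Filter.inter_mem self_mem_nhdsWithin (mem_nhdsWithin_of_mem_nhds
        (Icc_mem_nhds (by linarith) (by linarith)))
    · exact ⟨max_le ht.1 (by linarith), le_min ht.2 (by linarith)⟩
    · have h1 := (le_max_right _ _).trans hs.1
      have h2 := hs.2.trans (min_le_right _ _)
      rw [Metric.mem_ball, Real.dist_eq, abs_lt]
      constructor <;> linarith
    · exact ⟨(le_max_left _ _).trans hs.1, hs.2.trans (min_le_left _ _)⟩
  set f : ℝ × 𝔼 → 𝔼 := fun x => extChartAt (𝓡 m) p₀ (φ x.1 ((extChartAt (𝓡 m) p).symm x.2)) with hf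
  have hfs : ContDiffOn ℝ ∞ f (Icc a b ×ˢ N) := by
    rw [← contMDiffOn_iff_contDiffOn]
    refine (contMDiffOn_extChartAt (x := p₀)).comp (hf₀.mono (prod_mono hJ hNt)) fun y hy => ?_
    rw [← extChartAt_source (𝓡 m)]
    exact hmaps _ hy.1 _ hy.2
  have hmain := IsMoserAt.hasDerivWithinAt (isOpen_extChartAt_target p₀) (contDiffOn_inChart hα p₀)
    (hX p₀) (c := fun y => c y.1 ((extChartAt (𝓡 m) p₀).symm y.2)) (fun y hy => by
      have := (hm y.1 hy.1 ((extChartAt (𝓡 m) p₀).symm y.2)).isMoserAt hα hy.1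
        ((extChartAt (𝓡 m) p₀).map_target hy.2)
      rwa [(extChartAt (𝓡 m) p₀).right_inv hy.2] at this) hab hJ hN hfs
    (fun s hs z hz => (extChartAt (𝓡 m) p₀).map_source (hmaps s hs z hz)) (fun s hs z hz => by
      have h1 := (hasDerivWithinAt_extChartAt (hc ((extChartAt (𝓡 m) p).symm z)) (hJ hs)
        (hmaps s hs z hz)).mono hJ
      simp only [hf]
      rwa [(extChartAt (𝓡 m) p₀).left_inv (hmaps s hs z hz)]) htJ hxN (toChart p p v)
  -- By the chain rule, the coordinate quantity of `IsMoserAt.hasDerivWithinAt` is the pull-back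
  -- evaluated at `v`.
  have hpull : ∀ s ∈ Icc a b, (α s).inChart p₀ (f (s, x))
      (fderivWithin ℝ f (Icc a b ×ˢ N) (s, x) (0, toChart p p v)) = pullback (φ s) (α s) p v := by
    intro s hs
    have hsrc : φ s p ∈ (extChartAt (𝓡 m) p₀).source := by
      have := hmaps s hs x hxN
      rwa [hxp] at this
    have hφs : MDifferentiableAt (𝓡 m) (𝓡 m) (φ s) p := by
      have h1 : ContMDiffOn (𝓡 m) (𝓡 m) ∞ (φ s) univ :=
        hφ.comp (contMDiff_const.prodMk contMDiff_id).contMDiffOn fun q _ => ⟨hJ hs, trivial⟩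
      exact (h1.contMDiffAt Filter.univ_mem).mdifferentiableAt (by simp)
    have hψ : MDifferentiableAt (𝓡 m) 𝓘(ℝ, 𝔼) (extChartAt (𝓡 m) p₀) (φ s p) :=
      mdifferentiableAt_extChartAt (by rwa [extChartAt_source] at hsrc)
    have h1 := mfderiv_eq_fderiv_toChart (mem_extChartAt_source (I := 𝓡 m) p)
      (f := fun q => extChartAt (𝓡 m) p₀ (φ s q)) (hψ.comp p hφs) v
    have h2 := congrArg (fun L => L (toChart p p v)) (hasFDerivAt_space_of_isOpen hN hs hxN
      (hfs.differentiableOn (by simp) (s, x) ⟨hs, hxN⟩)).fderiv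
    have h3 : mfderiv (𝓡 m) 𝓘(ℝ, 𝔼) (fun q => extChartAt (𝓡 m) p₀ (φ s q)) p v =
        toChart p₀ (φ s p) (mfderiv (𝓡 m) (𝓡 m) (φ s) p v) :=
      congrArg (fun T => T v) (mfderiv_comp p hψ hφs)
    have h4 : fderivWithin ℝ f (Icc a b ×ˢ N) (s, x) (0, toChart p p v) =
        toChart p₀ (φ s p) (mfderiv (𝓡 m) (𝓡 m) (φ s) p v) := by
      rw [← h3, h1]
      exact h2.symm
    rw [h4, hf]
    simp only [hxp]
    rw [inChart_toChart _ hsrc]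
    rfl
  have hcx : c t ((extChartAt (𝓡 m) p₀).symm (f (t, x))) = c t (φ t p) := by
    simp only [hf, hxp]
    rw [← hp₀, extChartAt_to_inv]
  have h := hmain.congr_of_mem (fun s hs => (hpull s hs).symm) htJ
  refine (h.congr_deriv ?_).mono_of_mem_nhdsWithin hJt
  rw [← hcx]
  exact congrArg _ (hpull t htJ)

end OneForm

end

/-! ### Assembly of the isotopy and of the conformal factors -/

theorem theorem5 {n h : ℕ} (hn : h ≤ n) {M : Type*} [TopologicalSpace M]
    [ChartedSpace (EuclideanSpace ℝ (Fin (2 * n + 2))) M] [IsManifold (𝓡 (2 * n + 2)) ∞ M]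
    [T2Space M] [CompactSpace M]
    (α β : ℝ → OneForm (2 * n + 2) M)
    (hα : OneForm.IsSmoothFamily α) (hβ : OneForm.IsSmoothFamily β)
    (hαβ : ∀ t ∈ Icc (0 : ℝ) 1,
      IsContactContactStructure h (n - h) (α t).kernelField (β t).kernelField)
    (hF : ∀ t ∈ Icc (0 : ℝ) 1, (α t).charDistribution h = (α 0).charDistribution h)
    (hG : ∀ t ∈ Icc (0 : ℝ) 1, (β t).charDistribution (n - h) = (β 0).charDistribution (n - h)) :
    ∃ (φ : ℝ → M → M) (f g : ℝ → M → ℝ), IsIsotopy (m := 2 * n + 2) φ ∧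
      IsSmoothNonvanishingFamily (m := 2 * n + 2) f ∧
      IsSmoothNonvanishingFamily (m := 2 * n + 2) g ∧
      ∀ t ∈ Icc (0 : ℝ) 1, ∀ p : M,
        OneForm.pullback (φ t) (α t) p = f t p • α 0 p ∧
        OneForm.pullback (φ t) (β t) p = g t p • β 0 p := by
  obtain ⟨ι, _, ⟨R⟩⟩ := exists_retractedEmbedding (m := 2 * n + 2) (M := M)
  have h00 : (0 : ℝ) ∈ Icc (0 : ℝ) 1 := ⟨le_rfl, zero_le_one⟩
  have hst := fun t ht p => OneForm.isCompl_charField hα hβ (t := t) ht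
    (m := 2 * n + 2) (h := h) (k := n - h) (by omega) (hαβ t ht) p
  have hα0 : ∀ t ∈ Icc (0 : ℝ) 1, ∀ p, α t p ≠ 0 := fun t ht p => (hst t ht p).1
  have hβ0 : ∀ t ∈ Icc (0 : ℝ) 1, ∀ p, β t p ≠ 0 := fun t ht p => (hst t ht p).2.1
  have hcompl : ∀ t ∈ Icc (0 : ℝ) 1, ∀ p, IsCompl ((α t).charField p) ((β t).charField p) :=
    fun t ht p => (hst t ht p).2.2.1
  -- The characteristic space at time `t` lies in the leaf directions, which are the same at time
  -- `s` and are contained in the kernel of α_s.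
  have hαc : ∀ s ∈ Icc (0 : ℝ) 1, ∀ t ∈ Icc (0 : ℝ) 1, ∀ p, ∀ v ∈ (α t).charField p, α s p v = 0 :=
    fun s hs t ht p v hv => by
      have h1 := OneForm.charField_le_charDistribution (α t) h p hv
      rw [hF t ht, ← hF s hs] at h1
      exact (hst s hs p).2.2.2.1 h1
  have hβc : ∀ s ∈ Icc (0 : ℝ) 1, ∀ t ∈ Icc (0 : ℝ) 1, ∀ p, ∀ v ∈ (β t).charField p, β s p v = 0 :=
    fun s hs t ht p v hv => by
      have h1 := OneForm.charField_le_charDistribution (β t) (n - h) p hv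
      rw [hG t ht, ← hG s hs] at h1
      exact (hst s hs p).2.2.2.2 h1
  have hex : ∀ t p, ∃ (X : TangentSpace (𝓡 (2 * n + 2)) p) (c d : ℝ), t ∈ Icc (0 : ℝ) 1 →
      OneForm.IsMoser α t p X c ∧ OneForm.IsMoser β t p X d := fun t p => by
    by_cases ht : t ∈ Icc (0 : ℝ) 1
    · obtain ⟨X, c, d, hX⟩ := OneForm.exists_isMoser hα hβ hcompl hαc hβc ht p
      exact ⟨X, c, d, fun _ => hX⟩
    · exact ⟨0, 0, 0, fun h => absurd h ht⟩
  choose X c d hX using hex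
  have hXα := fun t ht p => (hX t p ht).1
  have hXβ := fun t ht p => (hX t p ht).2
  have hsmooth := OneForm.contDiffOn_of_isMoser hα hβ hα0 hβ0 hcompl hXα hXβ
  have hXs := fun p₀ => contDiff_fst.comp_contDiffOn (hsmooth p₀)
  have hl := OneForm.contMDiffOn_of_chart (f := fun x : ℝ × M => (c x.1 x.2, d x.1 x.2))
    fun p₀ => contDiff_snd.comp_contDiffOn (hsmooth p₀)
  have hg := OneForm.contMDiffOn_mfderiv R.smooth_e hXs
  have htan : ∀ t ∈ Icc (0 : ℝ) 1, ∀ p, ∃ v : TangentSpace (𝓡 (2 * n + 2)) p,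
      mfderiv (𝓡 (2 * n + 2)) 𝓘(ℝ, ι → EuclideanSpace ℝ (Fin (2 * n + 2)) × ℝ) R.e p (X t p) =
        mfderiv (𝓡 (2 * n + 2)) 𝓘(ℝ, ι → EuclideanSpace ℝ (Fin (2 * n + 2)) × ℝ) R.e p v :=
    fun t ht p => ⟨X t p, rfl⟩
  obtain ⟨φ, z, hφ0, hz0, hφ, hz, hφc, hzd⟩ := R.exists_flow hg hl htan
  have hz1 : ∀ p, ∀ t ∈ Icc (0 : ℝ) 1,
      HasDerivWithinAt (fun t => (z t p).1) (c t (φ t p)) (Icc 0 1) t := fun p t ht =>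
    (hasFDerivAt_fst (𝕜 := ℝ) (E := ℝ) (F := ℝ)).comp_hasDerivWithinAt t (hzd p t ht)
  have hz2 : ∀ p, ∀ t ∈ Icc (0 : ℝ) 1,
      HasDerivWithinAt (fun t => (z t p).2) (d t (φ t p)) (Icc 0 1) t := fun p t ht =>
    (hasFDerivAt_snd (𝕜 := ℝ) (E := ℝ) (F := ℝ)).comp_hasDerivWithinAt t (hzd p t ht)
  have hpull0 : ∀ (θ : OneForm (2 * n + 2) M) p v, OneForm.pullback (φ 0) θ p v = θ p v :=
    fun θ p v => by
      rw [hφ0]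
      simp only [OneForm.pullback]
      rw [mfderiv_id]
      rfl
  -- The factors are exponentials of the integrals of `c` and `d` along the flow, hence positive and
  -- equal to 1 at time zero.
  refine ⟨φ, fun t p => Real.exp (z t p).1, fun t p => Real.exp (z t p).2,
    R.isIsotopy_of_isCurve hg htan hφ0 hφ hφc,
    ⟨(Real.contDiff_exp.comp contDiff_fst).contMDiff.comp_contMDiffOn hz,
      fun t ht p => (Real.exp_pos _).ne'⟩,
    ⟨(Real.contDiff_exp.comp contDiff_snd).contMDiff.comp_contMDiffOn hz,
      fun t ht p => (Real.exp_pos _).ne'⟩, fun t ht p => ⟨?_, ?_⟩⟩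
  · ext v
    have h1 := eq_exp_mul_of_hasDerivWithinAt
      (fun s hs => OneForm.hasDerivWithinAt_pullback hα hXs hXα hφ hφc p v hs) (hz1 p)
      (by rw [hz0]; rfl) ht
    rw [hpull0] at h1
    exact h1
  · ext v
    have h1 := eq_exp_mul_of_hasDerivWithinAt
      (fun s hs => OneForm.hasDerivWithinAt_pullback hβ hXs hXβ hφ hφc p v hs) (hz2 p)
      (by rw [hz0]; rfl) ht
    rw [hpull0] at h1
    exact h1
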